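/- Let $T>0$, $p\in(2,3)$, $d\in\mathbb N_0$, and let $\mathbf X=(X,\mathbb X^{(2)})$ be a continuous $p$-rough path on $[0,T]$ over $\mathbb R^d$: $X\colon[0,T]\to\mathbb R^d$ is continuous of finite $p$-variation, $\mathbb X^{(2)}\colon\Delta_T\to\mathbb R^{d\times d}$ is continuous of finite $p/2$-variation on $\Delta_T=\{0\le s\le t\le T\}$, and $\mathbb X^{(2)}_{s,t}=\mathbb X^{(2)}_{s,u}+\mathbb X^{(2)}_{u,t}+X_{s,u}\otimes X_{u,t}$ for $s\le u\le t$, where $X_{s,t}=X_t-X_s$. Let $[\mathbf X]_t=X_{0,t}\otimes X_{0,t}-(\mathbb X^{(2)}_{0,t}+(\mathbb X^{(2)}_{0,t})^\top)$ be its bracket, $Q(X)=([\mathbf X]^{ij})_{1\le i\le j\le d}$, $\hat d=1+d+\frac{d(d+1)}2$, and $\widehat X_t=(t,X_t,Q(X)_t)\in\mathbb R^{\hat d}$. Write $e_0,e_1,\dots,e_d,(\epsilon_{ij})_{1\le i\le j\le d}$ for the corresponding canonical basis of $\mathbb R^{\hat d}$, also numbered $e_0,\dots,e_{\hat d-1}$;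 set $\epsilon_{ji}=\epsilon_{ij}$, and $\epsilon_{ij}=0$ if $i,j\in\{0,\dots,\hat d-1\}$ are not both in $\{1,\dots,d\}$. For a multi-index $I=(i_1,\dots,i_n)$ with entries in $\{0,\dots,\hat d-1\}$ let $e_I=e_{i_1}\otimes\dots\otimes e_{i_n}$ and, if $n\ge1$, $I'=(i_1,\dots,i_{n-1})$. Let $\widehat{\mathbb X}^{(2)}$ be the canonical second level over $\widehat X$: $(\widehat{\mathbb X}^{(2)}_{s,t})^{ij}=(\mathbb X^{(2)}_{s,t})^{ij}$ for $i,j\in\{1,\dots,d\}$, and $(\widehat{\mathbb X}^{(2)}_{s,t})^{ij}=\int_s^t\widehat X^i_{s,r}\,\mathrm d\widehat X^j_r$ (Young integral, the limit of left-point Riemann sums) for all other $i,j$. These integrals exist, $\widehat{\mathbf X}=(\widehat X,\widehat{\mathbb X}^{(2)})$ is a $p$-rough path over $\mathbb R^{\hat d}$, and, with $[\widehat{\mathbf X}]$ its bracket, the corrected path $(\widehat X,\widehat{\mathbb X}^{(2)}+\frac12[\widehat{\mathbf X}])$ (second level $\widehat{\mathbb X}^{(2)}_{s,t}+\frac12([\widehat{\mathbf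 X}]_t-[\widehat{\mathbf X}]_s)$) is a weakly geometric $p$-rough path, i.e. $(1,\widehat X_{0,t},\widehat{\mathbb X}^{(2)}_{0,t}+\frac12[\widehat{\mathbf X}]_t)$ lies in the free step-2 nilpotent group $G^2(\mathbb R^{\hat d})$ for all $t$. A Lyons extension of a rough path $(Y,\mathbb Y^{(2)})$ is a continuous map $(s,t)\mapsto\mathbb Y_{s,t}\in T((\mathbb R^{\hat d}))=\prod_{n\ge0}(\mathbb R^{\hat d})^{\otimes n}$ on $\Delta_T$ whose components of level $0,1,2$ are $1$, $Y_{s,t}$, $\mathbb Y^{(2)}_{s,t}$, which satisfies $\mathbb Y_{s,t}=\mathbb Y_{s,u}\otimes\mathbb Y_{u,t}$ for $s\le u\le t$, and whose level $n$ has finite $p/n$-variation for every $n\ge1$; one writes $\mathbb Y_t=\mathbb Y_{0,t}$. Then $\widehat{\mathbf X}$ has a Lyons extension $\widehat{\mathbb X}$, and $(\widehat X,\widehat{\mathbb X}^{(2)}+\frac12[\widehat{\mathbf X}])$ has a Lyons extension $\widehat{\mathbb X}^o$; and for any such extensions, for all $t\in[0,T]$, $\widehat{\mathbb X}^o_t$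 is group-like, i.e. the tensor exponential of a Lie series, and for every multi-index $I$ with entries in $\{0,\dots,\hat d-1\}$ $$\langle e_I,\widehat{\mathbb X}_t\rangle=\langle\ell^I,\widehat{\mathbb X}^o_t\rangle ,$$ where $\ell^I\in T(\mathbb R^{\hat d})=\bigoplus_{n\ge0}(\mathbb R^{\hat d})^{\otimes n}$ is defined recursively by $\ell^\emptyset=e_\emptyset$, $\ell^{(i_1)}=e_{i_1}$ and, for $n=|I|\ge2$, $$\ell^I=\ell^{I'}\otimes e_{i_n}-\tfrac12\,\ell^{(I')'}\otimes\epsilon_{i_{n-1}i_n}.$$ -/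

import Mathlib

noncomputable section

/-! ### Tensor algebra and tensor series over `ℝ^ι`, in the basis of words -/

/-- The tensor algebra `T(ℝ^ι)`: finite real linear combinations of words in the letters `ι`.
The word `(i₁, …, iₙ)` stands for `e_{i₁} ⊗ ⋯ ⊗ e_{iₙ}`, and the product is `⊗`. -/
abbrev TensorPoly (ι : Type) : Type := MonoidAlgebra ℝ (FreeMonoid ι)

/-- The extended tensor algebra `T((ℝ^ι))`: an element is given by its coefficients `a_I`. -/
abbrev TensorSeries (ι : Type) : Type := List ι → ℝ

/-- The basis tensor `e_I`. -/
def basisTensor {ι : Type} (I : List ι) : TensorPoly ι :=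
  MonoidAlgebra.single (FreeMonoid.ofList I) 1

/-- The pairing `⟨ℓ, a⟩ = ∑_I ℓ_I a_I` of `T(ℝ^ι)` with `T((ℝ^ι))`. -/
def tensorPairing {ι : Type} (l : TensorPoly ι) (a : TensorSeries ι) : ℝ :=
  Finsupp.sum l.coeff fun w c => c * a w.toList

/-- The product `a ⊗ b` in `T((ℝ^ι))`. -/
def TensorSeries.tmul {ι : Type} (a b : TensorSeries ι) : TensorSeries ι := fun w =>
  ∑ k ∈ Finset.range (w.length + 1), a (w.take k) * b (w.drop k)

/-- The unit `(1, 0, 0, …)` of `T((ℝ^ι))`. -/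
def TensorSeries.unit {ι : Type} : TensorSeries ι
  | [] => 1
  | _ :: _ => 0

/-- The powers `a^{⊗ k}`. -/
def TensorSeries.tpow {ι : Type} (a : TensorSeries ι) : ℕ → TensorSeries ι
  | 0 => TensorSeries.unit
  | k + 1 => TensorSeries.tmul (TensorSeries.tpow a k) a

/-- The tensor exponential `∑_k a^{⊗ k} / k!` of a series `a` without constant term; then
`a^{⊗ k}` has no component of level `< k`, so the sum is finite at every word. -/
def TensorSeries.texp {ι : Type} (a : TensorSeries ι) : TensorSeries ι := fun w =>
  ∑ k ∈ Finset.range (w.length + 1), ((k.factorial : ℝ))⁻¹ * TensorSeries.tpow a k w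

/-- The component of level `n` of a series, as an element of the tensor algebra. -/
def TensorSeries.level {ι : Type} [Fintype ι] (a : TensorSeries ι) (n : ℕ) : TensorPoly ι :=
  ∑ v : Fin n → ι, a (List.ofFn v) • basisTensor (List.ofFn v)

attribute [local instance] LieRing.ofAssociativeRing

/-- Lie series: every homogeneous component lies in the Lie algebra generated by the letters
(with the commutator bracket of the tensor algebra). In particular the constant term is `0`. -/
def TensorSeries.IsLie {ι : Type} [Fintype ι] (a : TensorSeries ι) : Prop :=
  ∀ n : ℕ, TensorSeries.level a n ∈
    LieSubalgebra.lieSpan ℝ (TensorPoly ι) (Set.range fun i : ι => basisTensor [i])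

/-- The group-like elements `G((ℝ^ι))`: exponentials of Lie series. -/
def TensorSeries.IsGroupLike {ι : Type} [Fintype ι] (g : TensorSeries ι) : Prop :=
  ∃ a : TensorSeries ι, TensorSeries.IsLie a ∧ g = TensorSeries.texp a

/-! ### Partitions, variation, Young integrals -/

/-- The simplex `Δ_T`. -/
def timeSimplex (T : ℝ) : Set (ℝ × ℝ) := {q | 0 ≤ q.1 ∧ q.1 ≤ q.2 ∧ q.2 ≤ T}

/-- `s = u 0 < u 1 < ⋯ < u n = t`. -/
def IsPartitionOf (s t : ℝ) (n : ℕ) (u : ℕ → ℝ) : Prop :=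
  u 0 = s ∧ u n = t ∧ ∀ k < n, u k < u (k + 1)

/-- The Euclidean norm of a finite family of real numbers. -/
def euclNorm {κ : Type} [Fintype κ] (x : κ → ℝ) : ℝ := ‖WithLp.toLp 2 x‖

/-- A two-parameter function has finite `r`-variation on `[0,T]`. -/
def HasFiniteVar {κ : Type} [Fintype κ] (r T : ℝ) (F : ℝ → ℝ → κ → ℝ) : Prop :=
  ∃ C : ℝ, ∀ (n : ℕ) (u : ℕ → ℝ), IsPartitionOf 0 T n u →
    ∑ k ∈ Finset.range n, euclNorm (F (u k) (u (k + 1))) ^ r ≤ C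

/-- `∫_s^t f dg` exists and equals `J`, as the limit of the left-point Riemann sums along
partitions of `[s,t]` with vanishing mesh. -/
def HasYoungIntegral (f g : ℝ → ℝ) (s t J : ℝ) : Prop :=
  ∀ ε > 0, ∃ δ > 0, ∀ (n : ℕ) (u : ℕ → ℝ), IsPartitionOf s t n u →
    (∀ k < n, u (k + 1) - u k < δ) →
    |∑ k ∈ Finset.range n, f (u k) * (g (u (k + 1)) - g (u k)) - J| < ε

/-! ### Rough paths and Lyons' extension -/

/-- `(X, X2)` is a continuous rough path on `[0,T]` over `ℝ^ι`, of finite `p`-variation. -/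
structure IsRoughPath {ι : Type} [Fintype ι] (p T : ℝ) (X : ℝ → ι → ℝ)
    (X2 : ℝ → ℝ → Matrix ι ι ℝ) : Prop where
  continuousOn_path : ContinuousOn X (Set.Icc 0 T)
  var_path : HasFiniteVar p T fun s t => X t - X s
  continuousOn_lift : ContinuousOn (fun q : ℝ × ℝ => X2 q.1 q.2) (timeSimplex T)
  var_lift : HasFiniteVar (p / 2) T fun s t (q : ι × ι) => X2 s t q.1 q.2
  chen : ∀ s u t : ℝ, 0 ≤ s → s ≤ u → u ≤ t → t ≤ T → ∀ i j : ι,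
    X2 s t i j = X2 s u i j + X2 u t i j + (X u i - X s i) * (X t j - X u j)

/-- `(X, X2)` is a weakly geometric rough path: `(1, X_{0,t}, X2_{0,t})` is the truncation to
level two of a group-like element, for all `t`. -/
structure IsWeaklyGeometric {ι : Type} [Fintype ι] (p T : ℝ) (X : ℝ → ι → ℝ)
    (X2 : ℝ → ℝ → Matrix ι ι ℝ) : Prop extends IsRoughPath p T X X2 where
  mem_group : ∀ t ∈ Set.Icc 0 T, ∃ g : TensorSeries ι, TensorSeries.IsGroupLike g ∧
    (∀ i, g [i] = X t i - X 0 i) ∧ ∀ i j, g [i, j] = X2 0 t i j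

/-- `S` is Lyons' extension of `(1, X, X2)`: a continuous multiplicative functional with values
in `T((ℝ^ι))`, of finite `p`-variation at all levels, which extends `(1, X, X2)`. -/
structure IsLyonsExtension {ι : Type} [Fintype ι] (p T : ℝ) (X : ℝ → ι → ℝ)
    (X2 : ℝ → ℝ → Matrix ι ι ℝ) (S : ℝ → ℝ → TensorSeries ι) : Prop where
  level_zero : ∀ s t : ℝ, 0 ≤ s → s ≤ t → t ≤ T → S s t [] = 1
  level_one : ∀ s t : ℝ, 0 ≤ s → s ≤ t → t ≤ T → ∀ i, S s t [i] = X t i - X s i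
  level_two : ∀ s t : ℝ, 0 ≤ s → s ≤ t → t ≤ T → ∀ i j, S s t [i, j] = X2 s t i j
  chen : ∀ s u t : ℝ, 0 ≤ s → s ≤ u → u ≤ t → t ≤ T →
    S s t = TensorSeries.tmul (S s u) (S u t)
  continuousOn : ∀ I : List ι, ContinuousOn (fun q : ℝ × ℝ => S q.1 q.2 I) (timeSimplex T)
  var : ∀ n : ℕ, 1 ≤ n →
    HasFiniteVar (p / n) T fun s t (v : Fin n → ι) => S s t (List.ofFn v)

/-- The rough path bracket `[𝐗]_t = X_{0,t} ⊗ X_{0,t} - (X2_{0,t} + X2_{0,t}ᵀ)`. -/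
def roughBracket {ι : Type} (X : ℝ → ι → ℝ) (X2 : ℝ → ℝ → Matrix ι ι ℝ) (t : ℝ) :
    Matrix ι ι ℝ :=
  Matrix.vecMulVec (X t - X 0) (X t - X 0) - (X2 0 t + (X2 0 t).transpose)

/-- The second level `X2 + ½ [𝐗]`, as a two-parameter function: `X2_{s,t} + ½ [𝐗]_{s,t}`. -/
def correctedLift {ι : Type} (X : ℝ → ι → ℝ) (X2 : ℝ → ℝ → Matrix ι ι ℝ) (s t : ℝ) :
    Matrix ι ι ℝ :=
  X2 s t + (1 / 2 : ℝ) • (roughBracket X X2 t - roughBracket X X2 s)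

/-! ### The extension by time and bracket -/

/-- The `1 + d + d (d + 1) / 2` coordinates of the extended path: time, the coordinates of the
path, and the bracket terms `[𝐗]^{ij}`, `i ≤ j`. -/
inductive ExtIndex (d : ℕ) : Type
  | time : ExtIndex d
  | path (i : Fin d) : ExtIndex d
  | bracket (q : {q : Fin d × Fin d // q.1 ≤ q.2}) : ExtIndex d
  deriving DecidableEq, Fintype

/-- The extended path `X̂ = (·, X, Q(X))`. -/
def extPath {d : ℕ} (X : ℝ → Fin d → ℝ) (X2 : ℝ → ℝ → Matrix (Fin d) (Fin d) ℝ) (t : ℝ) :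
    ExtIndex d → ℝ
  | .time => t
  | .path i => X t i
  | .bracket q => roughBracket X X2 t q.1.1 q.1.2

/-- `Y2` is the canonical second level over `X̂`: it is `X2` on pairs of coordinates of the path,
and it is given by Young integrals on all other pairs. -/
structure IsCanonicalLift {d : ℕ} (T : ℝ) (X : ℝ → Fin d → ℝ)
    (X2 : ℝ → ℝ → Matrix (Fin d) (Fin d) ℝ)
    (Y2 : ℝ → ℝ → Matrix (ExtIndex d) (ExtIndex d) ℝ) : Prop where
  path_path : ∀ s t : ℝ, 0 ≤ s → s ≤ t → t ≤ T → ∀ i j : Fin d,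
    Y2 s t (.path i) (.path j) = X2 s t i j
  young : ∀ s t : ℝ, 0 ≤ s → s ≤ t → t ≤ T → ∀ a b : ExtIndex d,
    ¬ ((∃ i, a = .path i) ∧ ∃ j, b = .path j) →
    HasYoungIntegral (fun r => extPath X X2 r a - extPath X X2 s a)
      (fun r => extPath X X2 r b) s t (Y2 s t a b)

/-- `ε_{ab}`: the basis vector of the coordinate `[𝐗]^{ij} = [𝐗]^{ji}` when `a, b` are the
coordinates `i, j` of the path, and `0` otherwise. -/
def epsTensor {d : ℕ} : ExtIndex d → ExtIndex d → TensorPoly (ExtIndex d)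
  | .path i, .path j => basisTensor [.bracket ⟨(min i j, max i j), min_le_max⟩]
  | _, _ => 0

/-- `ℓ^I` as a function of the reversed word, so that the recursion removes the last letters. -/
def ellReverse {d : ℕ} : List (ExtIndex d) → TensorPoly (ExtIndex d)
  | [] => 1
  | [a] => basisTensor [a]
  | b :: a :: J =>
      ellReverse (a :: J) * basisTensor [b] - (1 / 2 : ℝ) • (ellReverse J * epsTensor a b)

/-- The coefficients `ℓ^I`. -/
def ellCoeff {d : ℕ} (I : List (ExtIndex d)) : TensorPoly (ExtIndex d) := ellReverse I.reverse

theorem ellCoeff_nil {d : ℕ} : ellCoeff ([] : List (ExtIndex d)) = basisTensor [] := rfl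

theorem ellCoeff_singleton {d : ℕ} (a : ExtIndex d) : ellCoeff [a] = basisTensor [a] := rfl

/-- The recursion `ℓ^I = ℓ^{I'} ⊗ e_{i_n} - ½ ℓ^{(I')'} ⊗ ε_{i_{n-1} i_n}`. -/
theorem ellCoeff_append {d : ℕ} (J : List (ExtIndex d)) (a b : ExtIndex d) :
    ellCoeff (J ++ [a, b]) =
      ellCoeff (J ++ [a]) * basisTensor [b] - (1 / 2 : ℝ) • (ellCoeff J * epsTensor a b) := by
  simp [ellCoeff, ellReverse]

end

/-!
Everything rests on one uniqueness principle: a function of two times that is additive and bounded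
by a power `θ > 1` of a control vanishes. Its existence counterpart, the sewing lemma, produces both
the Young integrals and, level by level, Lyons' extension.

On a pair of coordinates whose lift is a Young integral, the defect of the product rule is additive
and of exponent greater than `1`; so the bracket of the extended path is supported on the pairs of
coordinates of the original path, where it is itself a coordinate of the extended path.

The corrected lift satisfies the product rule on all pairs. By uniqueness its Lyons extension is a
character of the shuffle algebra, so its logarithm annihilates shuffles of nonempty words; Dynkin's
operator, written through the antipode of the shuffle algebra, then multiplies the level `n` of this
logarithm by `n`, which exhibits it as a Lie series.

The transpose of `e_I ↦ ℓ^I` is multiplicative for `⊗`. Hence both sides of the identity to be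
proved are multiplicative functionals; they agree up to level two by the formula for the bracket,
and at higher levels their difference is additive. A bracket letter, which replaces two letters of
the path in `ℓ^I`, has twice their regularity, so the difference has exponent greater than `1`.
-/

open Filter Topology TensorSeries

/-! ### Controls -/

/-- `x` is the sum of `N (u k) (u (k + 1))` over the `n` intervals of a partition of `[s,t]`. -/
inductive IsPartitionSum (N : ℝ → ℝ → ℝ) (s : ℝ) : ℕ → ℝ → ℝ → Prop
  | refl : IsPartitionSum N s 0 s 0
  | snoc {n : ℕ} {u t x : ℝ} : IsPartitionSum N s n u x → u < t →
      IsPartitionSum N s (n + 1) t (x + N u t)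

namespace IsPartitionSum

variable {N : ℝ → ℝ → ℝ} {n m : ℕ} {s t u x y : ℝ}

theorem le (h : IsPartitionSum N s n t x) : s ≤ t := by
  induction h with
  | refl => exact le_rfl
  | snoc _ hut ih => exact ih.trans hut.le

theorem single (h : s < t) : IsPartitionSum N s 1 t (N s t) := by
  simpa only [zero_add] using IsPartitionSum.snoc (N := N) refl h

theorem trans (h : IsPartitionSum N s n u x) (h' : IsPartitionSum N u m t y) :
    IsPartitionSum N s (n + m) t (x + y) := by
  induction h' with
  | refl => simpa only [add_zero] using h
  | snoc _ hut ih => rw [← add_assoc, ← add_assoc]; exact ih.snoc hut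

theorem eq_zero_of_self (h : IsPartitionSum N s n s x) : x = 0 := by
  cases h with
  | refl => rfl
  | snoc hsu hus => exact absurd hsu.le hus.not_ge

theorem exists_isPartitionOf (h : IsPartitionSum N s n t x) :
    ∃ u, IsPartitionOf s t n u ∧ ∑ k ∈ Finset.range n, N (u k) (u (k + 1)) = x := by
  induction h with
  | refl => exact ⟨fun _ => s, ⟨rfl, rfl, by simp⟩, by simp⟩
  | @snoc n v t x _ hvt ih =>
    obtain ⟨u, ⟨h0, hn, hlt⟩, hsum⟩ := ih
    refine ⟨fun k => if k ≤ n then u k else t, ⟨by simp [h0], by simp, fun k hk => ?_⟩, ?_⟩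
    · rcases Nat.lt_succ_iff_lt_or_eq.1 hk with hk | rfl
      · simpa [hk.le, Nat.succ_le_iff.2 hk] using hlt k hk
      · simpa [hn] using hvt
    · rw [Finset.sum_range_succ, ← hsum]
      congr 1
      · refine Finset.sum_congr rfl fun k hk => ?_
        have hk := Finset.mem_range.1 hk
        simp [hk.le, Nat.succ_le_iff.2 hk]
      · simp [hn]

theorem exists_head (h : IsPartitionSum N s n t x) (hst : s < t) :
    ∃ m v y, s < v ∧ IsPartitionSum N v m t y ∧ x = N s v + y := by
  induction h with
  | refl => exact absurd hst (lt_irrefl _)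
  | @snoc n u t x hu hut ih =>
    rcases hu.le.eq_or_lt with rfl | hsu
    · exact ⟨0, t, 0, hut, refl, by rw [hu.eq_zero_of_self, add_comm]⟩
    · obtain ⟨m, v, y, hsv, hv, rfl⟩ := ih hsu
      exact ⟨m + 1, v, y + N u t, hsv, hv.snoc hut, add_assoc _ _ _⟩

theorem exists_crossing (h : IsPartitionSum N s n t x) (hst : s < t) {f : ℝ → ℝ} {c : ℝ}
    (hs : f s ≤ c) (ht : c ≤ f t) :
    ∃ k m v w y z, n = k + 1 + m ∧ v < w ∧ f v ≤ c ∧ c ≤ f w ∧ IsPartitionSum N s k v y ∧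
      IsPartitionSum N w m t z ∧ x = y + N v w + z := by
  induction h with
  | refl => exact absurd hst (lt_irrefl _)
  | @snoc n u t x hu hut ih =>
    rcases le_total (f u) c with huc | huc
    · exact ⟨n, 0, u, t, x, 0, rfl, hut, huc, ht, hu, refl, (add_zero _).symm⟩
    rcases hu.le.eq_or_lt with rfl | hsu
    · exact ⟨n, 0, s, t, x, 0, rfl, hut, hs, ht, hu, refl, (add_zero _).symm⟩
    · obtain ⟨k, m, v, w, y, z, rfl, hvw, hv, hw, hy, hz, rfl⟩ := ih hsu huc
      exact ⟨k, m + 1, v, w, y, z + N u t, rfl, hvw, hv, hw, hy, hz.snoc hut,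
        (add_assoc _ _ _)⟩

end IsPartitionSum

theorem isCompact_timeSimplex (T : ℝ) : IsCompact (timeSimplex T) := by
  refine (isCompact_Icc (a := ((0 : ℝ), (0 : ℝ))) (b := (T, T))).of_isClosed_subset ?_ ?_
  · exact (isClosed_le continuous_const continuous_fst).inter
      ((isClosed_le continuous_fst continuous_snd).inter
        (isClosed_le continuous_snd continuous_const))
  · rintro ⟨s, t⟩ ⟨hs, hst, ht⟩
    exact ⟨⟨hs, hs.trans hst⟩, ⟨hst.trans ht, ht⟩⟩

/-- Non-negative functions on the simplex, vanishing on the diagonal, whose sums along partitions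
are bounded; for example `|F s t| ^ r` for a function `F` of finite `r`-variation. -/
structure HasBoundedPartitionSums (T C : ℝ) (N : ℝ → ℝ → ℝ) : Prop where
  nonneg : ∀ s t, 0 ≤ s → s ≤ t → t ≤ T → 0 ≤ N s t
  diag : ∀ s, 0 ≤ s → s ≤ T → N s s = 0
  sum_le : ∀ n x, IsPartitionSum N 0 n T x → x ≤ C

/-- The supremum of the sums of `N` along the partitions of `[s,t]`. -/
noncomputable def partitionSup (N : ℝ → ℝ → ℝ) (s t : ℝ) : ℝ :=
  sSup {x | ∃ n, IsPartitionSum N s n t x}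

theorem exists_isPartitionSum (N : ℝ → ℝ → ℝ) {s t : ℝ} (hst : s ≤ t) :
    ∃ x n, IsPartitionSum N s n t x := by
  rcases hst.eq_or_lt with rfl | hlt
  · exact ⟨0, 0, .refl⟩
  · exact ⟨_, _, .single hlt⟩

theorem partitionSup_le {C : ℝ} {N : ℝ → ℝ → ℝ} {s t : ℝ} (hst : s ≤ t)
    (h : ∀ n x, IsPartitionSum N s n t x → x ≤ C) :
    partitionSup N s t ≤ C :=
  csSup_le (exists_isPartitionSum N hst) fun x ⟨n, hx⟩ => h n x hx

namespace HasBoundedPartitionSums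

variable {T C : ℝ} {N : ℝ → ℝ → ℝ} {s t u x : ℝ} {n : ℕ}

theorem le_of_isPartitionSum (hN : HasBoundedPartitionSums T C N) (hs : 0 ≤ s) (ht : t ≤ T)
    (hx : IsPartitionSum N s n t x) : x ≤ C := by
  obtain ⟨m, y, hy, hxy⟩ : ∃ m y, IsPartitionSum N 0 m t y ∧ x ≤ y := by
    rcases hs.eq_or_lt with rfl | hs'
    · exact ⟨n, x, hx, le_rfl⟩
    · exact ⟨1 + n, _, (IsPartitionSum.single hs').trans hx,
        le_add_of_nonneg_left (hN.nonneg 0 s le_rfl hs (hx.le.trans ht))⟩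
  rcases ht.eq_or_lt with rfl | ht'
  · exact hxy.trans (hN.sum_le _ _ hy)
  · linarith [hN.sum_le _ _ (hy.snoc ht'), hN.nonneg t T hy.le ht le_rfl]

theorem le_partitionSup (hN : HasBoundedPartitionSums T C N) (hs : 0 ≤ s) (ht : t ≤ T)
    (hx : IsPartitionSum N s n t x) : x ≤ partitionSup N s t :=
  le_csSup ⟨C, fun _ ⟨_, hy⟩ => hN.le_of_isPartitionSum hs ht hy⟩ ⟨n, hx⟩

theorem add_le_partitionSup (hN : HasBoundedPartitionSums T C N) (hs : 0 ≤ s) (hut : u ≤ t)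
    (ht : t ≤ T) (hx : IsPartitionSum N s n u x) : x + N u t ≤ partitionSup N s t := by
  rcases hut.eq_or_lt with rfl | hut
  · simpa only [hN.diag u (hs.trans hx.le) ht, add_zero] using hN.le_partitionSup hs ht hx
  · exact hN.le_partitionSup hs ht (hx.snoc hut)

theorem partitionSup_add_le (hN : HasBoundedPartitionSums T C N) (hs : 0 ≤ s) (hsu : s ≤ u)
    (hut : u ≤ t) (ht : t ≤ T) :
    partitionSup N s u + partitionSup N u t ≤ partitionSup N s t := by
  rw [← le_sub_iff_add_le]
  refine partitionSup_le hsu fun n x hx => ?_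
  rw [le_sub_comm]
  refine partitionSup_le hut fun m y hy => ?_
  rw [le_sub_iff_add_le']
  exact hN.le_partitionSup hs ht (hx.trans hy)

theorem le_partitionSup_self (hN : HasBoundedPartitionSums T C N) (hs : 0 ≤ s) (hst : s ≤ t)
    (ht : t ≤ T) : N s t ≤ partitionSup N s t := by
  simpa only [zero_add] using hN.add_le_partitionSup hs hst ht .refl

theorem partitionSup_nonneg (hN : HasBoundedPartitionSums T C N) (hs : 0 ≤ s) (hst : s ≤ t)
    (ht : t ≤ T) : 0 ≤ partitionSup N s t :=
  (hN.nonneg s t hs hst ht).trans (hN.le_partitionSup_self hs hst ht)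

theorem le_partitionSup_sub (hN : HasBoundedPartitionSums T C N) (hs : 0 ≤ s) (hst : s ≤ t)
    (ht : t ≤ T) : N s t ≤ partitionSup N 0 t - partitionSup N 0 s := by
  linarith [hN.partitionSup_add_le le_rfl hs hst ht, hN.le_partitionSup_self hs hst ht]

theorem monotoneOn_partitionSup (hN : HasBoundedPartitionSums T C N) :
    MonotoneOn (partitionSup N 0) (Set.Icc 0 T) := fun s hs t ht hst => by
  linarith [hN.le_partitionSup_sub hs.1 hst ht.2, hN.nonneg s t hs.1 hst ht.2]

/-- Cutting the interval of a partition of `[0,t]` that contains `t₀` costs at most `ε`. -/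
theorem partitionSup_le_add (hN : HasBoundedPartitionSums T C N) {t₀ ε : ℝ} (h0 : 0 ≤ t₀)
    (h1 : t₀ < t) (ht : t ≤ T)
    (hε : ∀ u v, 0 ≤ u → u ≤ t₀ → t₀ ≤ v → v ≤ t → N u v ≤ N u t₀ + ε) :
    partitionSup N 0 t ≤ partitionSup N 0 t₀ + partitionSup N t₀ t + ε := by
  refine partitionSup_le (h0.trans h1.le) fun n x hx => ?_
  obtain ⟨k, m, v, w, y, z, -, -, hv, hw, hy, hz, rfl⟩ :=
    hx.exists_crossing (f := id) (h0.trans_lt h1) h0 h1.le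
  simp only [id] at hv hw
  have hleft := hN.add_le_partitionSup le_rfl hv (h1.le.trans ht) hy
  have hright := hN.partitionSup_add_le h0 hw hz.le ht
  linarith [hε v w hy.le hv hw hz.le, hN.partitionSup_nonneg h0 hw (hz.le.trans ht),
    hN.le_partitionSup (h0.trans hw) ht hz]

variable (hNc : ContinuousOn (fun q : ℝ × ℝ => N q.1 q.2) (timeSimplex T))

include hNc in
/-- Moving the last point of a nearly optimal partition changes its sum continuously. -/
theorem eventually_lt_partitionSup (hN : HasBoundedPartitionSums T C N) {t₀ ε : ℝ}
    (ht₀ : t₀ ∈ Set.Icc 0 T) (hε : 0 < ε) :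
    ∀ᶠ t in 𝓝[Set.Icc 0 t₀] t₀, partitionSup N 0 t₀ - ε < partitionSup N 0 t := by
  obtain ⟨_, ⟨n, hx⟩, hlt⟩ := exists_lt_of_lt_csSup (exists_isPartitionSum N ht₀.1)
    (sub_lt_self (partitionSup N 0 t₀) (half_pos hε))
  cases hx with
  | refl => simpa using hε
  | @snoc n u _ x hu hut =>
    have hc : ContinuousWithinAt (fun r => N u r) (Set.Icc u t₀) t₀ :=
      ContinuousWithinAt.comp (f := fun r : ℝ => (u, r)) (t := timeSimplex T)
        (hNc (u, t₀) ⟨hu.le, hut.le, ht₀.2⟩) (by fun_prop)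
        (fun r hr => ⟨hu.le, hr.1, hr.2.trans ht₀.2⟩)
    have hnhds : 𝓝[Set.Icc 0 t₀] t₀ ≤ 𝓝[Set.Icc u t₀] t₀ :=
      nhdsWithin_le_of_mem (mem_of_superset (inter_mem self_mem_nhdsWithin
        (mem_nhdsWithin_of_mem_nhds (Ioi_mem_nhds hut))) fun r hr => ⟨le_of_lt hr.2, hr.1.2⟩)
    filter_upwards [hnhds (hc.eventually (lt_mem_nhds (sub_lt_self _ (half_pos hε)))),
      hnhds self_mem_nhdsWithin] with t ht htu
    linarith [hN.add_le_partitionSup le_rfl htu.1 (htu.2.trans ht₀.2) hu]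

include hNc in
/-- Moving the first point of a nearly optimal partition of `[t₀,T]` to `t` bounds from below what
is left for `[t,T]`. -/
theorem eventually_partitionSup_lt (hN : HasBoundedPartitionSums T C N) {t₀ ε : ℝ} (h0 : 0 ≤ t₀)
    (hT : t₀ < T) (hε : 0 < ε) : ∀ᶠ t in 𝓝[Set.Icc t₀ T] t₀, partitionSup N t₀ t < ε := by
  obtain ⟨_, ⟨n, hx⟩, hlt⟩ := exists_lt_of_lt_csSup (exists_isPartitionSum N hT.le)
    (sub_lt_self (partitionSup N t₀ T) (half_pos hε))
  obtain ⟨m, v, y, hv, hy, rfl⟩ := hx.exists_head hT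
  have hc : ContinuousWithinAt (fun r => N r v) (Set.Icc t₀ v) t₀ :=
    ContinuousWithinAt.comp (f := fun r : ℝ => (r, v)) (t := timeSimplex T)
      (hNc (t₀, v) ⟨h0, hv.le, hy.le⟩) (by fun_prop) (fun r hr => ⟨h0.trans hr.1, hr.2, hy.le⟩)
  have hnhds : 𝓝[Set.Icc t₀ T] t₀ ≤ 𝓝[Set.Icc t₀ v] t₀ :=
    nhdsWithin_le_of_mem (mem_of_superset (inter_mem self_mem_nhdsWithin
      (mem_nhdsWithin_of_mem_nhds (Iio_mem_nhds hv))) fun r hr => ⟨hr.1.1, le_of_lt hr.2⟩)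
  filter_upwards [hnhds (hc.eventually (lt_mem_nhds (sub_lt_self _ (half_pos hε)))),
    hnhds self_mem_nhdsWithin] with t ht htv
  have hT' := hN.partitionSup_add_le h0 htv.1 (htv.2.trans hy.le) le_rfl
  have hv' := hN.partitionSup_add_le (h0.trans htv.1) htv.2 hy.le le_rfl
  linarith [hN.le_partitionSup_self (h0.trans htv.1) htv.2 hy.le,
    hN.le_partitionSup (h0.trans hv.le) le_rfl hy]

include hNc in
theorem eventually_partitionSup_zero_lt (hN : HasBoundedPartitionSums T C N) {t₀ ε : ℝ}
    (ht₀ : t₀ ∈ Set.Icc 0 T) (hε : 0 < ε) :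
    ∀ᶠ t in 𝓝[Set.Icc t₀ T] t₀, partitionSup N 0 t < partitionSup N 0 t₀ + ε := by
  rcases ht₀.2.eq_or_lt with rfl | htT
  · filter_upwards [self_mem_nhdsWithin] with t ht
    rw [le_antisymm ht.2 ht.1]
    linarith
  obtain ⟨δ, hδ, hd⟩ := Metric.uniformContinuousOn_iff.1
    ((isCompact_timeSimplex T).uniformContinuousOn_of_continuous hNc) (ε / 2) (half_pos hε)
  filter_upwards [hN.eventually_partitionSup_lt hNc ht₀.1 htT (half_pos hε), self_mem_nhdsWithin,
    mem_nhdsWithin_of_mem_nhds (Iio_mem_nhds (lt_add_of_pos_right t₀ hδ))] with t ht htI htδ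
  rcases htI.1.eq_or_lt with rfl | hlt
  · linarith
  have hcut : ∀ u v, 0 ≤ u → u ≤ t₀ → t₀ ≤ v → v ≤ t → N u v ≤ N u t₀ + ε / 2 := by
    intro u v hu hut hv hvt
    have hdist : dist (u, v) (u, t₀) < δ := by
      rw [Prod.dist_eq, dist_self, Real.dist_eq, abs_of_nonneg (sub_nonneg.2 hv), max_lt_iff]
      exact ⟨hδ, by linarith [Set.mem_Iio.1 htδ]⟩
    have := hd (u, v) ⟨hu, hut.trans hv, hvt.trans htI.2⟩ (u, t₀) ⟨hu, hut, ht₀.2⟩ hdist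
    linarith [(abs_lt.1 this).2]
  linarith [hN.partitionSup_le_add ht₀.1 hlt htI.2 hcut]

include hNc in
theorem continuousOn_partitionSup (hN : HasBoundedPartitionSums T C N) :
    ContinuousOn (partitionSup N 0) (Set.Icc 0 T) := by
  intro t₀ ht₀
  rw [← Set.Icc_union_Icc_eq_Icc ht₀.1 ht₀.2]
  refine ContinuousWithinAt.union ?_ ?_ <;>
    refine tendsto_order.2 ⟨fun a ha => ?_, fun a ha => ?_⟩
  · simpa only [sub_sub_cancel] using hN.eventually_lt_partitionSup hNc ht₀ (sub_pos.2 ha)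
  · filter_upwards [self_mem_nhdsWithin] with t ht
    exact (hN.monotoneOn_partitionSup ⟨ht.1, ht.2.trans ht₀.2⟩ ht₀ ht.2).trans_lt ha
  · filter_upwards [self_mem_nhdsWithin] with t ht
    exact ha.trans_le (hN.monotoneOn_partitionSup ht₀ ⟨ht₀.1.trans ht.1, ht.2⟩ ht.1)
  · simpa only [add_sub_cancel] using hN.eventually_partitionSup_zero_lt hNc ht₀ (sub_pos.2 ha)

end HasBoundedPartitionSums

/-- A primitive of a continuous additive control on `[0,T]`. -/
structure IsControl (T : ℝ) (h : ℝ → ℝ) : Prop where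
  mono : MonotoneOn h (Set.Icc 0 T)
  cont : ContinuousOn h (Set.Icc 0 T)

theorem IsControl.sub_nonneg {T : ℝ} {h : ℝ → ℝ} (hh : IsControl T h) {s t : ℝ} (hs : 0 ≤ s)
    (hst : s ≤ t) (ht : t ≤ T) : 0 ≤ h t - h s :=
  _root_.sub_nonneg.2 (hh.mono ⟨hs, hst.trans ht⟩ ⟨hs.trans hst, ht⟩ hst)

theorem HasBoundedPartitionSums.isControl {T C : ℝ} {N : ℝ → ℝ → ℝ}
    (hN : HasBoundedPartitionSums T C N)
    (hNc : ContinuousOn (fun q : ℝ × ℝ => N q.1 q.2) (timeSimplex T)) :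
    IsControl T (partitionSup N 0) :=
  ⟨hN.monotoneOn_partitionSup, hN.continuousOn_partitionSup hNc⟩

theorem IsControl.add {T : ℝ} {h h' : ℝ → ℝ} (hh : IsControl T h) (hh' : IsControl T h') :
    IsControl T fun t => h t + h' t :=
  ⟨hh.mono.add hh'.mono, hh.cont.add hh'.cont⟩

/-- `F` is bounded on the simplex by a multiple of the power `θ` of the control with primitive
`h`; this is how finite `θ⁻¹`-variation is used. -/
def Controlled (T : ℝ) (h : ℝ → ℝ) (θ : ℝ) (F : ℝ → ℝ → ℝ) : Prop :=
  ∃ C, 0 ≤ C ∧ ∀ s t, 0 ≤ s → s ≤ t → t ≤ T → |F s t| ≤ C * (h t - h s) ^ θ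

namespace Controlled

variable {T θ θ' : ℝ} {h h' : ℝ → ℝ} {F G : ℝ → ℝ → ℝ}

theorem congr (hF : Controlled T h θ F)
    (hFG : ∀ s t, 0 ≤ s → s ≤ t → t ≤ T → G s t = F s t) : Controlled T h θ G := by
  obtain ⟨C, hC, hb⟩ := hF
  exact ⟨C, hC, fun s t hs hst ht => by rw [hFG s t hs hst ht]; exact hb s t hs hst ht⟩

theorem zero : Controlled T h θ fun _ _ => 0 :=
  ⟨0, le_rfl, fun s t _ _ _ => by simp⟩

theorem add (hF : Controlled T h θ F) (hG : Controlled T h θ G) :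
    Controlled T h θ fun s t => F s t + G s t := by
  obtain ⟨C, hC, hb⟩ := hF
  obtain ⟨D, hD, hd⟩ := hG
  refine ⟨C + D, add_nonneg hC hD, fun s t hs hst ht => (abs_add_le _ _).trans ?_⟩
  rw [add_mul]
  exact add_le_add (hb s t hs hst ht) (hd s t hs hst ht)

theorem const_mul (c : ℝ) (hF : Controlled T h θ F) : Controlled T h θ fun s t => c * F s t := by
  obtain ⟨C, hC, hb⟩ := hF
  refine ⟨|c| * C, by positivity, fun s t hs hst ht => ?_⟩
  rw [abs_mul, mul_assoc]
  exact mul_le_mul_of_nonneg_left (hb s t hs hst ht) (abs_nonneg c)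

theorem neg (hF : Controlled T h θ F) : Controlled T h θ fun s t => -F s t :=
  (hF.const_mul (-1)).congr fun _ _ _ _ _ => by ring

theorem sub (hF : Controlled T h θ F) (hG : Controlled T h θ G) :
    Controlled T h θ fun s t => F s t - G s t :=
  (hF.add hG.neg).congr fun _ _ _ _ _ => by ring

theorem mul (hh : IsControl T h) (h1 : 0 ≤ θ) (h2 : 0 ≤ θ') (hF : Controlled T h θ F)
    (hG : Controlled T h θ' G) : Controlled T h (θ + θ') fun s t => F s t * G s t := by
  obtain ⟨C, hC, hb⟩ := hF
  obtain ⟨D, hD, hd⟩ := hG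
  refine ⟨C * D, mul_nonneg hC hD, fun s t hs hst ht => ?_⟩
  have h0 := hh.sub_nonneg hs hst ht
  rw [abs_mul, Real.rpow_add_of_nonneg h0 h1 h2, mul_mul_mul_comm]
  exact mul_le_mul (hb s t hs hst ht) (hd s t hs hst ht) (abs_nonneg _) (by positivity)

theorem mono_exponent (hh : IsControl T h) (h1 : 0 ≤ θ') (h2 : θ' ≤ θ)
    (hF : Controlled T h θ F) : Controlled T h θ' F := by
  obtain ⟨C, hC, hb⟩ := hF
  refine ⟨C * |h T - h 0| ^ (θ - θ'), by positivity, fun s t hs hst ht => ?_⟩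
  have h0 := hh.sub_nonneg hs hst ht
  refine (hb s t hs hst ht).trans ?_
  have : (h t - h s) ^ θ = (h t - h s) ^ (θ - θ') * (h t - h s) ^ θ' := by
    rw [← Real.rpow_add_of_nonneg h0 (by linarith) h1]; ring_nf
  rw [this, ← mul_assoc]
  have hle : h t - h s ≤ |h T - h 0| := by
    refine le_trans ?_ (le_abs_self _)
    have := hh.sub_nonneg le_rfl hs (hst.trans ht)
    have := hh.sub_nonneg (hs.trans hst) ht le_rfl
    linarith
  gcongr

theorem mono_control (hh : IsControl T h) (h1 : 0 ≤ θ)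
    (hle : ∀ s t, 0 ≤ s → s ≤ t → t ≤ T → h t - h s ≤ h' t - h' s)
    (hF : Controlled T h θ F) : Controlled T h' θ F := by
  obtain ⟨C, hC, hb⟩ := hF
  refine ⟨C, hC, fun s t hs hst ht => (hb s t hs hst ht).trans ?_⟩
  exact mul_le_mul_of_nonneg_left
    (Real.rpow_le_rpow (hh.sub_nonneg hs hst ht) (hle s t hs hst ht) h1) hC

end Controlled

theorem Controlled.add_left {T θ : ℝ} {h h' : ℝ → ℝ} {F : ℝ → ℝ → ℝ} (hh : IsControl T h)
    (hh' : IsControl T h') (h1 : 0 ≤ θ) (hF : Controlled T h θ F) :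
    Controlled T (fun t => h t + h' t) θ F :=
  hF.mono_control hh h1 fun s t hs hst ht => by linarith [hh'.sub_nonneg hs hst ht]

theorem Controlled.add_right {T θ : ℝ} {h h' : ℝ → ℝ} {F : ℝ → ℝ → ℝ} (hh : IsControl T h)
    (hh' : IsControl T h') (h1 : 0 ≤ θ) (hF : Controlled T h' θ F) :
    Controlled T (fun t => h t + h' t) θ F :=
  hF.mono_control hh' h1 fun s t hs hst ht => by linarith [hh.sub_nonneg hs hst ht]

theorem IsPartitionOf.le_of_le {s t : ℝ} {n : ℕ} {u : ℕ → ℝ} (hu : IsPartitionOf s t n u) :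
    ∀ {j k : ℕ}, j ≤ k → k ≤ n → u j ≤ u k := by
  intro j k hjk
  induction k, hjk using Nat.le_induction with
  | base => intro _; exact le_rfl
  | succ k _ ih => intro hk; exact (ih (by omega)).trans (hu.2.2 k (by omega)).le

theorem IsPartitionOf.mem {s t : ℝ} {n : ℕ} {u : ℕ → ℝ} (hu : IsPartitionOf s t n u) {k : ℕ}
    (hk : k ≤ n) : s ≤ u k ∧ u k ≤ t :=
  ⟨hu.1 ▸ hu.le_of_le (Nat.zero_le k) hk, hu.2.1 ▸ hu.le_of_le hk le_rfl⟩

theorem abs_le_euclNorm {κ : Type} [Fintype κ] (x : κ → ℝ) (i : κ) : |x i| ≤ euclNorm x := by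
  simpa [euclNorm] using PiLp.norm_apply_le (WithLp.toLp 2 x) i

theorem euclNorm_le_sum {κ : Type} [Fintype κ] (x : κ → ℝ) : euclNorm x ≤ ∑ i, |x i| := by
  rw [euclNorm, EuclideanSpace.norm_eq]
  refine Real.sqrt_le_iff.2 ⟨Finset.sum_nonneg fun i _ => abs_nonneg _, ?_⟩
  simpa using Finset.sum_sq_le_sq_sum_of_nonneg (s := Finset.univ) (f := fun i => |x i|)
    (fun i _ => abs_nonneg _)

theorem HasFiniteVar.of_controlled {κ : Type} [Fintype κ] {T r : ℝ} {h : ℝ → ℝ}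
    (hh : IsControl T h) (hr : 0 < r) {F : ℝ → ℝ → κ → ℝ}
    (hF : ∀ i, Controlled T h r⁻¹ fun s t => F s t i) : HasFiniteVar r T F := by
  choose C hC hb using hF
  set D := ∑ i, C i with hD
  have hD0 : 0 ≤ D := Finset.sum_nonneg fun i _ => hC i
  refine ⟨D ^ r * (h T - h 0), fun n u hu => ?_⟩
  have key : ∀ k ∈ Finset.range n,
      euclNorm (F (u k) (u (k + 1))) ^ r ≤ D ^ r * (h (u (k + 1)) - h (u k)) := by
    intro k hk
    have hk := Finset.mem_range.1 hk
    have h1 := (hu.mem hk.le).1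
    have h2 := (hu.2.2 k hk).le
    have h3 := (hu.mem (Nat.succ_le_iff.2 hk)).2
    have h0 := hh.sub_nonneg h1 h2 h3
    have h4 : euclNorm (F (u k) (u (k + 1))) ≤ D * (h (u (k + 1)) - h (u k)) ^ r⁻¹ := by
      refine (euclNorm_le_sum _).trans ?_
      rw [hD, Finset.sum_mul]
      exact Finset.sum_le_sum fun i _ => hb i _ _ h1 h2 h3
    refine (Real.rpow_le_rpow (norm_nonneg _) h4 hr.le).trans ?_
    rw [Real.mul_rpow hD0 (Real.rpow_nonneg h0 _), Real.rpow_inv_rpow h0 hr.ne']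
  refine (Finset.sum_le_sum key).trans ?_
  rw [← Finset.mul_sum, Finset.sum_range_sub (fun k => h (u k)), hu.1, hu.2.1]

theorem continuous_euclNorm {κ : Type} [Fintype κ] : Continuous (euclNorm : (κ → ℝ) → ℝ) :=
  (PiLp.continuous_toLp 2 _).norm

theorem euclNorm_zero {κ : Type} [Fintype κ] : euclNorm (0 : κ → ℝ) = 0 := by
  simp [euclNorm]

theorem HasFiniteVar.exists_control {κ : Type} [Fintype κ] {T r : ℝ} (hr : 0 < r)
    {F : ℝ → ℝ → κ → ℝ} (hF : HasFiniteVar r T F)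
    (hc : ContinuousOn (fun q : ℝ × ℝ => F q.1 q.2) (timeSimplex T))
    (hd : ∀ s, 0 ≤ s → s ≤ T → F s s = 0) :
    ∃ h, IsControl T h ∧ ∀ i, Controlled T h r⁻¹ fun s t => F s t i := by
  obtain ⟨C, hC⟩ := hF
  have hN : HasBoundedPartitionSums T C fun s t => euclNorm (F s t) ^ r :=
    { nonneg := fun s t _ _ _ => Real.rpow_nonneg (norm_nonneg _) _
      diag := fun s hs ht => by simp only [hd s hs ht, euclNorm_zero, Real.zero_rpow hr.ne']
      sum_le := fun n x hx => by
        obtain ⟨u, hu, rfl⟩ := hx.exists_isPartitionOf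
        exact hC n u hu }
  have hh := hN.isControl
    ((continuous_euclNorm.comp_continuousOn hc).rpow_const fun _ _ => Or.inr hr.le)
  refine ⟨_, hh, fun i => ⟨1, zero_le_one, fun s t hs hst ht => ?_⟩⟩
  rw [one_mul, Real.le_rpow_inv_iff_of_pos (abs_nonneg _) (hh.sub_nonneg hs hst ht) hr]
  exact (Real.rpow_le_rpow (abs_nonneg _) (abs_le_euclNorm _ i) hr.le).trans
    (hN.le_partitionSup_sub hs hst ht)

theorem sum_rpow_le {κ : Type*} (A : Finset κ) {x : κ → ℝ} {η θ : ℝ} (hθ : 1 ≤ θ)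
    (h0 : ∀ k ∈ A, 0 ≤ x k) (h1 : ∀ k ∈ A, x k ≤ η) :
    ∑ k ∈ A, x k ^ θ ≤ η ^ (θ - 1) * ∑ k ∈ A, x k := by
  rw [Finset.mul_sum]
  refine Finset.sum_le_sum fun k hk => ?_
  have : x k ^ θ = x k ^ (θ - 1) * x k := by
    rw [← Real.rpow_add_one' (h0 k hk) (by linarith)]; ring_nf
  rw [this]
  exact mul_le_mul_of_nonneg_right (Real.rpow_le_rpow (h0 k hk) (h1 k hk) (by linarith)) (h0 k hk)

/-! ### Sewing -/

theorem two_mul_inv_two_rpow_lt_one {θ : ℝ} (hθ : 1 < θ) : (2 : ℝ) * 2⁻¹ ^ θ < 1 := by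
  have : (2⁻¹ : ℝ) ^ θ < 2⁻¹ ^ (1 : ℝ) :=
    Real.rpow_lt_rpow_of_exponent_gt (by norm_num) (by norm_num) hθ
  rw [Real.rpow_one] at this
  linarith

/-- The analogue of `Controlled` for functions of three times `s ≤ u ≤ t`, such as the defect of
additivity `A s t - A s u - A u t`. -/
def ControlledTriple (T : ℝ) (h : ℝ → ℝ) (θ : ℝ) (B : ℝ → ℝ → ℝ → ℝ) : Prop :=
  ∃ C, 0 ≤ C ∧ ∀ s u t, 0 ≤ s → s ≤ u → u ≤ t → t ≤ T → |B s u t| ≤ C * (h t - h s) ^ θ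

theorem ControlledTriple.congr {T θ : ℝ} {h : ℝ → ℝ} {B B' : ℝ → ℝ → ℝ → ℝ}
    (hB : ControlledTriple T h θ B)
    (heq : ∀ s u t, 0 ≤ s → s ≤ u → u ≤ t → t ≤ T → |B' s u t| = |B s u t|) :
    ControlledTriple T h θ B' := by
  obtain ⟨C, hC, hb⟩ := hB
  exact ⟨C, hC, fun s u t hs hsu hut ht =>
    (heq s u t hs hsu hut ht).trans_le (hb s u t hs hsu hut ht)⟩

theorem ControlledTriple.sum {κ : Type*} {T θ : ℝ} {h : ℝ → ℝ} {B : κ → ℝ → ℝ → ℝ → ℝ}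
    (A : Finset κ) (hB : ∀ k ∈ A, ControlledTriple T h θ (B k)) :
    ControlledTriple T h θ fun s u t => ∑ k ∈ A, B k s u t := by
  choose! C hC hb using hB
  refine ⟨∑ k ∈ A, C k, Finset.sum_nonneg hC, fun s u t hs hsu hut ht => ?_⟩
  rw [Finset.sum_mul]
  exact (Finset.abs_sum_le_sum_abs _ _).trans
    (Finset.sum_le_sum fun k hk => hb k hk s u t hs hsu hut ht)

theorem Controlled.mul_triple {T θ θ' : ℝ} {h : ℝ → ℝ} {F G : ℝ → ℝ → ℝ} (hh : IsControl T h)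
    (hθ : 0 ≤ θ) (hθ' : 0 ≤ θ') (hF : Controlled T h θ F) (hG : Controlled T h θ' G) :
    ControlledTriple T h (θ + θ') fun s u t => F s u * G u t := by
  obtain ⟨C, hC, hF⟩ := hF
  obtain ⟨D, hD, hG⟩ := hG
  refine ⟨C * D, mul_nonneg hC hD, fun s u t hs hsu hut ht => ?_⟩
  have hsu' := hh.sub_nonneg hs hsu (hut.trans ht)
  have hut' := hh.sub_nonneg (hs.trans hsu) hut ht
  rw [Real.rpow_add_of_nonneg (by linarith) hθ hθ', abs_mul, mul_mul_mul_comm]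
  refine mul_le_mul ((hF s u hs hsu (hut.trans ht)).trans ?_)
    ((hG u t (hs.trans hsu) hut ht).trans ?_) (abs_nonneg _)
    (mul_nonneg hC (Real.rpow_nonneg (by linarith) _)) <;> gcongr <;> linarith

section Sewing

variable {T θ : ℝ} {h : ℝ → ℝ} {A : ℝ → ℝ → ℝ}

/-- The interval of the partition at which `h` crosses the midpoint of its range splits the sum
into two sums over intervals carrying at most half of the control. -/
theorem exists_abs_partitionSum_sub_le (hh : IsControl T h) (hθ : 1 < θ)
    (hA : ControlledTriple T h θ fun s u t => A s t - A s u - A u t) :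
    ∃ K, 0 ≤ K ∧ ∀ n s t x, 0 ≤ s → t ≤ T → IsPartitionSum A s n t x →
      |x - A s t| ≤ K * (h t - h s) ^ θ := by
  obtain ⟨C, hC, hA⟩ := hA
  have h2 := two_mul_inv_two_rpow_lt_one hθ
  obtain ⟨K, hK, hKC⟩ : ∃ K, 0 ≤ K ∧ K = 2 * (K * 2⁻¹ ^ θ) + 2 * C :=
    ⟨2 * C / (1 - 2 * 2⁻¹ ^ θ), div_nonneg (by linarith) (by linarith), by
      field_simp [show (1 - 2 * (2⁻¹ : ℝ) ^ θ) ≠ 0 by linarith]; ring⟩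
  refine ⟨K, hK, fun n => ?_⟩
  induction n using Nat.strong_induction_on with
  | _ n ih =>
  intro s t x hs ht hx
  set ω := h t - h s with hω
  rcases hx.le.eq_or_lt with rfl | hst
  · simpa [hω, hx.eq_zero_of_self, Real.zero_rpow (by linarith : θ ≠ 0)]
      using hA s s s hs le_rfl le_rfl ht
  have hω0 : 0 ≤ ω := hh.sub_nonneg hs hst.le ht
  obtain ⟨k, m, v, w, y, z, rfl, hvw, hv, hw, hy, hz, rfl⟩ :=
    hx.exists_crossing (f := h) (c := h s + ω / 2) hst (by linarith) (by linarith)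
  have hw0 : 0 ≤ w := hs.trans (hy.le.trans hvw.le)
  have hhalf : ∀ r, 0 ≤ r → r ≤ ω / 2 → K * r ^ θ ≤ K * (2⁻¹ ^ θ * ω ^ θ) := fun r h0 hr => by
    rw [← Real.mul_rpow (by norm_num) hω0, ← div_eq_inv_mul]
    gcongr
  have hleft := (ih k (by omega) s v y hs (hvw.le.trans (hz.le.trans ht)) hy).trans
    (hhalf _ (hh.sub_nonneg hs hy.le (hvw.le.trans (hz.le.trans ht))) (by linarith))
  have hright := (ih m (by omega) w t z hw0 ht hz).trans
    (hhalf _ (hh.sub_nonneg hw0 hz.le ht) (by linarith))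
  have hAv := hA s v t hs hy.le (hvw.le.trans hz.le) ht
  have hAw : |A v t - A v w - A w t| ≤ C * ω ^ θ := by
    refine (hA v w t (hs.trans hy.le) hvw.le hz.le ht).trans ?_
    have := hh.sub_nonneg (hs.trans hy.le) (hvw.le.trans hz.le) ht
    have := hh.sub_nonneg hs hy.le (hvw.le.trans (hz.le.trans ht))
    gcongr
    linarith
  have hKω : K * ω ^ θ = 2 * (K * (2⁻¹ ^ θ * ω ^ θ)) + 2 * (C * ω ^ θ) := by
    conv_lhs => rw [hKC]
    ring
  rw [abs_le] at hleft hright hAv hAw ⊢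
  constructor <;> linarith

theorem exists_isPartitionSum_sub (A : ℝ → ℝ → ℝ) (P : Finset ℝ) :
    ∃ J : ℝ → ℝ, ∀ s ∈ P, ∀ t ∈ P, s ≤ t → ∃ n, IsPartitionSum A s n t (J t - J s) := by
  induction P using Finset.induction_on_max with
  | empty => exact ⟨0, by simp⟩
  | insert b P hb ih =>
    obtain ⟨J, hJ⟩ := ih
    rcases P.eq_empty_or_nonempty with rfl | hP
    · refine ⟨0, fun s hs t ht _ => ⟨0, ?_⟩⟩
      obtain rfl : s = b := by simpa using hs
      obtain rfl : t = s := by simpa using ht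
      simpa using IsPartitionSum.refl
    set a := P.max' hP
    have ha : a ∈ P := P.max'_mem hP
    have hJb : ∀ s ∈ P, Function.update J b (J a + A a b) s = J s := fun s hs =>
      Function.update_of_ne (hb s hs).ne _ _
    refine ⟨Function.update J b (J a + A a b), fun s hs t ht hst => ?_⟩
    rcases Finset.mem_insert.1 hs with rfl | hsP <;> rcases Finset.mem_insert.1 ht with rfl | htP
    · exact ⟨0, by simpa using IsPartitionSum.refl⟩
    · exact absurd hst (hb t htP).not_ge
    · obtain ⟨n, hn⟩ := hJ s hsP a ha (P.le_max' s hsP)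
      refine ⟨n + 1, ?_⟩
      rw [hJb s hsP, Function.update_self, add_sub_right_comm]
      exact hn.snoc (hb a ha)
    · simpa only [hJb s hsP, hJb t htP] using hJ s hsP t htP hst

/-- The path is the limit, along an ultrafilter on the finite subsets of `ℝ`, of paths whose
increments are partition sums. -/
theorem exists_sewing (hh : IsControl T h) (hθ : 1 < θ)
    (hA : ControlledTriple T h θ fun s u t => A s t - A s u - A u t) :
    ∃ J : ℝ → ℝ, Controlled T h θ fun s t => J t - J s - A s t := by
  obtain ⟨K, hK, hbound⟩ := exists_abs_partitionSum_sub_le hh hθ hA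
  choose J hJ using exists_isPartitionSum_sub A
  set 𝒰 : Ultrafilter (Finset ℝ) := Ultrafilter.of atTop
  have hmem : ∀ s t : ℝ, ∀ᶠ P : Finset ℝ in 𝒰, s ∈ P ∧ t ∈ P := fun s t => by
    filter_upwards [Ultrafilter.of_le _ (eventually_ge_atTop ({s, t} : Finset ℝ))] with P hP
    simpa [Finset.insert_subset_iff] using hP
  have hclose : ∀ s t, 0 ≤ s → s ≤ t → t ≤ T →
      ∀ᶠ P : Finset ℝ in 𝒰, |J P t - J P s - A s t| ≤ K * (h t - h s) ^ θ := fun s t hs hst ht => by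
    filter_upwards [hmem s t] with P hP
    obtain ⟨n, hn⟩ := hJ P s hP.1 t hP.2 hst
    exact hbound n s t _ hs ht hn
  have hlim : ∀ t, 0 ≤ t → t ≤ T → ∃ L, Tendsto (fun P => J P t - J P 0) 𝒰 (𝓝 L) := by
    intro t h0 ht
    obtain ⟨L, -, hL⟩ := (isCompact_closedBall (A 0 t) (K * (h t - h 0) ^ θ)).ultrafilter_le_nhds
      (𝒰.map fun P => J P t - J P 0) (le_principal_iff.2 (hclose 0 t le_rfl h0 ht))
    exact ⟨L, hL⟩
  choose! L hL using hlim
  refine ⟨L, K, hK, fun s t hs hst ht => ?_⟩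
  have hst' := (hL t (hs.trans hst) ht).sub (hL s hs (hst.trans ht))
  simp only [sub_sub_sub_cancel_right] at hst'
  exact le_of_tendsto (hst'.sub_const (A s t)).abs (hclose s t hs hst ht)

theorem continuousOn_fst_simplex {f : ℝ → ℝ} (hf : ContinuousOn f (Set.Icc 0 T)) :
    ContinuousOn (fun q : ℝ × ℝ => f q.1) (timeSimplex T) :=
  hf.comp continuousOn_fst fun _ hq => ⟨hq.1, hq.2.1.trans hq.2.2⟩

theorem continuousOn_snd_simplex {f : ℝ → ℝ} (hf : ContinuousOn f (Set.Icc 0 T)) :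
    ContinuousOn (fun q : ℝ × ℝ => f q.2) (timeSimplex T) :=
  hf.comp continuousOn_snd fun _ hq => ⟨hq.1.trans hq.2.1, hq.2.2⟩

theorem continuousOn_zero_fst {F : ℝ → ℝ → ℝ}
    (hF : ContinuousOn (fun q : ℝ × ℝ => F q.1 q.2) (timeSimplex T)) :
    ContinuousOn (fun q : ℝ × ℝ => F 0 q.1) (timeSimplex T) :=
  hF.comp (f := fun q : ℝ × ℝ => ((0 : ℝ), q.1)) (by fun_prop)
    fun _ hq => ⟨le_rfl, hq.1, hq.2.1.trans hq.2.2⟩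

/-- Uniform continuity of `F` on the compact simplex transfers to `J`. -/
theorem continuousOn_of_abs_sub_le {J : ℝ → ℝ} {F : ℝ → ℝ → ℝ}
    (hF : ContinuousOn (fun q : ℝ × ℝ => F q.1 q.2) (timeSimplex T))
    (hF0 : ∀ s, 0 ≤ s → s ≤ T → F s s = 0)
    (hJ : ∀ s t, 0 ≤ s → s ≤ t → t ≤ T → |J t - J s| ≤ F s t) :
    ContinuousOn J (Set.Icc 0 T) := by
  have hF := (isCompact_timeSimplex T).uniformContinuousOn_of_continuous hF
  refine (Metric.uniformContinuousOn_iff.2 fun ε hε => ?_).continuousOn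
  obtain ⟨δ, hδ, hd⟩ := Metric.uniformContinuousOn_iff.1 hF ε hε
  have hlt : ∀ s ∈ Set.Icc 0 T, ∀ t ∈ Set.Icc 0 T, s ≤ t → dist s t < δ →
      |J t - J s| < ε := by
    intro s hs t ht hst hdist
    have := hd (s, t) ⟨hs.1, hst, ht.2⟩ (s, s) ⟨hs.1, le_rfl, hs.2⟩ (by
      rw [Prod.dist_eq, dist_self, dist_comm t s]; exact max_lt hδ hdist)
    rw [Real.dist_eq, hF0 s hs.1 hs.2, sub_zero] at this
    exact (hJ s t hs.1 hst ht.2).trans_lt ((le_abs_self _).trans_lt this)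
  refine ⟨δ, hδ, fun s hs t ht hdist => ?_⟩
  rcases le_total s t with hst | hts
  · rw [dist_comm]; exact hlt s hs t ht hst hdist
  · exact hlt t ht s hs hts (by rwa [dist_comm])

theorem Controlled.continuousOn (hh : IsControl T h) (hθ : 0 < θ) {J : ℝ → ℝ}
    (hA : ContinuousOn (fun q : ℝ × ℝ => A q.1 q.2) (timeSimplex T))
    (hJ : Controlled T h θ fun s t => J t - J s - A s t) : ContinuousOn J (Set.Icc 0 T) := by
  obtain ⟨C, -, hb⟩ := hJ
  refine continuousOn_of_abs_sub_le (F := fun s t => C * (h t - h s) ^ θ + |A s t|)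
    (((((continuousOn_snd_simplex hh.cont).sub (continuousOn_fst_simplex hh.cont)).rpow_const
      fun _ _ => Or.inr hθ.le).const_mul C).add hA.abs)
    (fun s hs ht => ?_) fun s t hs hst ht => ?_
  · have := hb s s hs le_rfl ht
    simp only [sub_self, Real.zero_rpow hθ.ne', mul_zero, zero_sub, abs_neg] at this ⊢
    rw [le_antisymm this (abs_nonneg _), add_zero]
  · have := abs_add_le (J t - J s - A s t) (A s t)
    rw [sub_add_cancel] at this
    exact this.trans (add_le_add (hb s t hs hst ht) le_rfl)

end Sewing

/-- Bisecting every interval at the midpoint of the control improves the bound by the factor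
`2 * 2⁻¹ ^ θ < 1`. -/
theorem Controlled.eq_zero {T θ : ℝ} {h : ℝ → ℝ} (hh : IsControl T h) (hθ : 1 < θ)
    {F : ℝ → ℝ → ℝ} (hF : Controlled T h θ F)
    (hadd : ∀ s u t, 0 ≤ s → s ≤ u → u ≤ t → t ≤ T → F s t = F s u + F u t)
    {s t : ℝ} (hs : 0 ≤ s) (hst : s ≤ t) (ht : t ≤ T) : F s t = 0 := by
  obtain ⟨C, -, hb⟩ := hF
  have hbisect : ∀ n : ℕ, ∀ s t, 0 ≤ s → s ≤ t → t ≤ T →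
      |F s t| ≤ (2 * 2⁻¹ ^ θ) ^ n * (C * (h t - h s) ^ θ) := by
    intro n
    induction n with
    | zero => simpa using hb
    | succ n ih =>
      intro s t hs hst ht
      have h0 := hh.sub_nonneg hs hst ht
      obtain ⟨u, hu, hum⟩ := intermediate_value_Icc hst
        (hh.cont.mono (Set.Icc_subset_Icc hs ht))
        (show (h s + h t) / 2 ∈ Set.Icc (h s) (h t) by constructor <;> linarith)
      rw [hadd s u t hs hu.1 hu.2 ht]
      refine (abs_add_le _ _).trans ((add_le_add (ih s u hs hu.1 (hu.2.trans ht))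
        (ih u t (hs.trans hu.1) hu.2 ht)).trans (le_of_eq ?_))
      rw [show h u - h s = 2⁻¹ * (h t - h s) by rw [hum]; ring,
        show h t - h u = 2⁻¹ * (h t - h s) by rw [hum]; ring,
        Real.mul_rpow (by norm_num) h0]
      ring
  have hlim : Tendsto (fun n : ℕ => ((2 : ℝ) * 2⁻¹ ^ θ) ^ n * (C * (h t - h s) ^ θ)) atTop
      (𝓝 0) := by
    simpa using (tendsto_pow_atTop_nhds_zero_of_lt_one (by positivity)
      (two_mul_inv_two_rpow_lt_one hθ)).mul_const (C * (h t - h s) ^ θ)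
  exact abs_nonpos_iff.1 (ge_of_tendsto' hlim fun n => hbisect n s t hs hst ht)

/-! ### Multiplicative functionals and Lyons' extension -/

namespace TensorSeries

variable {ι : Type}

theorem tmul_nil (a b : TensorSeries ι) : tmul a b [] = a [] * b [] := by simp [tmul]

theorem tmul_cons (a b : TensorSeries ι) (x : ι) (w : List ι) :
    tmul a b (x :: w) = a [] * b (x :: w) + tmul (fun v => a (x :: v)) b w := by
  simp only [tmul, List.length_cons]
  rw [Finset.sum_range_succ']
  simp [add_comm]

theorem tmul_concat (a b : TensorSeries ι) (x : ι) (w : List ι) :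
    tmul a b (w ++ [x]) = a (w ++ [x]) * b [] + tmul a (fun v => b (v ++ [x])) w := by
  simp only [tmul, List.length_append, List.length_singleton]
  rw [Finset.sum_range_succ, add_comm]
  congr 1
  · rw [List.take_of_length_le (by simp), List.drop_of_length_le (by simp)]
  · refine Finset.sum_congr rfl fun k hk => ?_
    have hk : k ≤ w.length := Nat.lt_succ_iff.1 (Finset.mem_range.1 hk)
    rw [List.take_append_of_le_length hk, List.drop_append_of_le_length hk]

theorem add_tmul (a a' b : TensorSeries ι) (w : List ι) :
    tmul (fun v => a v + a' v) b w = tmul a b w + tmul a' b w := by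
  simp [tmul, add_mul, Finset.sum_add_distrib]

theorem tmul_add (a b b' : TensorSeries ι) (w : List ι) :
    tmul a (fun v => b v + b' v) w = tmul a b w + tmul a b' w := by
  simp [tmul, mul_add, Finset.sum_add_distrib]

theorem smul_tmul (c : ℝ) (a b : TensorSeries ι) (w : List ι) :
    tmul (fun v => c * a v) b w = c * tmul a b w := by
  simp [tmul, mul_assoc, Finset.mul_sum]

theorem tmul_smul (c : ℝ) (a b : TensorSeries ι) (w : List ι) :
    tmul a (fun v => c * b v) w = c * tmul a b w := by
  simp [tmul, mul_left_comm, Finset.mul_sum]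

theorem tmul_assoc (a b c : TensorSeries ι) : tmul (tmul a b) c = tmul a (tmul b c) := by
  funext w
  induction w generalizing a with
  | nil => simp [tmul_nil, mul_assoc]
  | cons x w ih =>
    rw [tmul_cons, tmul_nil, tmul_cons a, tmul_cons b]
    simp only [tmul_cons a b]
    rw [add_tmul, smul_tmul, ih]
    ring

theorem tmul_congr {a a' b b' : TensorSeries ι} {w : List ι}
    (ha : ∀ v, v.length ≤ w.length → a v = a' v) (hb : ∀ v, v.length ≤ w.length → b v = b' v) :
    tmul a b w = tmul a' b' w := by
  refine Finset.sum_congr rfl fun k _ => ?_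
  rw [ha _ (by simp), hb _ (by simp)]

theorem tmul_sub_tmul_left {a a' b : TensorSeries ι} {w : List ι}
    (h : ∀ v, v.length < w.length → a v = a' v) :
    tmul a b w - tmul a' b w = (a w - a' w) * b [] := by
  rw [tmul, tmul, ← Finset.sum_sub_distrib, Finset.sum_range_succ, Finset.sum_eq_zero]
  · rw [zero_add, List.take_length, List.drop_length, sub_mul]
  · intro k hk
    have hk := Finset.mem_range.1 hk
    rw [h _ (by rwa [List.length_take_of_le hk.le]), sub_self]

theorem tmul_sub_tmul_right {a b b' : TensorSeries ι} {w : List ι}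
    (h : ∀ v, v.length < w.length → b v = b' v) :
    tmul a b w - tmul a b' w = a [] * (b w - b' w) := by
  rw [tmul, tmul, ← Finset.sum_sub_distrib, Finset.sum_range_succ', Finset.sum_eq_zero]
  · rw [zero_add, List.take_zero, List.drop_zero, mul_sub]
  · intro k hk
    have hk := Finset.mem_range.1 hk
    rw [h _ (by rw [List.length_drop]; omega), sub_self]

theorem tmul_unit (a : TensorSeries ι) : tmul a unit = a := by
  funext w
  rw [tmul, Finset.sum_range_succ, Finset.sum_eq_zero]
  · simp [unit]
  · intro k hk
    have hk := Finset.mem_range.1 hk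
    obtain ⟨x, v, hd⟩ := List.exists_cons_of_ne_nil (mt List.drop_eq_nil_iff.1 hk.not_ge)
    rw [hd, unit, mul_zero]

theorem unit_tmul (a : TensorSeries ι) : tmul unit a = a := by
  funext w
  cases w with
  | nil => simp [tmul_nil, unit]
  | cons x w =>
    rw [tmul_cons]
    simp [unit, tmul]

/-- `a` with its level `n` replaced by that of `f`. -/
def updateLevel (a : TensorSeries ι) (n : ℕ) (f : List ι → ℝ) : TensorSeries ι := fun w =>
  if w.length = n then f w else a w

variable {a b : TensorSeries ι} {f g : List ι → ℝ} {n : ℕ} {w : List ι}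

theorem updateLevel_of_eq (hw : w.length = n) : updateLevel a n f w = f w := if_pos hw

theorem updateLevel_of_lt (hw : w.length < n) : updateLevel a n f w = a w := if_neg hw.ne

theorem tmul_updateLevel_of_lt (hw : w.length < n) :
    tmul (updateLevel a n f) (updateLevel b n g) w = tmul a b w :=
  tmul_congr (fun _ hv => updateLevel_of_lt (hv.trans_lt hw))
    (fun _ hv => updateLevel_of_lt (hv.trans_lt hw))

theorem tmul_updateLevel (hn : n ≠ 0) (hw : w.length = n) (ha : a w = 0) (hb : b w = 0) :
    tmul (updateLevel a n f) (updateLevel b n g) w = f w * b [] + a [] * g w + tmul a b w := by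
  have hleft := tmul_sub_tmul_left (a := updateLevel a n f) (a' := a) (b := updateLevel b n g)
    (w := w) fun v hv => updateLevel_of_lt (hw ▸ hv)
  have hright := tmul_sub_tmul_right (a := a) (b := updateLevel b n g) (b' := b) (w := w)
    fun v hv => updateLevel_of_lt (hw ▸ hv)
  rw [updateLevel_of_eq hw, ha, updateLevel_of_lt (Nat.pos_of_ne_zero hn)] at hleft
  rw [updateLevel_of_eq hw, hb] at hright
  linarith

end TensorSeries

/-- A functional which is multiplicative, continuous and controlled by `h` on words of length at
most `n`. -/
structure IsMultUpTo {ι : Type} (p T : ℝ) (h : ℝ → ℝ) (n : ℕ) (S : ℝ → ℝ → TensorSeries ι) :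
    Prop where
  nil : ∀ s t : ℝ, 0 ≤ s → s ≤ t → t ≤ T → S s t [] = 1
  chen : ∀ w : List ι, w.length ≤ n → ∀ s u t : ℝ, 0 ≤ s → s ≤ u → u ≤ t → t ≤ T →
    S s t w = tmul (S s u) (S u t) w
  cont : ∀ w : List ι, w.length ≤ n →
    ContinuousOn (fun q : ℝ × ℝ => S q.1 q.2 w) (timeSimplex T)
  bound : ∀ w : List ι, w ≠ [] → w.length ≤ n → Controlled T h (w.length / p) fun s t => S s t w

namespace IsMultUpTo

variable {ι : Type} {p T : ℝ} {h : ℝ → ℝ} {m n : ℕ} {R S S' : ℝ → ℝ → TensorSeries ι}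

theorem of_eq (hS : IsMultUpTo p T h m S) (hnm : n ≤ m)
    (heq : ∀ w : List ι, w.length ≤ n → ∀ s t, S' s t w = S s t w) : IsMultUpTo p T h n S' where
  nil s t hs hst ht := (heq [] (Nat.zero_le n) s t).trans (hS.nil s t hs hst ht)
  chen w hw s u t hs hsu hut ht := by
    rw [heq w hw, hS.chen w (hw.trans hnm) s u t hs hsu hut ht]
    exact tmul_congr (fun v hv => (heq v (hv.trans hw) _ _).symm)
      (fun v hv => (heq v (hv.trans hw) _ _).symm)
  cont w hw := by simpa only [heq w hw] using hS.cont w (hw.trans hnm)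
  bound w hw0 hw := by simpa only [heq w hw] using hS.bound w hw0 (hw.trans hnm)

theorem updateLevel (hR : IsMultUpTo p T h n R)
    (hR0 : ∀ w : List ι, w.length = n + 1 → ∀ s t, R s t w = 0) {F : ℝ → ℝ → List ι → ℝ}
    (hchen : ∀ w : List ι, w.length = n + 1 → ∀ s u t, 0 ≤ s → s ≤ u → u ≤ t → t ≤ T →
      F s t w = F s u w + F u t w + tmul (R s u) (R u t) w)
    (hcont : ∀ w : List ι, w.length = n + 1 →
      ContinuousOn (fun q : ℝ × ℝ => F q.1 q.2 w) (timeSimplex T))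
    (hbound : ∀ w : List ι, w.length = n + 1 →
      Controlled T h (w.length / p) fun s t => F s t w) :
    IsMultUpTo p T h (n + 1) fun s t => (R s t).updateLevel (n + 1) (F s t) where
  nil s t hs hst ht := by
    rw [updateLevel_of_lt (Nat.succ_pos n), hR.nil s t hs hst ht]
  chen w hw s u t hs hsu hut ht := by
    rcases hw.lt_or_eq with hlt | heq
    · rw [updateLevel_of_lt hlt, tmul_updateLevel_of_lt hlt]
      exact hR.chen w (Nat.lt_succ_iff.1 hlt) s u t hs hsu hut ht
    · rw [updateLevel_of_eq heq, tmul_updateLevel (Nat.succ_ne_zero n) heq (hR0 w heq s u)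
        (hR0 w heq u t), hR.nil s u hs hsu (hut.trans ht), hR.nil u t (hs.trans hsu) hut ht,
        mul_one, one_mul]
      exact hchen w heq s u t hs hsu hut ht
  cont w hw := by
    rcases hw.lt_or_eq with hlt | heq
    · simpa only [updateLevel_of_lt hlt] using hR.cont w (Nat.lt_succ_iff.1 hlt)
    · simpa only [updateLevel_of_eq heq] using hcont w heq
  bound w hw0 hw := by
    rcases hw.lt_or_eq with hlt | heq
    · simpa only [updateLevel_of_lt hlt] using hR.bound w hw0 (Nat.lt_succ_iff.1 hlt)
    · simpa only [updateLevel_of_eq heq] using hbound w heq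

theorem updateLevel_zero (hS : IsMultUpTo p T h n S) :
    IsMultUpTo p T h n fun s t => (S s t).updateLevel (n + 1) 0 :=
  hS.of_eq le_rfl fun _ hw _ _ => updateLevel_of_lt (Nat.lt_succ_iff.2 hw)

theorem tmul_add_tmul (hR : IsMultUpTo p T h n R)
    (hR0 : ∀ w : List ι, w.length = n + 1 → ∀ s t, R s t w = 0) {w : List ι}
    (hw : w.length = n + 1) {r s u t : ℝ} (hr : 0 ≤ r) (hrs : r ≤ s) (hsu : s ≤ u) (hut : u ≤ t)
    (ht : t ≤ T) :
    tmul (R r s) (R s t) w + tmul (R s u) (R u t) w =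
      tmul (R r u) (R u t) w + tmul (R r s) (R s u) w := by
  have hs := hr.trans hrs
  have hu := hs.trans hsu
  have hright := tmul_sub_tmul_right (a := R r s) (b := tmul (R s u) (R u t)) (b' := R s t)
    (w := w) fun v hv => (hR.chen v (by omega) s u t hs hsu hut ht).symm
  have hleft := tmul_sub_tmul_left (a := tmul (R r s) (R s u)) (a' := R r u) (b := R u t)
    (w := w) fun v hv => (hR.chen v (by omega) r s u hr hrs hsu (hut.trans ht)).symm
  rw [hR.nil r s hr hrs (hsu.trans (hut.trans ht)), hR0 w hw s t] at hright
  rw [tmul_assoc, hR.nil u t hu hut ht, hR0 w hw r u] at hleft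
  linarith

theorem controlledTriple_tmul (hp : 0 < p) (hh : IsControl T h) (hR : IsMultUpTo p T h n R)
    (hR0 : ∀ w : List ι, w.length = n + 1 → ∀ s t, R s t w = 0) {w : List ι}
    (hw : w.length = n + 1) :
    ControlledTriple T h (w.length / p) fun s u t => tmul (R s u) (R u t) w := by
  refine ControlledTriple.sum _ fun k hk => ?_
  have hzero : ControlledTriple T h (w.length / p) fun _ _ _ => 0 :=
    ⟨0, le_rfl, fun s u t _ _ _ _ => by simp⟩
  rcases Nat.eq_zero_or_pos k with rfl | hk0
  · exact hzero.congr fun s u t _ _ _ _ => by simp [hR0 w hw]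
  rcases (Nat.lt_succ_iff.1 (Finset.mem_range.1 hk)).eq_or_lt with rfl | hkn
  · exact hzero.congr fun s u t _ _ _ _ => by simp [hR0 w hw]
  have htake : (w.take k).length = k := List.length_take_of_le hkn.le
  have hdrop : (w.drop k).length = w.length - k := List.length_drop
  have hsum : (w.length / p : ℝ) = (w.take k).length / p + (w.drop k).length / p := by
    rw [← add_div, ← Nat.cast_add, htake, hdrop, Nat.add_sub_cancel' hkn.le]
  rw [hsum]
  exact (hR.bound _ (List.ne_nil_of_length_pos (by omega)) (by omega)).mul_triple hh
    (by positivity) (by positivity)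
    (hR.bound _ (List.ne_nil_of_length_pos (by omega)) (by omega))

/-- Level `n + 1` is the defect from additivity of the path sewn from
`A s t = (R 0 s ⊗ R s t) w`, where `R` is `S` without its level `n + 1`. -/
theorem exists_succ (hp : 0 < p) (hh : IsControl T h) (hn : p < n + 1)
    (hS : IsMultUpTo p T h n S) :
    ∃ S', IsMultUpTo p T h (n + 1) S' ∧
      ∀ w : List ι, w.length ≤ n → ∀ s t, S' s t w = S s t w := by
  set R : ℝ → ℝ → TensorSeries ι := fun s t => (S s t).updateLevel (n + 1) 0
  have hR : IsMultUpTo p T h n R := hS.updateLevel_zero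
  have hR0 : ∀ w : List ι, w.length = n + 1 → ∀ s t, R s t w = 0 :=
    fun w hw s t => updateLevel_of_eq hw
  have hsew : ∀ w : List ι, w.length = n + 1 → ∃ J : ℝ → ℝ,
      Controlled T h (w.length / p) fun s t => J t - J s - tmul (R 0 s) (R s t) w := by
    intro w hw
    refine exists_sewing hh (by rw [one_lt_div hp, hw]; exact_mod_cast hn)
      ((hR.controlledTriple_tmul hp hh hR0 hw).congr fun s u t hs hsu hut ht => ?_)
    rw [← abs_neg (tmul (R s u) (R u t) w)]
    congr 1
    linarith [hR.tmul_add_tmul hR0 hw le_rfl hs hsu hut ht]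
  choose! J hJ using hsew
  have hA : ∀ w : List ι, w.length = n + 1 →
      ContinuousOn (fun q : ℝ × ℝ => tmul (R 0 q.1) (R q.1 q.2) w) (timeSimplex T) := by
    intro w hw
    have hRc : ∀ v : List ι, v.length ≤ n + 1 →
        ContinuousOn (fun q : ℝ × ℝ => R q.1 q.2 v) (timeSimplex T) := fun v hv =>
      hv.lt_or_eq.elim (fun hlt => hR.cont v (Nat.lt_succ_iff.1 hlt)) fun heq => by
        simpa only [hR0 v heq] using continuousOn_const
    exact continuousOn_finsetSum _ fun k _ =>
      (continuousOn_zero_fst (F := fun s t => R s t (w.take k))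
        (hRc _ (by rw [← hw]; exact List.length_take_le' k w))).mul
        (hRc _ (by rw [← hw, List.length_drop]; exact Nat.sub_le _ _))
  refine ⟨_, hR.updateLevel hR0 (F := fun s t w => J w t - J w s - tmul (R 0 s) (R s t) w)
    (fun w hw s u t hs hsu hut ht => ?_) (fun w hw => ?_) hJ, fun w hw s t => ?_⟩
  · linarith [hR.tmul_add_tmul hR0 hw le_rfl hs hsu hut ht]
  · have hJc := (hJ w hw).continuousOn hh (div_pos (by rw [hw]; positivity) hp)
      (A := fun s t => tmul (R 0 s) (R s t) w) (hA w hw)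
    exact ((continuousOn_snd_simplex hJc).sub (continuousOn_fst_simplex hJc)).sub (hA w hw)
  · rw [updateLevel_of_lt (Nat.lt_succ_iff.2 hw)]
    exact updateLevel_of_lt (Nat.lt_succ_iff.2 hw)

theorem exists_forall (hp : 0 < p) (hh : IsControl T h) (hm : p < m + 1)
    (hS : IsMultUpTo p T h m S) :
    ∃ S', (∀ n, IsMultUpTo p T h n S') ∧
      ∀ w : List ι, w.length ≤ m → ∀ s t, S' s t w = S s t w := by
  have hstep : ∀ (n : ℕ) (S : {S // IsMultUpTo (ι := ι) p T h (m + n) S}),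
      ∃ S' : {S // IsMultUpTo (ι := ι) p T h (m + (n + 1)) S},
        ∀ w : List ι, w.length ≤ m + n → ∀ s t, S'.1 s t w = S.1 s t w := fun n S => by
    obtain ⟨S', hS', heq⟩ :=
      S.2.exists_succ hp hh (by push_cast; linarith [n.cast_nonneg (α := ℝ)])
    exact ⟨⟨S', hS'⟩, heq⟩
  choose next hnext using hstep
  let f : (n : ℕ) → {S // IsMultUpTo (ι := ι) p T h (m + n) S} :=
    fun n => Nat.rec ⟨S, hS⟩ next n
  have hstable : ∀ (w : List ι) (k n : ℕ), w.length ≤ m + k → k ≤ n → ∀ s t,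
      (f n).1 s t w = (f k).1 s t w := by
    intro w k n hk hkn
    induction n, hkn using Nat.le_induction with
    | base => intros; rfl
    | succ n hkn ih => intro s t; rw [← ih]; exact hnext n (f n) w (by omega) s t
  exact ⟨fun s t w => (f w.length).1 s t w,
    fun n => (f n).2.of_eq (Nat.le_add_left n m) fun w hw s t =>
      (hstable w w.length n (by omega) hw s t).symm,
    fun w hw s t => hstable w 0 w.length hw (Nat.zero_le _) s t⟩

end IsMultUpTo

section LyonsExtension

variable {ι : Type} [Fintype ι] {p T : ℝ} {X : ℝ → ι → ℝ} {X2 : ℝ → ℝ → Matrix ι ι ℝ}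

theorem IsRoughPath.lift_self (hX : IsRoughPath p T X X2) {s : ℝ} (hs : 0 ≤ s) (ht : s ≤ T)
    (i j : ι) : X2 s s i j = 0 := by
  simpa using hX.chen s s s hs le_rfl le_rfl ht i j

theorem IsRoughPath.continuousOn_coord (hX : IsRoughPath p T X X2) (i : ι) :
    ContinuousOn (fun t => X t i) (Set.Icc 0 T) :=
  (continuous_apply i).comp_continuousOn hX.continuousOn_path

theorem IsRoughPath.exists_control (hp : 0 < p) (hX : IsRoughPath p T X X2) :
    ∃ h, IsControl T h ∧ (∀ i, Controlled T h (1 / p) fun s t => X t i - X s i) ∧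
      ∀ i j, Controlled T h (2 / p) fun s t => X2 s t i j := by
  obtain ⟨h, hh, hb⟩ := hX.var_path.exists_control hp
    (continuousOn_pi.2 fun i => (continuousOn_snd_simplex (hX.continuousOn_coord i)).sub
      (continuousOn_fst_simplex (hX.continuousOn_coord i))) (fun s _ _ => sub_self _)
  obtain ⟨h', hh', hb'⟩ := hX.var_lift.exists_control (by positivity)
    (continuousOn_pi.2 fun q => (continuous_apply_apply q.1 q.2).comp_continuousOn
      hX.continuousOn_lift) (fun s hs ht => funext fun q => hX.lift_self hs ht q.1 q.2)
  refine ⟨_, hh.add hh', fun i => ?_, fun i j => ?_⟩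
  · simpa using (hb i).add_left hh hh' (by positivity)
  · simpa using (hb' (i, j)).add_right hh hh' (by positivity)

/-- The functional `(1, X, X2, 0, …)`, from which Lyons' extension is built. -/
def truncatedSignature {ι : Type} (X : ℝ → ι → ℝ) (X2 : ℝ → ℝ → Matrix ι ι ℝ) (s t : ℝ) :
    TensorSeries ι
  | [] => 1
  | [i] => X t i - X s i
  | [i, j] => X2 s t i j
  | _ => 0

theorem IsRoughPath.isMultUpTo (hX : IsRoughPath p T X X2) {h : ℝ → ℝ}
    (hpath : ∀ i, Controlled T h (1 / p) fun s t => X t i - X s i)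
    (hlift : ∀ i j, Controlled T h (2 / p) fun s t => X2 s t i j) :
    IsMultUpTo p T h 2 (truncatedSignature X X2) where
  nil _ _ _ _ _ := rfl
  chen w hw s u t hs hsu hut ht := by
    match w, hw with
    | [], _ => simp [tmul_nil, truncatedSignature]
    | [i], _ => simp [tmul_cons, tmul_nil, truncatedSignature]
    | [i, j], _ =>
      simp only [tmul_cons, tmul_nil, truncatedSignature, hX.chen s u t hs hsu hut ht i j]
      ring
  cont w hw := by
    match w, hw with
    | [], _ => simpa [truncatedSignature] using continuousOn_const
    | [i], _ =>
      exact (continuousOn_snd_simplex (hX.continuousOn_coord i)).sub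
        (continuousOn_fst_simplex (hX.continuousOn_coord i))
    | [i, j], _ => exact (continuous_apply_apply i j).comp_continuousOn hX.continuousOn_lift
  bound w hw0 hw := by
    match w, hw0, hw with
    | [i], _, _ => simpa [truncatedSignature] using hpath i
    | [i, j], _, _ => simpa [truncatedSignature] using hlift i j

theorem IsRoughPath.exists_lyonsExtension (hp : 0 < p) (hp3 : p < 3)
    (hX : IsRoughPath p T X X2) : ∃ S, IsLyonsExtension p T X X2 S := by
  obtain ⟨h, hh, hpath, hlift⟩ := hX.exists_control hp
  obtain ⟨S, hS, heq⟩ :=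
    (hX.isMultUpTo hpath hlift).exists_forall hp hh (by push_cast; linarith)
  refine ⟨S, ?_, ?_, ?_, ?_, ?_, ?_⟩
  · exact fun s t _ _ _ => heq [] (by simp) s t
  · exact fun s t _ _ _ i => heq [i] (by simp) s t
  · exact fun s t _ _ _ i j => heq [i, j] (by simp) s t
  · exact fun s u t hs hsu hut ht => funext fun w => (hS _).chen w le_rfl s u t hs hsu hut ht
  · exact fun w => (hS _).cont w le_rfl
  · intro n hn
    refine HasFiniteVar.of_controlled hh (by positivity) fun v => ?_
    have hv : (List.ofFn v).length = n := List.length_ofFn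
    simpa using (hS n).bound (List.ofFn v) (List.ne_nil_of_length_pos (by omega)) hv.le

namespace IsLyonsExtension

variable {S : ℝ → ℝ → TensorSeries ι}

theorem self_eq_zero (hS : IsLyonsExtension p T X X2 S) {s : ℝ} (hs : 0 ≤ s) (hsT : s ≤ T)
    {w : List ι} (hw : w ≠ []) : S s s w = 0 := by
  induction hn : w.length using Nat.strong_induction_on generalizing w with
  | _ n ih =>
  have hchen := tmul_sub_tmul_right (a := S s s) (b := S s s) (b' := unit) (w := w) fun v hv => by
    rcases v with _ | ⟨x, v⟩
    · exact hS.level_zero s s hs le_rfl hsT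
    · exact ih _ (hn ▸ hv) (List.cons_ne_nil x v) rfl
  rw [← hS.chen s s s hs le_rfl le_rfl hsT, tmul_unit, sub_self,
    hS.level_zero s s hs le_rfl hsT] at hchen
  obtain ⟨x, v, rfl⟩ := List.exists_cons_of_ne_nil hw
  simpa [unit] using hchen.symm

theorem exists_control (hS : IsLyonsExtension p T X X2 S) (hp : 0 < p) (n : ℕ) :
    ∃ h, IsControl T h ∧ ∀ w : List ι, w ≠ [] → w.length ≤ n →
      Controlled T h (w.length / p) fun s t => S s t w := by
  induction n with
  | zero =>
    exact ⟨fun _ => 0, ⟨monotoneOn_const, continuousOn_const⟩, fun w hw0 hw =>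
      absurd (List.length_eq_zero_iff.1 (Nat.le_zero.1 hw)) hw0⟩
  | succ n ih =>
    obtain ⟨h, hh, hb⟩ := ih
    obtain ⟨h', hh', hb'⟩ := (hS.var (n + 1) (by omega)).exists_control (by positivity)
      (continuousOn_pi.2 fun v => hS.continuousOn _)
      (fun s hs ht => funext fun v => hS.self_eq_zero hs ht (by simp))
    refine ⟨_, hh.add hh', fun w hw0 hw => ?_⟩
    rcases hw.lt_or_eq with hlt | heq
    · exact (hb w hw0 (Nat.lt_succ_iff.1 hlt)).add_left hh hh' (by positivity)
    · have hw' := (hb' fun k => w.get (k.cast heq.symm)).add_right hh hh' (by positivity)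
      have hofFn : List.ofFn (fun k : Fin (n + 1) => w.get (k.cast heq.symm)) = w :=
        List.ext_getElem (by simp [heq]) fun k _ _ => by rw [List.getElem_ofFn]; rfl
      rw [hofFn] at hw'
      simpa [heq] using hw'

end IsLyonsExtension

end LyonsExtension

/-! ### Shuffles -/

section Shuffle

/-- The pairing `⟨u ⧢ v, a⟩` of the shuffle product of the words `u` and `v` with a series. -/
def shuffleEval {ι : Type} : List ι → List ι → TensorSeries ι → ℝ
  | [], v, a => a v
  | x :: u, [], a => a (x :: u)
  | x :: u, y :: v, a =>
      shuffleEval u (y :: v) (fun w => a (x :: w)) + shuffleEval (x :: u) v (fun w => a (y :: w))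
termination_by u v => u.length + v.length

variable {ι : Type}

theorem shuffleEval_nil_left (v : List ι) (a : TensorSeries ι) : shuffleEval [] v a = a v := by
  rw [shuffleEval]

theorem shuffleEval_nil_right (u : List ι) (a : TensorSeries ι) : shuffleEval u [] a = a u := by
  cases u <;> rw [shuffleEval]

theorem shuffleEval_cons_cons (x y : ι) (u v : List ι) (a : TensorSeries ι) :
    shuffleEval (x :: u) (y :: v) a =
      shuffleEval u (y :: v) (fun w => a (x :: w)) +
        shuffleEval (x :: u) v (fun w => a (y :: w)) := by
  rw [shuffleEval]

/-- `α` carries the data on which the series depends, and `shift x` its change when the first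
letter `x` is split off. -/
theorem shuffle_induction {α : Type*} (shift : ι → α → α) {P : List ι → List ι → α → Prop}
    (nil_left : ∀ v a, P [] v a) (nil_right : ∀ u a, P u [] a)
    (cons_cons : ∀ x y u v a, P u (y :: v) (shift x a) → P (x :: u) v (shift y a) →
      P (x :: u) (y :: v) a) (u v : List ι) (a : α) : P u v a := by
  induction hn : u.length + v.length using Nat.strong_induction_on generalizing u v a with
  | _ n ih =>
  match u, v with
  | [], v => exact nil_left v a
  | u, [] => exact nil_right u a
  | x :: u, y :: v =>
    simp only [List.length_cons] at hn
    exact cons_cons x y u v a (ih _ (by rw [List.length_cons]; omega) _ _ _ rfl)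
      (ih _ (by rw [List.length_cons]; omega) _ _ _ rfl)

theorem shuffleEval_sum {κ : Type*} (A : Finset κ) (c : κ → ℝ) (a : κ → TensorSeries ι)
    (u v : List ι) : shuffleEval u v (fun w => ∑ k ∈ A, c k * a k w) =
      ∑ k ∈ A, c k * shuffleEval u v (a k) := by
  refine shuffle_induction (α := κ → TensorSeries ι) (fun x a k w => a k (x :: w))
    (P := fun u v a => shuffleEval u v (fun w => ∑ k ∈ A, c k * a k w) =
      ∑ k ∈ A, c k * shuffleEval u v (a k)) ?_ ?_ ?_ u v a
  · intro v a; simp only [shuffleEval_nil_left]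
  · intro u a; simp only [shuffleEval_nil_right]
  · intro x y u v a hleft hright
    simp only [shuffleEval_cons_cons, mul_add, Finset.sum_add_distrib, hleft, hright]

theorem shuffleEval_add (u v : List ι) (a b : TensorSeries ι) :
    shuffleEval u v (fun w => a w + b w) = shuffleEval u v a + shuffleEval u v b := by
  simpa using shuffleEval_sum Finset.univ (fun _ : Bool => 1) (fun k => if k then a else b) u v

theorem shuffleEval_mul (u v : List ι) (c : ℝ) (a : TensorSeries ι) :
    shuffleEval u v (fun w => c * a w) = c * shuffleEval u v a := by
  simpa using shuffleEval_sum {()} (fun _ => c) (fun _ => a) u v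

theorem shuffleEval_congr {u v : List ι} {a b : TensorSeries ι}
    (h : ∀ w, w.length = u.length + v.length → a w = b w) :
    shuffleEval u v a = shuffleEval u v b := by
  refine shuffle_induction (α := TensorSeries ι × TensorSeries ι)
    (fun x q => (fun w => q.1 (x :: w), fun w => q.2 (x :: w)))
    (P := fun u v q => (∀ w, w.length = u.length + v.length → q.1 w = q.2 w) →
      shuffleEval u v q.1 = shuffleEval u v q.2) ?_ ?_ ?_ u v (a, b) h
  · intro v q h; simpa only [shuffleEval_nil_left] using h v (by simp)
  · intro u q h; simpa only [shuffleEval_nil_right] using h u (by simp)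
  · intro x y u v q hleft hright h
    simp only [shuffleEval_cons_cons]
    rw [hleft fun w hw => h (x :: w) (by simp only [List.length_cons] at hw ⊢; omega),
      hright fun w hw => h (y :: w) (by simp only [List.length_cons] at hw ⊢; omega)]

theorem Controlled.shuffleEval {T θ : ℝ} {h : ℝ → ℝ} {u v : List ι}
    {S : ℝ → ℝ → TensorSeries ι}
    (hS : ∀ w, w.length = u.length + v.length → Controlled T h θ fun s t => S s t w) :
    Controlled T h θ fun s t => shuffleEval u v (S s t) := by
  refine shuffle_induction (α := ℝ → ℝ → TensorSeries ι) (fun x S s t w => S s t (x :: w))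
    (P := fun u v S =>
      (∀ w, w.length = u.length + v.length → Controlled T h θ fun s t => S s t w) →
        Controlled T h θ fun s t => _root_.shuffleEval u v (S s t)) ?_ ?_ ?_ u v S hS
  · intro v S hS; simpa only [shuffleEval_nil_left] using hS v (by simp)
  · intro u S hS; simpa only [shuffleEval_nil_right] using hS u (by simp)
  · intro x y u v S hleft hright hS
    simp only [shuffleEval_cons_cons]
    exact (hleft fun w hw => hS (x :: w) (by simp only [List.length_cons] at hw ⊢; omega)).add
      (hright fun w hw => hS (y :: w) (by simp only [List.length_cons] at hw ⊢; omega))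

theorem shuffleEval_tmul (u v : List ι) (a b : TensorSeries ι) :
    shuffleEval u v (tmul a b) =
      ∑ i ∈ Finset.range (u.length + 1), ∑ j ∈ Finset.range (v.length + 1),
        shuffleEval (u.take i) (v.take j) a * shuffleEval (u.drop i) (v.drop j) b := by
  refine shuffle_induction (fun x a w => a (x :: w))
    (P := fun u v a => shuffleEval u v (tmul a b) =
      ∑ i ∈ Finset.range (u.length + 1), ∑ j ∈ Finset.range (v.length + 1),
        shuffleEval (u.take i) (v.take j) a * shuffleEval (u.drop i) (v.drop j) b) ?_ ?_ ?_ u v a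
  · intro v a; simp [shuffleEval_nil_left, tmul]
  · intro u a; simp [shuffleEval_nil_right, tmul]
  · intro x y u v a hleft hright
    simp only [shuffleEval_cons_cons, tmul_cons, shuffleEval_add, shuffleEval_mul, hleft, hright]
    simp only [List.length_cons]
    simp only [Finset.sum_range_succ' _ (u.length + 1), Finset.sum_range_succ' _ (v.length + 1),
      List.take_succ_cons, List.drop_succ_cons, List.take_zero, List.drop_zero,
      shuffleEval_nil_left, shuffleEval_nil_right, shuffleEval_cons_cons, add_mul, mul_add,
      Finset.sum_add_distrib]
    ring

theorem shuffleEval_tmul_sub_mul {a b : TensorSeries ι} {u v : List ι} (ha0 : a [] = 1)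
    (hb0 : b [] = 1) (huv : u ≠ [] ∨ v ≠ [])
    (ha : ∀ u' v' : List ι, u'.length + v'.length < u.length + v.length →
      shuffleEval u' v' a = a u' * a v')
    (hb : ∀ u' v' : List ι, u'.length + v'.length < u.length + v.length →
      shuffleEval u' v' b = b u' * b v') :
    shuffleEval u v (tmul a b) - tmul a b u * tmul a b v =
      (shuffleEval u v a - a u * a v) + (shuffleEval u v b - b u * b v) := by
  have hpos : 0 < u.length + v.length := by
    rcases huv with h | h <;> have := List.length_pos_iff.2 h <;> omega
  rw [shuffleEval_tmul, tmul, tmul, Finset.sum_mul_sum, ← Finset.sum_product',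
    ← Finset.sum_product', ← Finset.sum_sub_distrib,
    Finset.sum_eq_add (0, 0) (u.length, v.length) (by simp; omega) ?_ (by simp) (by simp)]
  · simp only [List.take_zero, List.drop_zero, List.take_length, List.drop_length,
      shuffleEval_nil_left, ha0, hb0]
    ring
  · rintro ⟨i, j⟩ hij ⟨hne0, hne1⟩
    simp only [Finset.mem_product, Finset.mem_range, Prod.mk.injEq, ne_eq] at hij hne0 hne1
    rw [ha _ _ (by simp only [List.length_take]; omega),
      hb _ _ (by simp only [List.length_drop]; omega)]
    ring

/-- Characters of the shuffle algebra: the series `g` with `⟨u ⧢ v, g⟩ = ⟨u, g⟩ ⟨v, g⟩`. -/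
structure IsShuffleCharacter (g : TensorSeries ι) : Prop where
  nil : g [] = 1
  shuffle : ∀ u v, shuffleEval u v g = g u * g v

theorem IsShuffleCharacter.tmul {g g' : TensorSeries ι} (hg : IsShuffleCharacter g)
    (hg' : IsShuffleCharacter g') : IsShuffleCharacter (TensorSeries.tmul g g') := by
  refine ⟨by rw [tmul_nil, hg.nil, hg'.nil, mul_one], fun u v => ?_⟩
  rw [shuffleEval_tmul, TensorSeries.tmul, TensorSeries.tmul, Finset.sum_mul_sum]
  refine Finset.sum_congr rfl fun i _ => Finset.sum_congr rfl fun j _ => ?_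
  rw [hg.shuffle, hg'.shuffle]
  ring

theorem shuffleEval_unit {u v : List ι} (h : u ≠ [] ∨ v ≠ []) :
    shuffleEval u v (unit : TensorSeries ι) = 0 := by
  have hpos : 0 < u.length + v.length := by
    rcases h with h | h <;> have := List.length_pos_iff.2 h <;> omega
  calc shuffleEval u v (unit : TensorSeries ι)
      = shuffleEval u v fun w => 0 * unit w := shuffleEval_congr fun w hw => by
        obtain ⟨x, w, rfl⟩ := List.exists_cons_of_length_pos (hw ▸ hpos)
        rw [zero_mul, unit]
    _ = 0 := by rw [shuffleEval_mul, zero_mul]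

theorem isShuffleCharacter_unit : IsShuffleCharacter (unit : TensorSeries ι) := by
  refine ⟨rfl, fun u v => ?_⟩
  rcases u with _ | ⟨x, u⟩
  · rw [shuffleEval_nil_left, unit, one_mul]
  · rw [shuffleEval_unit (Or.inl (List.cons_ne_nil x u)), unit, zero_mul]

/-- The defect of the character property on words of total length `n ≥ 3` is additive over
intervals and of order `n / p > 1`, hence vanishes. -/
theorem IsLyonsExtension.isShuffleCharacter [Fintype ι] {p T : ℝ} (hp : 0 < p)
    (hp3 : p < 3) {X : ℝ → ι → ℝ} {X2 : ℝ → ℝ → Matrix ι ι ℝ}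
    {S : ℝ → ℝ → TensorSeries ι} (hS : IsLyonsExtension p T X X2 S)
    (hsymm : ∀ s t : ℝ, 0 ≤ s → s ≤ t → t ≤ T → ∀ i j,
      X2 s t i j + X2 s t j i = (X t i - X s i) * (X t j - X s j))
    {s t : ℝ} (hs : 0 ≤ s) (hst : s ≤ t) (ht : t ≤ T) : IsShuffleCharacter (S s t) := by
  refine ⟨hS.level_zero s t hs hst ht, fun u v => ?_⟩
  induction hn : u.length + v.length using Nat.strong_induction_on generalizing u v s t with
  | _ n ih =>
  rcases eq_or_ne u [] with rfl | hu
  · rw [shuffleEval_nil_left, hS.level_zero s t hs hst ht, one_mul]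
  rcases eq_or_ne v [] with rfl | hv
  · rw [shuffleEval_nil_right, hS.level_zero s t hs hst ht, mul_one]
  have hu' := List.length_pos_iff.2 hu
  have hv' := List.length_pos_iff.2 hv
  rcases Nat.lt_or_ge n 3 with hn3 | hn3
  · obtain ⟨i, rfl⟩ := List.length_eq_one_iff.1 (show u.length = 1 by omega)
    obtain ⟨j, rfl⟩ := List.length_eq_one_iff.1 (show v.length = 1 by omega)
    rw [shuffleEval_cons_cons, shuffleEval_nil_left, shuffleEval_nil_right,
      hS.level_two s t hs hst ht, hS.level_two s t hs hst ht, hS.level_one s t hs hst ht,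
      hS.level_one s t hs hst ht, hsymm s t hs hst ht]
  obtain ⟨h, hh, hb⟩ := hS.exists_control hp n
  have hdefect : Controlled T h (n / p) fun s t => shuffleEval u v (S s t) - S s t u * S s t v := by
    refine Controlled.sub (Controlled.shuffleEval fun w hw => ?_) ?_
    · simpa only [hw, hn] using hb w (List.ne_nil_of_length_pos (by omega)) (by omega)
    · have := (hb u hu (by omega)).mul hh (by positivity) (by positivity) (hb v hv (by omega))
      rwa [← add_div, ← Nat.cast_add, hn] at this
  have hθ : 1 < n / p := (one_lt_div hp).2 (hp3.trans_le (by exact_mod_cast hn3))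
  refine sub_eq_zero.1 (hdefect.eq_zero hh hθ (fun s r t hs hsr hrt ht => ?_) hs hst ht)
  rw [hS.chen s r t hs hsr hrt ht]
  exact shuffleEval_tmul_sub_mul (hS.level_zero s r hs hsr (hrt.trans ht))
    (hS.level_zero r t (hs.trans hsr) hrt ht) (Or.inl hu)
    (fun u' v' h' => ih _ (hn ▸ h') hs hsr (hrt.trans ht) u' v' rfl)
    (fun u' v' h' => ih _ (hn ▸ h') (hs.trans hsr) hrt ht u' v' rfl)

end Shuffle

/-! ### Exponentials and Lie series -/

namespace TensorSeries

variable {ι : Type}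

theorem tpow_eq_zero {a : TensorSeries ι} (ha : a [] = 0) (k : ℕ) :
    ∀ w : List ι, w.length < k → tpow a k w = 0 := by
  induction k with
  | zero => exact fun w hw => absurd hw (Nat.not_lt_zero _)
  | succ k ih =>
    intro w hw
    rw [tpow, tmul]
    refine Finset.sum_eq_zero fun j _ => ?_
    rcases Nat.lt_or_ge j w.length with hjw | hjw
    · rw [ih _ (by rw [List.length_take]; omega), zero_mul]
    · rw [List.drop_of_length_le hjw, ha, mul_zero]

theorem tpow_congr {a b : TensorSeries ι} {n : ℕ} (hab : ∀ v, v.length < n → a v = b v) (k : ℕ) :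
    ∀ w : List ι, w.length < n → tpow a k w = tpow b k w := by
  induction k with
  | zero => exact fun w _ => rfl
  | succ k ih =>
    exact fun w hw => tmul_congr (fun v hv => ih v (by omega)) (fun v hv => hab v (by omega))

theorem tpow_congr_of_two_le {a b : TensorSeries ι} (ha : a [] = 0) (hb : b [] = 0) {n : ℕ}
    (hab : ∀ v, v.length < n → a v = b v) {k : ℕ} (hk : 2 ≤ k) {w : List ι} (hw : w.length ≤ n) :
    tpow a k w = tpow b k w := by
  obtain ⟨k, rfl⟩ := Nat.exists_eq_add_of_le' (show 1 ≤ k by omega)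
  rw [tpow, tpow, tmul, tmul]
  refine Finset.sum_congr rfl fun j _ => ?_
  rcases Nat.eq_zero_or_pos j with rfl | hj0
  · rw [List.take_zero, tpow_eq_zero ha _ _ (by rw [List.length_nil]; omega),
      tpow_eq_zero hb _ _ (by rw [List.length_nil]; omega), zero_mul, zero_mul]
  rcases Nat.lt_or_ge j w.length with hjw | hjw
  · rw [tpow_congr hab _ _ (by rw [List.length_take]; omega),
      hab _ (by rw [List.length_drop]; omega)]
  · rw [List.drop_of_length_le hjw, ha, hb, mul_zero, mul_zero]

theorem tpow_one (a : TensorSeries ι) : tpow a 1 = a := unit_tmul a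

theorem tpow_smul (c : ℝ) (a : TensorSeries ι) (k : ℕ) :
    tpow (fun w => c * a w) k = fun w => c ^ k * tpow a k w := by
  induction k with
  | zero => funext w; simp [tpow]
  | succ k ih =>
    funext w
    rw [tpow, ih, smul_tmul, tmul_smul, tpow]
    ring

theorem tpow_add (a : TensorSeries ι) (i j : ℕ) :
    tpow a (i + j) = tmul (tpow a i) (tpow a j) := by
  induction j with
  | zero => exact (tmul_unit _).symm
  | succ j ih => rw [← add_assoc, tpow, ih, tpow, tmul_assoc]

theorem texp_eq_sum {a : TensorSeries ι} (ha : a [] = 0) {w : List ι} {n : ℕ}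
    (hn : w.length ≤ n) :
    texp a w = ∑ k ∈ Finset.range (n + 1), (k.factorial : ℝ)⁻¹ * tpow a k w := by
  refine Finset.sum_subset (Finset.range_mono (by omega)) fun k _ hk => ?_
  rw [tpow_eq_zero ha k w (by simpa using hk), mul_zero]

theorem texp_eq_add (a : TensorSeries ι) {w : List ι} (hw : w ≠ []) :
    texp a w = a w + ∑ k ∈ Finset.Ico 2 (w.length + 1), (k.factorial : ℝ)⁻¹ * tpow a k w := by
  have hlen := List.length_pos_iff.2 hw
  obtain ⟨x, v, rfl⟩ := List.exists_cons_of_ne_nil hw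
  rw [texp, Finset.range_eq_Ico, Finset.sum_eq_sum_Ico_succ_bot (by omega),
    Finset.sum_eq_sum_Ico_succ_bot (by omega), tpow_one]
  simp [tpow, unit]

/-- Approximations of the tensor logarithm of `g`, obtained by iterating
`a ↦ g - ∑_{k ≥ 2} a^{⊗ k} / k!` on the components of positive level; the `n`-th one is correct up
to level `n`. -/
noncomputable def logIter (g : TensorSeries ι) : ℕ → TensorSeries ι
  | 0 => fun _ => 0
  | n + 1 => fun w => match w with
    | [] => 0
    | x :: w => g (x :: w) -
        ∑ k ∈ Finset.Ico 2 ((x :: w).length + 1), (k.factorial : ℝ)⁻¹ *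
          tpow (logIter g n) k (x :: w)

theorem logIter_nil (g : TensorSeries ι) (n : ℕ) : logIter g n [] = 0 := by cases n <;> rfl

theorem logIter_stable (g : TensorSeries ι) (n : ℕ) :
    ∀ m, n ≤ m → ∀ w : List ι, w.length ≤ n → logIter g m w = logIter g n w := by
  induction n with
  | zero =>
    intro m _ w hw
    rw [List.eq_nil_of_length_eq_zero (Nat.le_zero.1 hw), logIter_nil, logIter_nil]
  | succ n ih =>
    intro m hm w hw
    obtain ⟨m, rfl⟩ := Nat.exists_eq_add_of_le' (show 1 ≤ m by omega)
    rcases w with _ | ⟨x, w⟩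
    · rfl
    · simp only [logIter]
      congr 1
      refine Finset.sum_congr rfl fun k hk => ?_
      rw [tpow_congr_of_two_le (logIter_nil g m) (logIter_nil g n) (n := n + 1)
        (fun v hv => ih m (by omega) v (by omega)) (Finset.mem_Ico.1 hk).1 hw]

theorem exists_texp_eq {g : TensorSeries ι} (hg : g [] = 1) :
    ∃ a : TensorSeries ι, a [] = 0 ∧ texp a = g := by
  set a : TensorSeries ι := fun w => logIter g w.length w
  have ha : a [] = 0 := rfl
  refine ⟨a, ha, funext fun w => ?_⟩
  rcases w with _ | ⟨x, w⟩
  · simp [texp, tpow, unit, hg]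
  have ha_cons : a (x :: w) = g (x :: w) - ∑ k ∈ Finset.Ico 2 ((x :: w).length + 1),
      (k.factorial : ℝ)⁻¹ * tpow (logIter g w.length) k (x :: w) := rfl
  rw [texp_eq_add a (List.cons_ne_nil x w), ha_cons, sub_add_eq_add_sub, sub_eq_iff_eq_add]
  congr 1
  refine Finset.sum_congr rfl fun k hk => ?_
  rw [tpow_congr_of_two_le ha (logIter_nil g w.length) (n := w.length + 1)
    (fun v hv => (logIter_stable g v.length w.length (by omega) v le_rfl).symm)
    (Finset.mem_Ico.1 hk).1 (List.length_cons ..).le]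

theorem texp_smul_eq_sum {a : TensorSeries ι} (ha : a [] = 0) (c : ℝ) {w : List ι} {n : ℕ}
    (hn : w.length ≤ n) : texp (fun v => c * a v) w =
      ∑ k ∈ Finset.range (n + 1), c ^ k * ((k.factorial : ℝ)⁻¹ * tpow a k w) := by
  rw [texp_eq_sum (by rw [ha, mul_zero]) hn]
  refine Finset.sum_congr rfl fun k _ => ?_
  rw [tpow_smul]
  ring

theorem tmul_texp_smul_texp_smul {a : TensorSeries ι} (ha : a [] = 0) (c c' : ℝ) (w : List ι) :
    tmul (texp fun v => c * a v) (texp fun v => c' * a v) w =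
      ∑ i ∈ Finset.range (w.length + 1), ∑ j ∈ Finset.range (w.length + 1),
        c ^ i * (i.factorial : ℝ)⁻¹ * (c' ^ j * (j.factorial : ℝ)⁻¹) * tpow a (i + j) w := by
  have htake := fun k => texp_smul_eq_sum ha c (w := w.take k) (n := w.length) (by simp)
  have hdrop := fun k => texp_smul_eq_sum ha c' (w := w.drop k) (n := w.length) (by simp)
  simp only [tmul, htake, hdrop, Finset.sum_mul_sum, tpow_add]
  simp only [Finset.mul_sum]
  rw [Finset.sum_comm]
  refine Finset.sum_congr rfl fun i _ => ?_
  rw [Finset.sum_comm]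
  refine Finset.sum_congr rfl fun j _ => Finset.sum_congr rfl fun k _ => ?_
  ring

theorem texp_add_smul {a : TensorSeries ι} (ha : a [] = 0) (c c' : ℝ) :
    texp (fun v => (c + c') * a v) = tmul (texp fun v => c * a v) (texp fun v => c' * a v) := by
  funext w
  have truncate : ∀ i ∈ Finset.range (w.length + 1), ∑ j ∈ Finset.range (w.length + 1),
        c ^ i * (i.factorial : ℝ)⁻¹ * (c' ^ j * (j.factorial : ℝ)⁻¹) * tpow a (i + j) w =
      ∑ j ∈ Finset.range (w.length + 1 - i),
        c ^ i * (i.factorial : ℝ)⁻¹ * (c' ^ j * (j.factorial : ℝ)⁻¹) * tpow a (i + j) w := by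
    intro i _
    refine (Finset.sum_subset (Finset.range_mono (by omega)) fun j _ hj => ?_).symm
    rw [tpow_eq_zero ha _ _ (by rw [Finset.mem_range] at hj; omega), mul_zero]
  rw [texp_smul_eq_sum ha (c + c') le_rfl, tmul_texp_smul_texp_smul ha,
    Finset.sum_congr rfl truncate, ← Finset.sum_range_diag_flip (w.length + 1) fun i j =>
      c ^ i * (i.factorial : ℝ)⁻¹ * (c' ^ j * (j.factorial : ℝ)⁻¹) * tpow a (i + j) w]
  refine Finset.sum_congr rfl fun k _ => ?_
  rw [add_pow, Finset.sum_mul]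
  refine Finset.sum_congr rfl fun i hi => ?_
  have hik : i ≤ k := Nat.lt_succ_iff.1 (Finset.mem_range.1 hi)
  rw [Nat.add_sub_cancel' hik, Nat.cast_choose ℝ hik]
  have := Nat.factorial_ne_zero k
  field_simp

theorem isShuffleCharacter_texp_nsmul {a : TensorSeries ι} (ha : a [] = 0)
    (hg : IsShuffleCharacter (texp a)) (m : ℕ) :
    IsShuffleCharacter (texp fun v => (m : ℝ) * a v) := by
  induction m with
  | zero =>
    convert isShuffleCharacter_unit using 1
    funext w
    rw [texp_smul_eq_sum ha _ le_rfl, Finset.sum_range_succ', Finset.sum_eq_zero]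
    · simp [tpow]
    · simp
  | succ m ih =>
    rw [Nat.cast_succ, texp_add_smul ha]
    simp only [one_mul]
    exact ih.tmul hg

open Polynomial in
theorem coeff_one_of_sum_pow_eq_mul {n : ℕ} (hn : 1 ≤ n) {α β γ : ℕ → ℝ}
    (h : ∀ m : ℕ, ∑ k ∈ Finset.range (n + 1), (m : ℝ) ^ k * α k =
      (∑ k ∈ Finset.range (n + 1), (m : ℝ) ^ k * β k) *
        ∑ k ∈ Finset.range (n + 1), (m : ℝ) ^ k * γ k) :
    α 1 = β 0 * γ 1 + β 1 * γ 0 := by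
  let poly (c : ℕ → ℝ) : ℝ[X] := ∑ k ∈ Finset.range (n + 1), C (c k) * X ^ k
  have eval_poly (c : ℕ → ℝ) (x : ℝ) :
      (poly c).eval x = ∑ k ∈ Finset.range (n + 1), x ^ k * c k := by
    simp only [poly, eval_finsetSum, eval_mul, eval_C, eval_pow, eval_X, mul_comm]
  have coeff_poly (c : ℕ → ℝ) (k : ℕ) (hk : k ≤ n) : (poly c).coeff k = c k := by
    simp only [poly, finsetSum_coeff, coeff_C_mul, coeff_X_pow, mul_ite, mul_one, mul_zero]
    rw [Finset.sum_ite_eq, if_pos (Finset.mem_range.2 (by omega))]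
  have poly_eq : poly α = poly β * poly γ := by
    refine eq_of_infinite_eval_eq _ _
      ((Set.infinite_range_of_injective (Nat.cast_injective (R := ℝ))).mono ?_)
    rintro _ ⟨m, rfl⟩
    rw [Set.mem_ofPred_eq, eval_mul, eval_poly, eval_poly, eval_poly, h m]
  rw [← coeff_poly α 1 hn, poly_eq, mul_coeff_one, coeff_poly β 0 n.zero_le, coeff_poly γ 1 hn,
    coeff_poly β 1 hn, coeff_poly γ 0 n.zero_le]

/-- The character identity for `exp (m a)`, `m ∈ ℕ`, is polynomial in `m`; its linear term is the
claim. -/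
theorem shuffleEval_eq_zero_of_texp {a : TensorSeries ι} (ha : a [] = 0)
    (hg : IsShuffleCharacter (texp a)) {u v : List ι} (hu : u ≠ []) (hv : v ≠ []) :
    shuffleEval u v a = 0 := by
  set n := u.length + v.length
  have shuffleEval_texp (m : ℕ) : shuffleEval u v (texp fun w => (m : ℝ) * a w) =
      ∑ k ∈ Finset.range (n + 1),
        (m : ℝ) ^ k * ((k.factorial : ℝ)⁻¹ * shuffleEval u v (tpow a k)) := by
    rw [shuffleEval_congr (b := fun w => ∑ k ∈ Finset.range (n + 1),
      ((m : ℝ) ^ k * (k.factorial : ℝ)⁻¹) * tpow a k w), shuffleEval_sum]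
    · simp only [mul_assoc]
    · intro w hw
      rw [texp_smul_eq_sum ha (m : ℝ) (n := n) (by omega)]
      simp only [mul_assoc]
  have hpow : ∀ w : List ι, w ≠ [] → tpow a 0 w = 0 := by
    rintro (_ | ⟨x, w⟩) hw
    exacts [absurd rfl hw, rfl]
  have key := coeff_one_of_sum_pow_eq_mul (n := n)
    (by have := List.length_pos_iff.2 hu; omega)
    (α := fun k => (k.factorial : ℝ)⁻¹ * shuffleEval u v (tpow a k))
    (β := fun k => (k.factorial : ℝ)⁻¹ * tpow a k u)
    (γ := fun k => (k.factorial : ℝ)⁻¹ * tpow a k v) fun m => by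
      rw [← texp_smul_eq_sum ha (m : ℝ) (w := u) (by omega),
        ← texp_smul_eq_sum ha (m : ℝ) (w := v) (by omega),
        ← (isShuffleCharacter_texp_nsmul ha hg m).shuffle u v, shuffleEval_texp]
  simpa [tpow_one, hpow u hu, hpow v hv] using key

end TensorSeries

section Dynkin

variable {ι : Type}

/-- The shuffle convolution `∑_{w = uv} c |u| ⟨u ⧢ v.reverse, a⟩`. With the sign `(-1)^|v|`, the
reversal is the antipode of the shuffle algebra. -/
def splitShuffle (c : ℕ → ℝ) (w : List ι) (a : TensorSeries ι) : ℝ :=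
  ∑ k ∈ Finset.range (w.length + 1), c k * shuffleEval (w.take k) (w.drop k).reverse a

theorem shuffleEval_take_drop_cons_concat (x y : ι) {w : List ι} {k : ℕ} (hk : k ≤ w.length)
    (a : TensorSeries ι) :
    shuffleEval ((x :: (w ++ [y])).take (k + 1)) ((x :: (w ++ [y])).drop (k + 1)).reverse a =
      shuffleEval ((w ++ [y]).take k) ((w ++ [y]).drop k).reverse (fun v => a (x :: v)) +
      shuffleEval ((x :: w).take (k + 1)) ((x :: w).drop (k + 1)).reverse
        (fun v => a (y :: v)) := by
  simp only [List.take_succ_cons, List.drop_succ_cons, List.drop_append_of_le_length hk,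
    List.take_append_of_le_length hk, List.reverse_append, List.reverse_cons, List.reverse_nil,
    List.nil_append, List.singleton_append, shuffleEval_cons_cons]

theorem splitShuffle_cons_concat (c : ℕ → ℝ) (x y : ι) (w : List ι) (a : TensorSeries ι) :
    splitShuffle c (x :: (w ++ [y])) a =
      splitShuffle (fun k => c (k + 1)) (w ++ [y]) (fun v => a (x :: v)) +
        splitShuffle c (x :: w) (fun v => a (y :: v)) := by
  simp only [splitShuffle, List.length_cons, List.length_append, List.length_nil, zero_add]
  rw [Finset.sum_range_succ' _ (w.length + 1 + 1), Finset.sum_range_succ _ (w.length + 1),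
    Finset.sum_range_succ _ (w.length + 1), Finset.sum_range_succ' _ (w.length + 1),
    Finset.sum_congr rfl fun k hk => by rw [shuffleEval_take_drop_cons_concat x y
      (Nat.lt_succ_iff.1 (Finset.mem_range.1 hk)) a, mul_add], Finset.sum_add_distrib]
  have take_all : (w ++ [y]).take (w.length + 1) = w ++ [y] := List.take_of_length_le (by simp)
  have drop_all : (w ++ [y]).drop (w.length + 1) = [] := List.drop_of_length_le (by simp)
  simp only [List.take_succ_cons, List.drop_succ_cons, take_all, drop_all, List.reverse_nil,
    shuffleEval_nil_right, List.take_zero, List.drop_zero, shuffleEval_nil_left,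
    List.reverse_cons, List.reverse_append, List.nil_append, List.cons_append]
  ring

theorem splitShuffle_add (c c' : ℕ → ℝ) (w : List ι) (a : TensorSeries ι) :
    splitShuffle (fun k => c k + c' k) w a = splitShuffle c w a + splitShuffle c' w a := by
  simp only [splitShuffle, add_mul, Finset.sum_add_distrib]

theorem splitShuffle_neg (c : ℕ → ℝ) (w : List ι) (a : TensorSeries ι) :
    splitShuffle (fun k => -c k) w a = -splitShuffle c w a := by
  simp only [splitShuffle, neg_mul, Finset.sum_neg_distrib]

theorem splitShuffle_neg_one_pow {w : List ι} (hw : w ≠ []) (a : TensorSeries ι) :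
    splitShuffle (fun k => (-1) ^ k) w a = 0 := by
  induction hn : w.length generalizing w a with
  | zero => exact absurd (List.eq_nil_of_length_eq_zero hn) hw
  | succ n ih =>
    induction w using List.bidirectionalRec with
    | nil => exact absurd rfl hw
    | singleton x =>
      simp [splitShuffle, Finset.sum_range_succ, shuffleEval_nil_left, shuffleEval_nil_right]
    | cons_append x v y _ =>
      simp only [splitShuffle_cons_concat, pow_succ, mul_neg_one, splitShuffle_neg]
      rw [ih (by simp) _ (by simpa using hn), ih (by simp) _ (by simpa using hn), neg_zero,
        add_zero]

/-- The pairing of `a` with the adjoint of Dynkin's operator at `w`: the convolution of the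
grading of the shuffle algebra with its antipode. -/
def dynkinEval (w : List ι) (a : TensorSeries ι) : ℝ :=
  (-1) ^ w.length * splitShuffle (fun k => (-1) ^ k * k) w a

theorem dynkinEval_singleton (x : ι) (a : TensorSeries ι) : dynkinEval [x] a = a [x] := by
  simp [dynkinEval, splitShuffle, Finset.sum_range_succ, shuffleEval_nil_right]

theorem dynkinEval_cons_concat (x y : ι) (w : List ι) (a : TensorSeries ι) :
    dynkinEval (x :: (w ++ [y])) a = dynkinEval (w ++ [y]) (fun v => a (x :: v)) -
      dynkinEval (x :: w) (fun v => a (y :: v)) := by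
  have hweights : (fun k : ℕ => (-1 : ℝ) ^ (k + 1) * ((k + 1 : ℕ) : ℝ)) =
      fun k : ℕ => -((-1 : ℝ) ^ k * k) + -(-1) ^ k := by
    funext k; push_cast; ring
  simp only [dynkinEval, splitShuffle_cons_concat]
  rw [hweights, splitShuffle_add, splitShuffle_neg, splitShuffle_neg,
    splitShuffle_neg_one_pow (by simp)]
  simp only [List.length_cons, List.length_append, List.length_nil]
  ring

theorem dynkinEval_of_shuffleEval_eq_zero {a : TensorSeries ι}
    (ha : ∀ u v, u ≠ [] → v ≠ [] → shuffleEval u v a = 0) (w : List ι) :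
    dynkinEval w a = w.length * a w := by
  rw [dynkinEval, splitShuffle, Finset.sum_range_succ, Finset.sum_eq_zero]
  · simp only [List.take_length, List.drop_length, List.reverse_nil, shuffleEval_nil_right,
      zero_add]
    rw [← mul_assoc, ← mul_assoc, ← mul_pow, neg_one_mul, neg_neg, one_pow, one_mul]
  · intro k hk
    have hk := Finset.mem_range.1 hk
    rcases Nat.eq_zero_or_pos k with rfl | hk0
    · rw [Nat.cast_zero, mul_zero, zero_mul]
    · rw [ha, mul_zero]
      · rw [← List.length_pos_iff, List.length_take]; omega
      · rw [← List.length_pos_iff, List.length_reverse, List.length_drop]; omega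

theorem tensorPoly_ext {P Q : TensorPoly ι}
    (h : ∀ w : List ι, P.coeff (FreeMonoid.ofList w) = Q.coeff (FreeMonoid.ofList w)) : P = Q :=
  MonoidAlgebra.ext (Finsupp.ext h)

theorem coeff_basisTensor [DecidableEq ι] (v w : List ι) :
    (basisTensor v).coeff (FreeMonoid.ofList w) = if v = w then 1 else 0 := by
  classical
  rw [basisTensor, MonoidAlgebra.coeff_single, Finsupp.single_apply]
  exact if_congr FreeMonoid.ofList.injective.eq_iff rfl rfl

theorem coeff_basisTensor_mul_nil (x : ι) (P : TensorPoly ι) :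
    (basisTensor [x] * P).coeff (FreeMonoid.ofList []) = 0 :=
  MonoidAlgebra.coeff_single_mul_of_forall_mul_ne _ _ fun m hm => by
    simpa using congrArg FreeMonoid.length hm

theorem coeff_mul_basisTensor_nil (x : ι) (P : TensorPoly ι) :
    (P * basisTensor [x]).coeff (FreeMonoid.ofList []) = 0 :=
  MonoidAlgebra.coeff_mul_single_of_forall_mul_ne _ _ fun m hm => by
    simpa using congrArg FreeMonoid.length hm

theorem coeff_basisTensor_mul_cons [DecidableEq ι] (x y : ι) (w : List ι) (P : TensorPoly ι) :
    (basisTensor [x] * P).coeff (FreeMonoid.ofList (y :: w)) =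
      if x = y then P.coeff (FreeMonoid.ofList w) else 0 := by
  rw [basisTensor]
  split_ifs with h
  · subst h
    rw [MonoidAlgebra.coeff_single_mul_eq_mul_coeff (FreeMonoid.ofList w), one_mul]
    exact fun m _ => ⟨fun h => List.tail_eq_of_cons_eq h, by rintro rfl; rfl⟩
  · exact MonoidAlgebra.coeff_single_mul_of_forall_mul_ne _ _ fun m hm =>
      h (List.head_eq_of_cons_eq hm)

theorem coeff_mul_basisTensor_concat [DecidableEq ι] (x y : ι) (w : List ι) (P : TensorPoly ι) :
    (P * basisTensor [x]).coeff (FreeMonoid.ofList (w ++ [y])) =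
      if x = y then P.coeff (FreeMonoid.ofList w) else 0 := by
  rw [basisTensor]
  split_ifs with h
  · subst h
    rw [MonoidAlgebra.coeff_mul_single_eq_coeff_mul (FreeMonoid.ofList w), mul_one]
    exact fun m _ => ⟨fun h => (List.append_inj' h rfl).1, by rintro rfl; rfl⟩
  · exact MonoidAlgebra.coeff_mul_single_of_forall_mul_ne _ _ fun m hm =>
      h (List.singleton_injective (List.append_inj' hm rfl).2)

attribute [local instance] LieRing.ofAssociativeRing

theorem coeff_lie_basisTensor_nil (x : ι) (P : TensorPoly ι) :
    ⁅basisTensor [x], P⁆.coeff (FreeMonoid.ofList []) = 0 := by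
  rw [Ring.lie_def, MonoidAlgebra.coeff_sub, Finsupp.sub_apply, coeff_basisTensor_mul_nil,
    coeff_mul_basisTensor_nil, sub_zero]

theorem coeff_lie_basisTensor_singleton (x y : ι) (P : TensorPoly ι) :
    ⁅basisTensor [x], P⁆.coeff (FreeMonoid.ofList [y]) = 0 := by
  classical
  rw [Ring.lie_def, MonoidAlgebra.coeff_sub, Finsupp.sub_apply, coeff_basisTensor_mul_cons,
    ← List.nil_append [y], coeff_mul_basisTensor_concat, sub_self]

theorem coeff_lie_basisTensor_cons_concat [DecidableEq ι] (x y z : ι) (v : List ι)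
    (P : TensorPoly ι) :
    ⁅basisTensor [x], P⁆.coeff (FreeMonoid.ofList (y :: (v ++ [z]))) =
      (if x = y then P.coeff (FreeMonoid.ofList (v ++ [z])) else 0) -
        if x = z then P.coeff (FreeMonoid.ofList (y :: v)) else 0 := by
  rw [Ring.lie_def, MonoidAlgebra.coeff_sub, Finsupp.sub_apply, coeff_basisTensor_mul_cons,
    ← List.cons_append, coeff_mul_basisTensor_concat]

variable [Fintype ι]

/-- Dynkin's operator `e_{i₁} ⊗ ⋯ ⊗ e_{iₙ} ↦ [e_{i₁}, [⋯, e_{iₙ}]]` on the component of level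
`n`. -/
noncomputable def dynkin : ℕ → TensorSeries ι → TensorPoly ι
  | 0, _ => 0
  | 1, a => ∑ x, a [x] • basisTensor [x]
  | n + 2, a => ∑ x, ⁅basisTensor [x], dynkin (n + 1) (fun w => a (x :: w))⁆

theorem dynkin_mem_lieSpan (n : ℕ) (a : TensorSeries ι) : dynkin n a ∈
    LieSubalgebra.lieSpan ℝ (TensorPoly ι) (Set.range fun i : ι => basisTensor [i]) := by
  have letter_mem (x : ι) : basisTensor [x] ∈
      LieSubalgebra.lieSpan ℝ (TensorPoly ι) (Set.range fun i : ι => basisTensor [i]) :=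
    LieSubalgebra.subset_lieSpan ⟨x, rfl⟩
  fun_induction dynkin n a with
  | case1 => exact zero_mem _
  | case2 => exact sum_mem fun x _ => LieSubalgebra.smul_mem _ _ (letter_mem x)
  | case3 n a ih => exact sum_mem fun x _ => LieSubalgebra.lie_mem _ (letter_mem x) (ih x)

theorem coeff_dynkin (n : ℕ) (a : TensorSeries ι) (w : List ι) :
    (dynkin (n + 1) a).coeff (FreeMonoid.ofList w) =
      if w.length = n + 1 then dynkinEval w a else 0 := by
  classical
  induction n generalizing a w with
  | zero =>
    simp only [dynkin, MonoidAlgebra.coeff_sum, Finsupp.finsetSum_apply,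
      MonoidAlgebra.coeff_smul_apply, coeff_basisTensor, smul_eq_mul, mul_ite, mul_one, mul_zero]
    split_ifs with hw
    · obtain ⟨x, rfl⟩ := List.length_eq_one_iff.1 hw
      simp [dynkinEval_singleton]
    · exact Finset.sum_eq_zero fun x _ => if_neg (by rintro rfl; simp at hw)
  | succ n ih =>
    simp only [dynkin, MonoidAlgebra.coeff_sum, Finsupp.finsetSum_apply]
    induction w using List.bidirectionalRec with
    | nil =>
      rw [Finset.sum_eq_zero fun x _ => coeff_lie_basisTensor_nil x _, if_neg (by simp)]
    | singleton y =>
      rw [Finset.sum_eq_zero fun x _ => coeff_lie_basisTensor_singleton x y _, if_neg (by simp)]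
    | cons_append y v z _ =>
      simp only [coeff_lie_basisTensor_cons_concat, Finset.sum_sub_distrib, ih,
        Finset.sum_ite_eq', Finset.mem_univ, if_true, List.length_cons, List.length_append,
        List.length_nil, zero_add, Nat.add_right_cancel_iff]
      split_ifs
      · rw [dynkinEval_cons_concat]
      · rw [sub_zero]

theorem coeff_level (a : TensorSeries ι) (n : ℕ) (w : List ι) :
    (level a n).coeff (FreeMonoid.ofList w) = if w.length = n then a w else 0 := by
  classical
  simp only [level, MonoidAlgebra.coeff_sum, Finsupp.finsetSum_apply,
    MonoidAlgebra.coeff_smul_apply, coeff_basisTensor, smul_eq_mul, mul_ite, mul_one, mul_zero]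
  split_ifs with hw
  · subst hw
    rw [Finset.sum_eq_single w.get, if_pos (List.ofFn_get w), List.ofFn_get]
    · exact fun v _ hv => if_neg fun h => hv (List.ofFn_injective (h.trans (List.ofFn_get w).symm))
    · exact fun h => absurd (Finset.mem_univ _) h
  · exact Finset.sum_eq_zero fun v _ => if_neg (by rintro rfl; simp at hw)

theorem level_zero_eq_zero {a : TensorSeries ι} (ha : a [] = 0) : level a 0 = 0 := by
  refine tensorPoly_ext fun w => ?_
  rw [coeff_level, MonoidAlgebra.coeff_zero, Finsupp.zero_apply]
  split_ifs with hw
  · rw [List.eq_nil_of_length_eq_zero hw, ha]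
  · rfl

theorem level_succ_eq_smul_dynkin {a : TensorSeries ι}
    (ha : ∀ u v, u ≠ [] → v ≠ [] → shuffleEval u v a = 0) (n : ℕ) :
    level a (n + 1) = ((n + 1 : ℕ) : ℝ)⁻¹ • dynkin (n + 1) a := by
  refine tensorPoly_ext fun w => ?_
  rw [coeff_level, MonoidAlgebra.coeff_smul_apply, coeff_dynkin, smul_eq_mul]
  split_ifs with hw
  · rw [dynkinEval_of_shuffleEval_eq_zero ha, hw, inv_mul_cancel_left₀ (by positivity)]
  · rw [mul_zero]

theorem isLie_of_shuffleEval_eq_zero {a : TensorSeries ι} (ha0 : a [] = 0)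
    (ha : ∀ u v, u ≠ [] → v ≠ [] → shuffleEval u v a = 0) : IsLie a := by
  rintro (_ | n)
  · rw [level_zero_eq_zero ha0]
    exact zero_mem _
  · rw [level_succ_eq_smul_dynkin ha]
    exact LieSubalgebra.smul_mem _ _ (dynkin_mem_lieSpan _ _)

theorem IsShuffleCharacter.isGroupLike {g : TensorSeries ι} (hg : IsShuffleCharacter g) :
    IsGroupLike g := by
  obtain ⟨a, ha, rfl⟩ := exists_texp_eq hg.nil
  exact ⟨a, isLie_of_shuffleEval_eq_zero ha
    fun u v hu hv => shuffleEval_eq_zero_of_texp ha hg hu hv, rfl⟩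

end Dynkin

/-! ### The corrected lift -/

section CorrectedLift

variable {ι : Type} {p T : ℝ} {X : ℝ → ι → ℝ} {X2 : ℝ → ℝ → Matrix ι ι ℝ}

theorem roughBracket_apply (t : ℝ) (i j : ι) : roughBracket X X2 t i j =
    (X t i - X 0 i) * (X t j - X 0 j) - (X2 0 t i j + X2 0 t j i) := by
  simp [roughBracket, Matrix.vecMulVec_apply]

theorem roughBracket_symm (t : ℝ) (i j : ι) :
    roughBracket X X2 t i j = roughBracket X X2 t j i := by
  rw [roughBracket_apply, roughBracket_apply, mul_comm, add_comm (X2 0 t i j)]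

theorem correctedLift_apply (s t : ℝ) (i j : ι) : correctedLift X X2 s t i j =
    X2 s t i j + 1 / 2 * (roughBracket X X2 t i j - roughBracket X X2 s i j) := by
  simp [correctedLift]

/-- The series with components `x` of level one and `A` of level two, and no others. -/
def levelTwoSeries (x : ι → ℝ) (A : ι → ι → ℝ) : TensorSeries ι
  | [i] => x i
  | [i, j] => A i j
  | _ => 0

theorem texp_levelTwoSeries_singleton (x : ι → ℝ) (A : ι → ι → ℝ) (i : ι) :
    texp (levelTwoSeries x A) [i] = x i := by
  rw [texp_eq_add _ (List.cons_ne_nil i [])]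
  simp [levelTwoSeries]

theorem texp_levelTwoSeries_pair (x : ι → ℝ) (A : ι → ι → ℝ) (i j : ι) :
    texp (levelTwoSeries x A) [i, j] = A i j + x i * x j / 2 := by
  have hsq : tpow (levelTwoSeries x A) 2 [i, j] = x i * x j := by
    rw [tpow, tpow_one]
    simp [tmul_cons, tmul_nil, levelTwoSeries]
  rw [texp_eq_add _ (List.cons_ne_nil i [j]), show ([i, j] : List ι).length + 1 = 3 from rfl,
    Nat.Ico_succ_singleton, Finset.sum_singleton, hsq, Nat.factorial_two, Nat.cast_ofNat,
    inv_mul_eq_div]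
  rfl

variable [Fintype ι]

theorem IsRoughPath.of_controlled (hp : 0 < p) {h : ℝ → ℝ} (hh : IsControl T h)
    (hXc : ∀ i, ContinuousOn (fun t => X t i) (Set.Icc 0 T))
    (hX : ∀ i, Controlled T h (1 / p) fun s t => X t i - X s i)
    (hX2c : ∀ i j, ContinuousOn (fun q : ℝ × ℝ => X2 q.1 q.2 i j) (timeSimplex T))
    (hX2 : ∀ i j, Controlled T h (2 / p) fun s t => X2 s t i j)
    (hchen : ∀ s u t : ℝ, 0 ≤ s → s ≤ u → u ≤ t → t ≤ T → ∀ i j : ι,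
      X2 s t i j = X2 s u i j + X2 u t i j + (X u i - X s i) * (X t j - X u j)) :
    IsRoughPath p T X X2 where
  continuousOn_path := continuousOn_pi.2 hXc
  var_path := HasFiniteVar.of_controlled hh hp fun i => by simpa using hX i
  continuousOn_lift := continuousOn_pi.2 fun i => continuousOn_pi.2 fun j => hX2c i j
  var_lift := HasFiniteVar.of_controlled hh (by positivity) fun q => by
    simpa using hX2 q.1 q.2
  chen := hchen

namespace IsRoughPath

theorem continuousOn_lift_apply (hX : IsRoughPath p T X X2) (i j : ι) :
    ContinuousOn (fun q : ℝ × ℝ => X2 q.1 q.2 i j) (timeSimplex T) :=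
  (continuous_apply_apply i j).comp_continuousOn hX.continuousOn_lift

theorem roughBracket_sub (hX : IsRoughPath p T X X2) {s t : ℝ} (hs : 0 ≤ s) (hst : s ≤ t)
    (ht : t ≤ T) (i j : ι) :
    roughBracket X X2 t i j - roughBracket X X2 s i j =
      (X t i - X s i) * (X t j - X s j) - (X2 s t i j + X2 s t j i) := by
  rw [roughBracket_apply, roughBracket_apply, hX.chen 0 s t le_rfl hs hst ht i j,
    hX.chen 0 s t le_rfl hs hst ht j i]
  ring

theorem continuousOn_roughBracket (hX : IsRoughPath p T X X2) (i j : ι) :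
    ContinuousOn (fun t => roughBracket X X2 t i j) (Set.Icc 0 T) := by
  simp only [roughBracket_apply]
  have hlift (i j : ι) : ContinuousOn (fun t => X2 0 t i j) (Set.Icc 0 T) :=
    (hX.continuousOn_lift_apply i j).comp (f := fun t => ((0 : ℝ), t)) (by fun_prop)
      fun t ht => ⟨le_rfl, ht.1, ht.2⟩
  exact (((hX.continuousOn_coord i).sub continuousOn_const).mul
    ((hX.continuousOn_coord j).sub continuousOn_const)).sub ((hlift i j).add (hlift j i))

theorem controlled_roughBracket (hX : IsRoughPath p T X X2) (hp : 0 < p) {h : ℝ → ℝ}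
    (hh : IsControl T h) (hpath : ∀ i, Controlled T h (1 / p) fun s t => X t i - X s i)
    (hlift : ∀ i j, Controlled T h (2 / p) fun s t => X2 s t i j) (i j : ι) :
    Controlled T h (2 / p) fun s t => roughBracket X X2 t i j - roughBracket X X2 s i j := by
  have hprod := (hpath i).mul hh (by positivity) (by positivity) (hpath j)
  rw [← add_div, one_add_one_eq_two] at hprod
  exact (hprod.sub ((hlift i j).add (hlift j i))).congr fun s t hs hst ht =>
    hX.roughBracket_sub hs hst ht i j

theorem correctedLift_add_swap (hX : IsRoughPath p T X X2) {s t : ℝ} (hs : 0 ≤ s) (hst : s ≤ t)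
    (ht : t ≤ T) (i j : ι) :
    correctedLift X X2 s t i j + correctedLift X X2 s t j i =
      (X t i - X s i) * (X t j - X s j) := by
  rw [correctedLift_apply, correctedLift_apply, hX.roughBracket_sub hs hst ht i j,
    hX.roughBracket_sub hs hst ht j i]
  ring

theorem corrected (hX : IsRoughPath p T X X2) (hp : 0 < p) :
    IsRoughPath p T X (correctedLift X X2) := by
  obtain ⟨h, hh, hpath, hlift⟩ := hX.exists_control hp
  refine .of_controlled hp hh hX.continuousOn_coord hpath (fun i j => ?_) (fun i j => ?_) ?_
  · simp only [correctedLift_apply]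
    have hb := hX.continuousOn_roughBracket i j
    exact (hX.continuousOn_lift_apply i j).add (continuousOn_const.mul
      ((continuousOn_snd_simplex hb).sub (continuousOn_fst_simplex hb)))
  · simp only [correctedLift_apply]
    exact (hlift i j).add ((hX.controlled_roughBracket hp hh hpath hlift i j).const_mul _)
  · intro s u t hs hsu hut ht i j
    rw [correctedLift_apply, correctedLift_apply, correctedLift_apply,
      hX.chen s u t hs hsu hut ht]
    ring

end IsRoughPath

theorem isLie_levelTwoSeries {x : ι → ℝ} {A : ι → ι → ℝ} (hA : ∀ i j, A i j + A j i = 0) :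
    IsLie (levelTwoSeries x A) := by
  refine isLie_of_shuffleEval_eq_zero rfl fun u v hu hv => ?_
  match u, v, hu, hv with
  | [i], [j], _, _ =>
    rw [shuffleEval_cons_cons, shuffleEval_nil_left, shuffleEval_nil_right]
    exact hA i j
  | i :: k :: u, j :: v, _, _ | [i], j :: k :: v, _, _ =>
    rw [shuffleEval_congr (b := fun w => 0 * levelTwoSeries x A w), shuffleEval_mul, zero_mul]
    intro w hw
    match w, hw with
    | _ :: _ :: _ :: _, _ => exact (zero_mul _).symm
    | [], hw | [_], hw | [_, _], hw => simp at hw <;> omega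

theorem exists_isGroupLike (x : ι → ℝ) (M : ι → ι → ℝ) (hM : ∀ i j, M i j + M j i = x i * x j) :
    ∃ g : TensorSeries ι, IsGroupLike g ∧ (∀ i, g [i] = x i) ∧ ∀ i j, g [i, j] = M i j := by
  have hlie : IsLie (levelTwoSeries x fun i j => M i j - x i * x j / 2) :=
    isLie_levelTwoSeries fun i j => by linear_combination hM i j
  refine ⟨_, ⟨_, hlie, rfl⟩, texp_levelTwoSeries_singleton x _, fun i j => ?_⟩
  rw [texp_levelTwoSeries_pair, sub_add_cancel]

theorem IsRoughPath.isWeaklyGeometric_corrected (hX : IsRoughPath p T X X2) (hp : 0 < p) :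
    IsWeaklyGeometric p T X (correctedLift X X2) where
  toIsRoughPath := hX.corrected hp
  mem_group t ht := exists_isGroupLike (fun i => X t i - X 0 i) (correctedLift X X2 0 t)
    fun i j => hX.correctedLift_add_swap le_rfl ht.1 ht.2 i j

end CorrectedLift

/-! ### Young integrals and the extended path -/

section YoungIntegral

variable {T θ : ℝ} {h : ℝ → ℝ}

theorem IsPartitionOf.mem_Icc {s t : ℝ} {n : ℕ} {u : ℕ → ℝ} (hu : IsPartitionOf s t n u)
    (hs : 0 ≤ s) (ht : t ≤ T) {k : ℕ} (hk : k ≤ n) : u k ∈ Set.Icc 0 T :=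
  ⟨hs.trans (hu.mem hk).1, (hu.mem hk).2.trans ht⟩

theorem IsPartitionOf.sum_sub {s t : ℝ} {n : ℕ} {u : ℕ → ℝ} (hu : IsPartitionOf s t n u)
    (f : ℝ → ℝ) : ∑ k ∈ Finset.range n, (f (u (k + 1)) - f (u k)) = f t - f s := by
  rw [Finset.sum_range_sub (fun k => f (u k)), hu.1, hu.2.1]

theorem exists_rpow_mul_lt {a c ε : ℝ} (ha : 0 < a) (hε : 0 < ε) : ∃ η > 0, η ^ a * c < ε := by
  have hlim : Tendsto (fun η : ℝ => η ^ a * c) (𝓝[>] 0) (𝓝 0) := by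
    have := (Real.continuousAt_rpow_const 0 a (Or.inr ha.le)).tendsto.mul_const c
    rw [Real.zero_rpow ha.ne', zero_mul] at this
    exact this.mono_left nhdsWithin_le_nhds
  obtain ⟨η, hlt, hη⟩ := ((hlim.eventually (gt_mem_nhds hε)).and self_mem_nhdsWithin).exists
  exact ⟨η, hη, hlt⟩

theorem IsControl.exists_mesh_sum_rpow_lt (hh : IsControl T h) (hθ : 1 < θ) {ε : ℝ} (hε : 0 < ε) :
    ∃ δ > 0, ∀ (s t : ℝ) (n : ℕ) (u : ℕ → ℝ), 0 ≤ s → t ≤ T → IsPartitionOf s t n u →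
      (∀ k < n, u (k + 1) - u k < δ) →
      ∑ k ∈ Finset.range n, (h (u (k + 1)) - h (u k)) ^ θ < ε := by
  obtain ⟨η, hη, hηε⟩ := exists_rpow_mul_lt (c := h T - h 0) (sub_pos.2 hθ) hε
  obtain ⟨δ, hδ, hd⟩ := Metric.uniformContinuousOn_iff.1
    (isCompact_Icc.uniformContinuousOn_of_continuous hh.cont) η hη
  refine ⟨δ, hδ, fun s t n u hs ht hu hmesh => lt_of_le_of_lt ?_ hηε⟩
  have hmem {k : ℕ} (hk : k ≤ n) : u k ∈ Set.Icc 0 T := hu.mem_Icc hs ht hk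
  have hsmall : ∀ k < n, h (u (k + 1)) - h (u k) ≤ η := fun k hk => by
    refine (le_abs_self _).trans (hd _ (hmem hk) _ (hmem hk.le) ?_).le
    rw [Real.dist_eq, abs_of_pos (sub_pos.2 (hu.2.2 k hk))]
    exact hmesh k hk
  have htotal : h t - h s ≤ h T - h 0 := by
    have hst := hu.1 ▸ (hu.mem (Nat.zero_le n)).2
    linarith [hh.sub_nonneg le_rfl hs (hst.trans ht), hh.sub_nonneg (hs.trans hst) ht le_rfl]
  calc ∑ k ∈ Finset.range n, (h (u (k + 1)) - h (u k)) ^ θ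
      ≤ η ^ (θ - 1) * ∑ k ∈ Finset.range n, (h (u (k + 1)) - h (u k)) :=
        sum_rpow_le _ hθ.le (fun k hk => hh.sub_nonneg (hmem (Finset.mem_range.1 hk).le).1
          (hu.2.2 k (Finset.mem_range.1 hk)).le (hmem (Finset.mem_range.1 hk)).2)
          fun k hk => hsmall k (Finset.mem_range.1 hk)
    _ ≤ η ^ (θ - 1) * (h T - h 0) := by rw [hu.sum_sub h]; gcongr

theorem Controlled.exists_mesh_abs_sum_sub_lt (hh : IsControl T h) (hθ : 1 < θ) {A : ℝ → ℝ → ℝ}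
    {J : ℝ → ℝ} (hJ : Controlled T h θ fun s t => J t - J s - A s t) {ε : ℝ} (hε : 0 < ε) :
    ∃ δ > 0, ∀ (s t : ℝ) (n : ℕ) (u : ℕ → ℝ), 0 ≤ s → t ≤ T → IsPartitionOf s t n u →
      (∀ k < n, u (k + 1) - u k < δ) →
      |∑ k ∈ Finset.range n, A (u k) (u (k + 1)) - (J t - J s)| < ε := by
  obtain ⟨C, hC, hJ⟩ := hJ
  obtain ⟨δ, hδ, hmesh⟩ := hh.exists_mesh_sum_rpow_lt hθ (div_pos hε (by linarith : 0 < C + 1))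
  refine ⟨δ, hδ, fun s t n u hs ht hu hd => ?_⟩
  calc |∑ k ∈ Finset.range n, A (u k) (u (k + 1)) - (J t - J s)|
      = |∑ k ∈ Finset.range n, (J (u (k + 1)) - J (u k) - A (u k) (u (k + 1)))| := by
        rw [abs_sub_comm, Finset.sum_sub_distrib, hu.sum_sub J]
    _ ≤ ∑ k ∈ Finset.range n, C * (h (u (k + 1)) - h (u k)) ^ θ := by
        refine (Finset.abs_sum_le_sum_abs _ _).trans (Finset.sum_le_sum fun k hk => ?_)
        have hk := Finset.mem_range.1 hk
        exact hJ _ _ (hu.mem_Icc hs ht hk.le).1 (hu.2.2 k hk).le (hu.mem_Icc hs ht hk).2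
    _ ≤ C * (ε / (C + 1)) := by
        rw [← Finset.mul_sum]
        exact mul_le_mul_of_nonneg_left (hmesh s t n u hs ht hu hd).le hC
    _ < ε := by
        rw [mul_div_assoc', div_lt_iff₀ (by linarith)]
        linarith

theorem hasYoungIntegral_of_controlled (hh : IsControl T h) (hθ : 1 < θ) {f g J : ℝ → ℝ}
    (hJ : Controlled T h θ fun s t => J t - J s - f s * (g t - g s)) {s t : ℝ} (hs : 0 ≤ s)
    (ht : t ≤ T) :
    HasYoungIntegral (fun r => f r - f s) g s t (J t - J s - f s * (g t - g s)) := by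
  intro ε hε
  obtain ⟨δ, hδ, hmesh⟩ := hJ.exists_mesh_abs_sum_sub_lt hh hθ hε
  refine ⟨δ, hδ, fun n u hu hd => ?_⟩
  have hsum := hmesh s t n u hs ht hu hd
  simp only [sub_mul, Finset.sum_sub_distrib, ← Finset.mul_sum, hu.sum_sub g]
  rwa [sub_sub_sub_cancel_right]

theorem exists_partition_mesh {s t δ : ℝ} (hst : s ≤ t) (hδ : 0 < δ) :
    ∃ n u, IsPartitionOf s t n u ∧ ∀ k < n, u (k + 1) - u k < δ := by
  rcases hst.eq_or_lt with rfl | hlt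
  · exact ⟨0, fun _ => s, ⟨rfl, rfl, by simp⟩, by simp⟩
  obtain ⟨n, hn⟩ := exists_nat_gt ((t - s) / δ)
  have hn0 : (0 : ℝ) < n := lt_of_le_of_lt (div_nonneg (by linarith) hδ.le) hn
  have hstep : ∀ k : ℕ, (s + ((k + 1 : ℕ) : ℝ) * ((t - s) / n)) - (s + k * ((t - s) / n)) =
      (t - s) / n := fun k => by push_cast; ring
  refine ⟨n, fun k => s + k * ((t - s) / n), ⟨by simp, by field_simp; ring, fun k _ => ?_⟩,
    fun k _ => ?_⟩
  · have : 0 < (t - s) / n := div_pos (by linarith) hn0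
    linarith [hstep k]
  · rw [hstep, div_lt_iff₀ hn0]
    rwa [div_lt_iff₀ hδ, mul_comm] at hn

theorem HasYoungIntegral.unique {f g : ℝ → ℝ} {s t J J' : ℝ} (hst : s ≤ t)
    (hJ : HasYoungIntegral f g s t J) (hJ' : HasYoungIntegral f g s t J') : J = J' := by
  refine eq_of_forall_dist_le fun ε hε => ?_
  obtain ⟨δ, hδ, hd⟩ := hJ (ε / 2) (half_pos hε)
  obtain ⟨δ', hδ', hd'⟩ := hJ' (ε / 2) (half_pos hε)
  obtain ⟨n, u, hu, hmesh⟩ := exists_partition_mesh hst (lt_min hδ hδ')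
  have h1 := hd n u hu fun k hk => (hmesh k hk).trans_le (min_le_left _ _)
  have h2 := hd' n u hu fun k hk => (hmesh k hk).trans_le (min_le_right _ _)
  rw [abs_lt] at h1 h2
  rw [Real.dist_eq, abs_le]
  constructor <;> linarith [h1.1, h1.2, h2.1, h2.2]

/-- The integral is the increment of the path sewn from `f s * (g t - g s)`, corrected by `f s`. -/
theorem exists_hasYoungIntegral {α β : ℝ} (hh : IsControl T h) (hα : 0 ≤ α) (hβ : 0 ≤ β)
    (hαβ : 1 < α + β) {f g : ℝ → ℝ} (hfc : ContinuousOn f (Set.Icc 0 T))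
    (hgc : ContinuousOn g (Set.Icc 0 T)) (hf : Controlled T h α fun s t => f t - f s)
    (hg : Controlled T h β fun s t => g t - g s) :
    ∃ I : ℝ → ℝ → ℝ,
      (∀ s t, 0 ≤ s → s ≤ t → t ≤ T → HasYoungIntegral (fun r => f r - f s) g s t (I s t)) ∧
      Controlled T h (α + β) I ∧ ContinuousOn (fun q : ℝ × ℝ => I q.1 q.2) (timeSimplex T) ∧
      ∀ s u t, I s t = I s u + I u t + (f u - f s) * (g t - g u) := by
  obtain ⟨J, hJ⟩ := exists_sewing (A := fun s t => f s * (g t - g s)) hh hαβ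
    ((hf.mul_triple hh hα hβ hg).congr fun s u t _ _ _ _ => by rw [← abs_neg]; ring_nf)
  have hAc : ContinuousOn (fun q : ℝ × ℝ => f q.1 * (g q.2 - g q.1)) (timeSimplex T) :=
    (continuousOn_fst_simplex hfc).mul
      ((continuousOn_snd_simplex hgc).sub (continuousOn_fst_simplex hgc))
  have hJc := hJ.continuousOn hh (by linarith) hAc
  exact ⟨fun s t => J t - J s - f s * (g t - g s),
    fun s t hs _ ht => hasYoungIntegral_of_controlled hh hαβ hJ hs ht, hJ,
    ((continuousOn_snd_simplex hJc).sub (continuousOn_fst_simplex hJc)).sub hAc,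
    fun s u t => by ring⟩

end YoungIntegral

section Extended

/-- Time is Lipschitz and the bracket has finite `p/2`-variation; this is the Hölder exponent that
they share with respect to a control. -/
noncomputable def smoothExponent (p : ℝ) : ℝ := min 1 (2 / p)

section SmoothExponent

variable {p : ℝ}

theorem smoothExponent_le_one : smoothExponent p ≤ 1 := min_le_left _ _

theorem smoothExponent_le_two_div : smoothExponent p ≤ 2 / p := min_le_right _ _

theorem one_div_le_smoothExponent (hp : 1 ≤ p) : 1 / p ≤ smoothExponent p :=
  le_min (by rwa [div_le_one (by linarith)]) (by gcongr; norm_num)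

theorem smoothExponent_nonneg (hp : 1 ≤ p) : 0 ≤ smoothExponent p :=
  le_trans (by positivity) (one_div_le_smoothExponent hp)

theorem one_lt_one_div_add_smoothExponent (hp : 1 ≤ p) (hp3 : p < 3) :
    1 < 1 / p + smoothExponent p := by
  have hp0 : 0 < p := by linarith
  rw [smoothExponent, ← min_add_add_left, lt_min_iff, ← add_div, lt_div_iff₀ hp0]
  exact ⟨by linarith [one_div_pos.2 hp0], by linarith⟩

theorem one_div_add_smoothExponent_le (hp : 0 < p) {n : ℕ} (hn : 3 ≤ n) :
    1 / p + smoothExponent p ≤ n / p := by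
  have hn' : (1 + 2 : ℝ) ≤ n := by norm_num; exact_mod_cast hn
  calc 1 / p + smoothExponent p ≤ 1 / p + 2 / p := by gcongr; exact smoothExponent_le_two_div
    _ = (1 + 2) / p := (add_div _ _ _).symm
    _ ≤ n / p := by gcongr

end SmoothExponent

variable {d : ℕ} {p T : ℝ} {X : ℝ → Fin d → ℝ} {X2 : ℝ → ℝ → Matrix (Fin d) (Fin d) ℝ}

/-- The pairs of letters on which a canonical second level is given by Young integrals. -/
def IsYoungPair (a b : ExtIndex d) : Prop := ¬ ((∃ i, a = .path i) ∧ ∃ j, b = .path j)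

theorem IsYoungPair.symm {a b : ExtIndex d} (h : IsYoungPair a b) : IsYoungPair b a :=
  fun h' => h ⟨h'.2, h'.1⟩

/-- A control for a rough path `(X, X2)`, for the extended path, and, with the better exponent, for
the coordinates which the extension adds. -/
structure IsExtControl (p T : ℝ) (X : ℝ → Fin d → ℝ) (X2 : ℝ → ℝ → Matrix (Fin d) (Fin d) ℝ)
    (h : ℝ → ℝ) : Prop where
  control : IsControl T h
  path : ∀ a, Controlled T h (1 / p) fun s t => extPath X X2 t a - extPath X X2 s a
  smooth : ∀ a : ExtIndex d, (¬ ∃ i, a = .path i) →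
    Controlled T h (smoothExponent p) fun s t => extPath X X2 t a - extPath X X2 s a
  lift : ∀ i j, Controlled T h (2 / p) fun s t => X2 s t i j

theorem controlled_time : Controlled T (fun t => t) 1 fun s t => t - s :=
  ⟨1, zero_le_one, fun s t _ hst _ => by simp [abs_of_nonneg (sub_nonneg.2 hst)]⟩

theorem IsExtControl.of_controlled (hX : IsRoughPath p T X X2) (hp : 1 ≤ p) {h : ℝ → ℝ}
    (hh : IsControl T h) (htime : Controlled T h 1 fun s t => t - s)
    (hpath : ∀ i, Controlled T h (1 / p) fun s t => X t i - X s i)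
    (hlift : ∀ i j, Controlled T h (2 / p) fun s t => X2 s t i j) : IsExtControl p T X X2 h := by
  have hσ := smoothExponent_nonneg hp
  have hsmooth : ∀ a : ExtIndex d, (¬ ∃ i, a = .path i) →
      Controlled T h (smoothExponent p) fun s t => extPath X X2 t a - extPath X X2 s a := by
    intro a ha
    cases a with
    | time => exact htime.mono_exponent hh hσ smoothExponent_le_one
    | path i => exact absurd ⟨i, rfl⟩ ha
    | bracket q =>
      exact (hX.controlled_roughBracket (by linarith) hh hpath hlift _ _).mono_exponent hh hσ
        smoothExponent_le_two_div
  refine ⟨hh, fun a => ?_, hsmooth, hlift⟩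
  by_cases ha : ∃ i, a = .path i
  · obtain ⟨i, rfl⟩ := ha
    exact hpath i
  · exact (hsmooth a ha).mono_exponent hh (by positivity) (one_div_le_smoothExponent hp)

namespace IsRoughPath

theorem exists_isExtControl (hX : IsRoughPath p T X X2) (hp : 1 ≤ p) :
    ∃ h, IsExtControl p T X X2 h := by
  obtain ⟨h, hh, hpath, hlift⟩ := hX.exists_control (by linarith)
  have hid : IsControl T fun t => t := ⟨monotoneOn_id, continuousOn_id⟩
  exact ⟨_, .of_controlled hX hp (hh.add hid) (controlled_time.add_right hh hid zero_le_one)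
    (fun i => (hpath i).add_left hh hid (by positivity))
    fun i j => (hlift i j).add_left hh hid (by positivity)⟩

theorem continuousOn_extPath (hX : IsRoughPath p T X X2) (a : ExtIndex d) :
    ContinuousOn (fun t => extPath X X2 t a) (Set.Icc 0 T) := by
  cases a with
  | time => exact continuousOn_id
  | path i => exact hX.continuousOn_coord i
  | bracket q => exact hX.continuousOn_roughBracket q.1.1 q.1.2

theorem exists_hasYoungIntegral_extPath (hX : IsRoughPath p T X X2) (hp : 1 ≤ p) (hp3 : p < 3)
    {h : ℝ → ℝ} (hh : IsExtControl p T X X2 h) {a b : ExtIndex d} (hab : IsYoungPair a b) :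
    ∃ I : ℝ → ℝ → ℝ,
      (∀ s t, 0 ≤ s → s ≤ t → t ≤ T → HasYoungIntegral
        (fun r => extPath X X2 r a - extPath X X2 s a) (fun r => extPath X X2 r b) s t (I s t)) ∧
      Controlled T h (1 / p + smoothExponent p) I ∧
      ContinuousOn (fun q : ℝ × ℝ => I q.1 q.2) (timeSimplex T) ∧
      ∀ s u t, I s t = I s u + I u t +
        (extPath X X2 u a - extPath X X2 s a) * (extPath X X2 t b - extPath X X2 u b) := by
  have hσ := smoothExponent_nonneg hp
  have hpσ := one_lt_one_div_add_smoothExponent hp hp3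
  have hac := hX.continuousOn_extPath a
  have hbc := hX.continuousOn_extPath b
  by_cases ha : ∃ i, a = .path i
  · exact exists_hasYoungIntegral hh.control (by positivity) hσ hpσ hac hbc (hh.path a)
      (hh.smooth b fun hb => hab ⟨ha, hb⟩)
  · rw [add_comm] at hpσ ⊢
    exact exists_hasYoungIntegral hh.control hσ (by positivity) hpσ hac hbc (hh.smooth a ha)
      (hh.path b)

theorem exists_isCanonicalLift (hX : IsRoughPath p T X X2) (hp : 1 ≤ p) (hp3 : p < 3) :
    ∃ Y2, IsCanonicalLift T X X2 Y2 := by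
  obtain ⟨h, hh⟩ := hX.exists_isExtControl hp
  have hI : ∀ a b : ExtIndex d, ∃ I : ℝ → ℝ → ℝ, IsYoungPair a b →
      ∀ s t, 0 ≤ s → s ≤ t → t ≤ T → HasYoungIntegral
        (fun r => extPath X X2 r a - extPath X X2 s a) (fun r => extPath X X2 r b) s t (I s t) := by
    intro a b
    by_cases hab : IsYoungPair a b
    · obtain ⟨I, hI, -⟩ := hX.exists_hasYoungIntegral_extPath hp hp3 hh hab
      exact ⟨I, fun _ => hI⟩
    · exact ⟨0, fun h' => absurd h' hab⟩
  choose I hI using hI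
  refine ⟨fun s t => Matrix.of fun a b => match a, b with
    | .path i, .path j => X2 s t i j
    | a, b => I a b s t, fun s t _ _ _ i j => rfl, fun s t hs hst ht a b hab => ?_⟩
  have hY := hI a b hab s t hs hst ht
  cases a <;> cases b <;> first | exact hY | exact absurd ⟨⟨_, rfl⟩, ⟨_, rfl⟩⟩ hab

end IsRoughPath

namespace IsCanonicalLift

variable {Y2 : ℝ → ℝ → Matrix (ExtIndex d) (ExtIndex d) ℝ}

theorem young_pair (hY : IsCanonicalLift T X X2 Y2) (hX : IsRoughPath p T X X2) (hp : 1 ≤ p)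
    (hp3 : p < 3) {h : ℝ → ℝ} (hh : IsExtControl p T X X2 h) {a b : ExtIndex d}
    (hab : IsYoungPair a b) :
    Controlled T h (1 / p + smoothExponent p) (fun s t => Y2 s t a b) ∧
      ContinuousOn (fun q : ℝ × ℝ => Y2 q.1 q.2 a b) (timeSimplex T) ∧
      ∀ s u t, 0 ≤ s → s ≤ u → u ≤ t → t ≤ T →
        Y2 s t a b = Y2 s u a b + Y2 u t a b +
          (extPath X X2 u a - extPath X X2 s a) * (extPath X X2 t b - extPath X X2 u b) := by
  obtain ⟨I, hI, hIσ, hIc, hchen⟩ := hX.exists_hasYoungIntegral_extPath hp hp3 hh hab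
  have heq : ∀ s t, 0 ≤ s → s ≤ t → t ≤ T → Y2 s t a b = I s t := fun s t hs hst ht =>
    (hY.young s t hs hst ht a b hab).unique hst (hI s t hs hst ht)
  refine ⟨hIσ.congr heq, hIc.congr fun q hq => heq q.1 q.2 hq.1 hq.2.1 hq.2.2,
    fun s u t hs hsu hut ht => ?_⟩
  rw [heq s t hs (hsu.trans hut) ht, heq s u hs hsu (hut.trans ht),
    heq u t (hs.trans hsu) hut ht]
  exact hchen s u t

theorem isRoughPath (hY : IsCanonicalLift T X X2 Y2) (hX : IsRoughPath p T X X2) (hp : 1 ≤ p)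
    (hp3 : p < 3) : IsRoughPath p T (extPath X X2) Y2 := by
  obtain ⟨h, hh⟩ := hX.exists_isExtControl hp
  have htwo : 2 / p ≤ 1 / p + smoothExponent p := by
    rw [← one_add_one_eq_two, add_div]
    gcongr
    exact one_div_le_smoothExponent hp
  refine .of_controlled (by linarith) hh.control hX.continuousOn_extPath hh.path
    (fun a b => ?_) (fun a b => ?_) fun s u t hs hsu hut ht a b => ?_
  all_goals by_cases hab : IsYoungPair a b
  · exact (hY.young_pair hX hp hp3 hh hab).2.1
  · obtain ⟨⟨i, rfl⟩, j, rfl⟩ := not_not.1 hab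
    exact (hX.continuousOn_lift_apply i j).congr fun q hq =>
      hY.path_path q.1 q.2 hq.1 hq.2.1 hq.2.2 i j
  · exact (hY.young_pair hX hp hp3 hh hab).1.mono_exponent hh.control (by positivity) htwo
  · obtain ⟨⟨i, rfl⟩, j, rfl⟩ := not_not.1 hab
    exact (hh.lift i j).congr fun s t hs hst ht => hY.path_path s t hs hst ht i j
  · exact (hY.young_pair hX hp hp3 hh hab).2.2 s u t hs hsu hut ht
  · obtain ⟨⟨i, rfl⟩, j, rfl⟩ := not_not.1 hab
    rw [hY.path_path s t hs (hsu.trans hut) ht, hY.path_path s u hs hsu (hut.trans ht),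
      hY.path_path u t (hs.trans hsu) hut ht]
    exact hX.chen s u t hs hsu hut ht i j

/-- Integration by parts: the defect of the product rule is additive, of exponent greater than
`1`. -/
theorem roughBracket_eq_zero (hY : IsCanonicalLift T X X2 Y2) (hX : IsRoughPath p T X X2)
    (hp : 1 ≤ p) (hp3 : p < 3) {a b : ExtIndex d} (hab : IsYoungPair a b) {t : ℝ}
    (ht : t ∈ Set.Icc 0 T) : roughBracket (extPath X X2) Y2 t a b = 0 := by
  obtain ⟨h, hh⟩ := hX.exists_isExtControl hp
  have hσ := smoothExponent_nonneg hp
  have hprod : Controlled T h (1 / p + smoothExponent p) fun s t =>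
      (extPath X X2 t a - extPath X X2 s a) * (extPath X X2 t b - extPath X X2 s b) := by
    by_cases ha : ∃ i, a = .path i
    · exact (hh.path a).mul hh.control (by positivity) hσ (hh.smooth b fun hb => hab ⟨ha, hb⟩)
    · rw [add_comm]
      exact (hh.smooth a ha).mul hh.control hσ (by positivity) (hh.path b)
  obtain ⟨hab_le, -, hab_chen⟩ := hY.young_pair hX hp hp3 hh hab
  obtain ⟨hba_le, -, hba_chen⟩ := hY.young_pair hX hp hp3 hh hab.symm
  rw [roughBracket_apply]
  refine (hprod.sub (hab_le.add hba_le)).eq_zero hh.control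
    (one_lt_one_div_add_smoothExponent hp hp3) (fun s u t hs hsu hut ht => ?_) le_rfl ht.1 ht.2
  rw [hab_chen s u t hs hsu hut ht, hba_chen s u t hs hsu hut ht]
  ring

theorem roughBracket_path (hY : IsCanonicalLift T X X2 Y2) {t : ℝ} (ht : t ∈ Set.Icc 0 T)
    (i j : Fin d) :
    roughBracket (extPath X X2) Y2 t (.path i) (.path j) = roughBracket X X2 t i j := by
  rw [roughBracket_apply, roughBracket_apply, hY.path_path 0 t le_rfl ht.1 ht.2,
    hY.path_path 0 t le_rfl ht.1 ht.2]
  rfl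

theorem correctedLift_eq_self (hY : IsCanonicalLift T X X2 Y2) (hX : IsRoughPath p T X X2)
    (hp : 1 ≤ p) (hp3 : p < 3) {a b : ExtIndex d} (hab : IsYoungPair a b) {s t : ℝ} (hs : 0 ≤ s)
    (hst : s ≤ t) (ht : t ≤ T) : correctedLift (extPath X X2) Y2 s t a b = Y2 s t a b := by
  rw [correctedLift_apply, hY.roughBracket_eq_zero hX hp hp3 hab ⟨hs.trans hst, ht⟩,
    hY.roughBracket_eq_zero hX hp hp3 hab ⟨hs, hst.trans ht⟩]
  ring

end IsCanonicalLift

end Extended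

/-! ### The coefficients `ℓ^I` -/

section Pairing

variable {ι : Type}

theorem tensorPairing_zero (a : TensorSeries ι) : tensorPairing (0 : TensorPoly ι) a = 0 := by
  simp [tensorPairing]

theorem tensorPairing_basisTensor (w : List ι) (a : TensorSeries ι) :
    tensorPairing (basisTensor w) a = a w := by
  rw [tensorPairing, basisTensor, MonoidAlgebra.coeff_single, Finsupp.sum_single_index (by simp)]
  simp

theorem tensorPairing_add (l m : TensorPoly ι) (a : TensorSeries ι) :
    tensorPairing (l + m) a = tensorPairing l a + tensorPairing m a := by
  rw [tensorPairing, MonoidAlgebra.coeff_add]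
  exact Finsupp.sum_add_index' (by simp) fun _ _ _ => add_mul _ _ _

theorem tensorPairing_smul (c : ℝ) (l : TensorPoly ι) (a : TensorSeries ι) :
    tensorPairing (c • l) a = c * tensorPairing l a := by
  rw [tensorPairing, MonoidAlgebra.coeff_smul, Finsupp.sum_smul_index' (by simp), tensorPairing,
    Finsupp.mul_sum]
  simp [mul_assoc]

theorem tensorPairing_sub (l m : TensorPoly ι) (a : TensorSeries ι) :
    tensorPairing (l - m) a = tensorPairing l a - tensorPairing m a := by
  rw [sub_eq_add_neg, ← neg_one_smul ℝ m, tensorPairing_add, tensorPairing_smul]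
  ring

theorem tensorPairing_mul_add (l : TensorPoly ι) (c : ℝ) (a b : TensorSeries ι) :
    tensorPairing l (fun w => a w * c + b w) = tensorPairing l a * c + tensorPairing l b := by
  simp only [tensorPairing, Finsupp.sum, mul_add, Finset.sum_add_distrib, Finset.sum_mul, mul_assoc]

theorem basisTensor_mul (v w : List ι) :
    basisTensor v * basisTensor w = basisTensor (v ++ w) := by
  rw [basisTensor, basisTensor, MonoidAlgebra.single_mul_single, mul_one]
  rfl

theorem tensorPairing_mul_basisTensor (l : TensorPoly ι) (v : List ι) (a : TensorSeries ι) :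
    tensorPairing (l * basisTensor v) a = tensorPairing l fun w => a (w ++ v) := by
  induction l using MonoidAlgebra.induction_linear with
  | zero => simp only [zero_mul, tensorPairing_zero]
  | add l m hl hm => rw [add_mul, tensorPairing_add, tensorPairing_add, hl, hm]
  | single w c =>
    have hw : (MonoidAlgebra.single w c : TensorPoly ι) = c • basisTensor w.toList := by
      simp [basisTensor]
    rw [hw, smul_mul_assoc, basisTensor_mul, tensorPairing_smul, tensorPairing_smul,
      tensorPairing_basisTensor, tensorPairing_basisTensor]

end Pairing

section Ell

variable {d : ℕ}

theorem IsYoungPair.epsTensor_eq_zero {a b : ExtIndex d} (hab : IsYoungPair a b) :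
    epsTensor a b = 0 := by
  cases a <;> cases b <;> first | rfl | exact absurd ⟨⟨_, rfl⟩, ⟨_, rfl⟩⟩ hab

theorem exists_epsTensor_eq_smul (a b : ExtIndex d) :
    ∃ (c : ℝ) (z : ExtIndex d), epsTensor a b = c • basisTensor [z] := by
  cases a <;> cases b <;>
    first | exact ⟨0, .time, (zero_smul ℝ _).symm⟩ | exact ⟨1, _, (one_smul ℝ _).symm⟩

theorem ellCoeff_pair (a b : ExtIndex d) :
    ellCoeff [a, b] = basisTensor [a, b] - (1 / 2 : ℝ) • epsTensor a b := by
  have hrec := ellCoeff_append [] a b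
  rwa [List.nil_append, List.nil_append, ellCoeff_singleton, basisTensor_mul, ellCoeff_nil,
    show (basisTensor [] : TensorPoly (ExtIndex d)) = 1 from rfl, one_mul] at hrec

theorem word_induction {ι : Type} {motive : List ι → Prop} (nil : motive [])
    (singleton : ∀ x, motive [x])
    (append_pair : ∀ J x y, motive J → motive (J ++ [x]) → motive (J ++ [x, y])) (I : List ι) :
    motive I := by
  suffices h : ∀ w : List ι, motive w.reverse from I.reverse_reverse ▸ h I.reverse
  intro w
  induction w using List.twoStepInduction with
  | nil => exact nil
  | singleton x => exact singleton x
  | cons_cons y x w hw hxw => simpa using append_pair w.reverse x y hw (by simpa using hxw x)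

/-- The transpose of the linear map `e_I ↦ ℓ^I`, which acts on tensor series. -/
noncomputable def ellTranspose (a : TensorSeries (ExtIndex d)) : TensorSeries (ExtIndex d) :=
  fun I => tensorPairing (ellCoeff I) a

theorem ellTranspose_nil (a : TensorSeries (ExtIndex d)) : ellTranspose a [] = a [] := by
  rw [ellTranspose, ellCoeff_nil, tensorPairing_basisTensor]

theorem ellTranspose_singleton (a : TensorSeries (ExtIndex d)) (x : ExtIndex d) :
    ellTranspose a [x] = a [x] := by
  rw [ellTranspose, ellCoeff_singleton, tensorPairing_basisTensor]

theorem ellTranspose_append_pair {x y z : ExtIndex d} {c : ℝ}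
    (hxy : epsTensor x y = c • basisTensor [z]) (a : TensorSeries (ExtIndex d))
    (J : List (ExtIndex d)) :
    ellTranspose a (J ++ [x, y]) = ellTranspose (fun w => a (w ++ [y])) (J ++ [x]) +
      -(c / 2) * ellTranspose (fun w => a (w ++ [z])) J := by
  rw [ellTranspose, ellCoeff_append, hxy, mul_smul_comm, tensorPairing_sub, tensorPairing_smul,
    tensorPairing_smul, tensorPairing_mul_basisTensor, tensorPairing_mul_basisTensor, ellTranspose,
    ellTranspose]
  ring

theorem ellTranspose_tmul (I : List (ExtIndex d)) (a b : TensorSeries (ExtIndex d)) :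
    ellTranspose (tmul a b) I = tmul (ellTranspose a) (ellTranspose b) I := by
  induction I using word_induction generalizing b with
  | nil => rw [ellTranspose_nil, tmul_nil, tmul_nil, ellTranspose_nil, ellTranspose_nil]
  | singleton x => simp only [ellTranspose_singleton, tmul_cons, tmul_nil, ellTranspose_nil]
  | append_pair J x y hJ hJx =>
    obtain ⟨c, z, hxy⟩ := exists_epsTensor_eq_smul x y
    have hrec := ellTranspose_append_pair hxy
    have hconcat : ∀ (u : ExtIndex d) (K : List (ExtIndex d)),
        ellTranspose (fun w => tmul a b (w ++ [u])) K =
          ellTranspose (fun w => a (w ++ [u])) K * b [] +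
            ellTranspose (tmul a fun w => b (w ++ [u])) K := by
      intro u K
      simp only [tmul_concat]
      exact tensorPairing_mul_add _ _ _ _
    have hright : tmul (ellTranspose a) (ellTranspose b) (J ++ [x, y]) =
        ellTranspose a (J ++ [x, y]) * b [] + ellTranspose a (J ++ [x]) * b [y] +
          (tmul (ellTranspose a) (fun v => ellTranspose (fun w => b (w ++ [y])) (v ++ [x])) J +
            -(c / 2) * tmul (ellTranspose a) (ellTranspose fun w => b (w ++ [z])) J) := by
      rw [← tmul_smul, ← tmul_add, show J ++ [x, y] = J ++ [x] ++ [y] by simp, tmul_concat,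
        tmul_concat, ellTranspose_nil, List.nil_append, ellTranspose_singleton, ← add_assoc]
      simp only [List.append_assoc, List.singleton_append, hrec]
    rw [hright, hrec, hrec, hconcat, hconcat, hJ, hJx, tmul_concat, ellTranspose_nil,
      List.nil_append]
    ring

/-- The homogeneity of a letter: the bracket of a path has twice the regularity of the path. -/
def letterWeight : ExtIndex d → ℕ
  | .bracket _ => 2
  | _ => 1

theorem one_le_letterWeight (x : ExtIndex d) : 1 ≤ letterWeight x := by
  cases x <;> simp [letterWeight]

theorem letterWeight_le_two (x : ExtIndex d) : letterWeight x ≤ 2 := by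
  cases x <;> simp [letterWeight]

/-- The homogeneity of a word, with respect to which `ℓ^I` has components of weight at least
`|I|`. -/
def wordWeight (w : List (ExtIndex d)) : ℕ := (w.map letterWeight).sum

theorem wordWeight_le (w : List (ExtIndex d)) : wordWeight w ≤ w.length * 2 := by
  simpa [wordWeight] using
    (w.map letterWeight).sum_le_card_nsmul 2 (by simpa using fun x _ => letterWeight_le_two x)

theorem wordWeight_concat (w : List (ExtIndex d)) (x : ExtIndex d) :
    wordWeight (w ++ [x]) = wordWeight w + letterWeight x := by
  simp [wordWeight]

/-- The span of the words of weight at least `n` and length at most `n`, to which `ℓ^I` belongs for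
`|I| = n`. -/
noncomputable def weightSpan (d n : ℕ) : Submodule ℝ (TensorPoly (ExtIndex d)) :=
  Submodule.span ℝ (basisTensor '' {w | n ≤ wordWeight w ∧ w.length ≤ n})

theorem basisTensor_mem_weightSpan {n : ℕ} {w : List (ExtIndex d)} (hw : n ≤ wordWeight w)
    (hlen : w.length ≤ n) : basisTensor w ∈ weightSpan d n :=
  Submodule.subset_span ⟨w, ⟨hw, hlen⟩, rfl⟩

theorem mul_basisTensor_mem_weightSpan {n k : ℕ} {l : TensorPoly (ExtIndex d)}
    (hl : l ∈ weightSpan d n) {x : ExtIndex d} (hk : k ≤ letterWeight x) (hk1 : 1 ≤ k) :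
    l * basisTensor [x] ∈ weightSpan d (n + k) := by
  induction hl using Submodule.span_induction with
  | mem l hl =>
    obtain ⟨w, ⟨hw, hlen⟩, rfl⟩ := hl
    rw [basisTensor_mul]
    refine basisTensor_mem_weightSpan ?_ ?_
    · rw [wordWeight_concat]
      gcongr
    · rw [List.length_append, List.length_singleton]
      gcongr
  | zero => simp only [zero_mul, zero_mem]
  | add l m _ _ hl hm =>
    rw [add_mul]
    exact add_mem hl hm
  | smul c l _ hl =>
    rw [smul_mul_assoc]
    exact Submodule.smul_mem _ c hl

theorem ellCoeff_mem_weightSpan (I : List (ExtIndex d)) : ellCoeff I ∈ weightSpan d I.length := by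
  induction I using word_induction with
  | nil => exact basisTensor_mem_weightSpan (Nat.zero_le _) le_rfl
  | singleton x =>
    exact basisTensor_mem_weightSpan (by simpa [wordWeight] using one_le_letterWeight x) le_rfl
  | append_pair J x y hJ hJx =>
    rw [List.length_append, List.length_singleton] at hJx
    have hlast : ellCoeff (J ++ [x]) * basisTensor [y] ∈ weightSpan d (J.length + 2) :=
      mul_basisTensor_mem_weightSpan (k := 1) hJx (one_le_letterWeight y) le_rfl
    have hpair : ellCoeff J * epsTensor x y ∈ weightSpan d (J.length + 2) := by
      by_cases hxy : IsYoungPair x y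
      · rw [hxy.epsTensor_eq_zero, mul_zero]
        exact zero_mem _
      · obtain ⟨⟨i, rfl⟩, j, rfl⟩ := not_not.1 hxy
        exact mul_basisTensor_mem_weightSpan (k := 2) hJ le_rfl one_le_two
    rw [ellCoeff_append, show (J ++ [x, y]).length = J.length + 2 by simp]
    exact Submodule.sub_mem _ hlast (Submodule.smul_mem _ _ hpair)

end Ell

section Comparison

variable {d : ℕ} {p T : ℝ} {X : ℝ → Fin d → ℝ} {X2 : ℝ → ℝ → Matrix (Fin d) (Fin d) ℝ}
  {Y2 : ℝ → ℝ → Matrix (ExtIndex d) (ExtIndex d) ℝ}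
  {S So : ℝ → ℝ → TensorSeries (ExtIndex d)}

namespace IsCanonicalLift

theorem tensorPairing_epsTensor (hY : IsCanonicalLift T X X2 Y2) (hX : IsRoughPath p T X X2)
    (hp : 1 ≤ p) (hp3 : p < 3)
    (hSo : IsLyonsExtension p T (extPath X X2) (correctedLift (extPath X X2) Y2) So)
    (a b : ExtIndex d) {s t : ℝ} (hs : 0 ≤ s) (hst : s ≤ t) (ht : t ≤ T) :
    tensorPairing (epsTensor a b) (So s t) =
      roughBracket (extPath X X2) Y2 t a b - roughBracket (extPath X X2) Y2 s a b := by
  have ht' : t ∈ Set.Icc 0 T := ⟨hs.trans hst, ht⟩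
  have hs' : s ∈ Set.Icc 0 T := ⟨hs, hst.trans ht⟩
  by_cases hab : IsYoungPair a b
  · rw [hab.epsTensor_eq_zero, tensorPairing_zero, hY.roughBracket_eq_zero hX hp hp3 hab ht',
      hY.roughBracket_eq_zero hX hp hp3 hab hs', sub_zero]
  · obtain ⟨⟨i, rfl⟩, j, rfl⟩ := not_not.1 hab
    rw [epsTensor, tensorPairing_basisTensor, hSo.level_one s t hs hst ht,
      hY.roughBracket_path ht', hY.roughBracket_path hs']
    simp only [extPath]
    rcases le_total i j with hij | hij
    · rw [min_eq_left hij, max_eq_right hij]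
    · rw [min_eq_right hij, max_eq_left hij, roughBracket_symm t, roughBracket_symm s]

theorem lyonsExtension_pair (hY : IsCanonicalLift T X X2 Y2) (hX : IsRoughPath p T X X2)
    (hp : 1 ≤ p) (hp3 : p < 3) (hS : IsLyonsExtension p T (extPath X X2) Y2 S)
    (hSo : IsLyonsExtension p T (extPath X X2) (correctedLift (extPath X X2) Y2) So)
    (a b : ExtIndex d) {s t : ℝ} (hs : 0 ≤ s) (hst : s ≤ t) (ht : t ≤ T) :
    S s t [a, b] = ellTranspose (So s t) [a, b] := by
  rw [ellTranspose, ellCoeff_pair, tensorPairing_sub, tensorPairing_smul,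
    tensorPairing_basisTensor, hY.tensorPairing_epsTensor hX hp hp3 hSo a b hs hst ht,
    hS.level_two s t hs hst ht, hSo.level_two s t hs hst ht, correctedLift_apply]
  ring

theorem exists_control_wordWeight (hY : IsCanonicalLift T X X2 Y2) (hX : IsRoughPath p T X X2)
    (hp : 1 ≤ p) (hp3 : p < 3)
    (hSo : IsLyonsExtension p T (extPath X X2) (correctedLift (extPath X X2) Y2) So) {n : ℕ}
    (hn : 3 ≤ n) :
    ∃ h, IsControl T h ∧ ∀ w : List (ExtIndex d), n ≤ wordWeight w → w.length ≤ n →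
      Controlled T h (1 / p + smoothExponent p) fun s t => So s t w := by
  have hp0 : 0 < p := by linarith
  have hσ := add_nonneg (one_div_nonneg.2 hp0.le) (smoothExponent_nonneg hp)
  obtain ⟨h₁, hext⟩ := hX.exists_isExtControl hp
  obtain ⟨h₂, hh₂, hlong⟩ := hSo.exists_control hp0 n
  have hh := hext.control.add hh₂
  refine ⟨_, hh, fun w hw hlen => ?_⟩
  have hw2 := wordWeight_le w
  rcases Nat.lt_or_ge w.length 3 with hlt | hge
  · obtain ⟨a, b, rfl⟩ := List.length_eq_two.1 (show w.length = 2 by omega)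
    have hab : IsYoungPair a b := by
      rintro ⟨⟨i, rfl⟩, j, rfl⟩
      exact absurd (hn.trans hw) (by simp [wordWeight, letterWeight])
    have hYab := (hY.young_pair hX hp hp3 hext hab).1.add_left hext.control hh₂ hσ
    refine hYab.congr fun s t hs hst ht => ?_
    rw [hSo.level_two s t hs hst ht, hY.correctedLift_eq_self hX hp hp3 hab hs hst ht]
  · have hw0 : w ≠ [] := by rintro rfl; simp at hge
    exact ((hlong w hw0 hlen).add_right hext.control hh₂ (by positivity)).mono_exponent hh hσ
      (one_div_add_smoothExponent_le hp0 hge)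

theorem exists_control_weightSpan (hY : IsCanonicalLift T X X2 Y2) (hX : IsRoughPath p T X X2)
    (hp : 1 ≤ p) (hp3 : p < 3)
    (hSo : IsLyonsExtension p T (extPath X X2) (correctedLift (extPath X X2) Y2) So) {n : ℕ}
    (hn : 3 ≤ n) :
    ∃ h, IsControl T h ∧ ∀ l ∈ weightSpan d n,
      Controlled T h (1 / p + smoothExponent p) fun s t => tensorPairing l (So s t) := by
  obtain ⟨h, hh, hword⟩ := hY.exists_control_wordWeight hX hp hp3 hSo hn
  refine ⟨h, hh, fun l hl => ?_⟩
  induction hl using Submodule.span_induction with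
  | mem l hl =>
    obtain ⟨w, ⟨hw, hlen⟩, rfl⟩ := hl
    simpa only [tensorPairing_basisTensor] using hword w hw hlen
  | zero => simpa only [tensorPairing_zero] using Controlled.zero
  | add l m _ _ hl hm => simpa only [tensorPairing_add] using hl.add hm
  | smul c l _ hl => simpa only [tensorPairing_smul] using hl.const_mul c

theorem exists_control_sub_ellTranspose (hY : IsCanonicalLift T X X2 Y2)
    (hX : IsRoughPath p T X X2) (hp : 1 ≤ p) (hp3 : p < 3)
    (hS : IsLyonsExtension p T (extPath X X2) Y2 S)
    (hSo : IsLyonsExtension p T (extPath X X2) (correctedLift (extPath X X2) Y2) So)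
    {I : List (ExtIndex d)} (hI : 3 ≤ I.length) :
    ∃ h, IsControl T h ∧ Controlled T h (1 / p + smoothExponent p) fun s t =>
      S s t I - ellTranspose (So s t) I := by
  have hp0 : 0 < p := by linarith
  have hσ := add_nonneg (one_div_nonneg.2 hp0.le) (smoothExponent_nonneg hp)
  have hI0 : I ≠ [] := by rintro rfl; simp at hI
  obtain ⟨h₁, hh₁, hS_le⟩ := hS.exists_control hp0 I.length
  obtain ⟨h₂, hh₂, hSo_le⟩ := hY.exists_control_weightSpan hX hp hp3 hSo hI
  have hSI := (hS_le I hI0 le_rfl).mono_exponent hh₁ hσ (one_div_add_smoothExponent_le hp0 hI)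
  exact ⟨_, hh₁.add hh₂, (hSI.add_left hh₁ hh₂ hσ).sub
    ((hSo_le _ (ellCoeff_mem_weightSpan I)).add_right hh₁ hh₂ hσ)⟩

end IsCanonicalLift

/-- Both extensions are multiplicative, and so is `ellTranspose`. -/
theorem sub_ellTranspose_add_of_length_lt {Z Zo : ℝ → ExtIndex d → ℝ}
    {Z2 Zo2 : ℝ → ℝ → Matrix (ExtIndex d) (ExtIndex d) ℝ} (hS : IsLyonsExtension p T Z Z2 S)
    (hSo : IsLyonsExtension p T Zo Zo2 So) {I : List (ExtIndex d)}
    (hlt : ∀ v : List (ExtIndex d), v.length < I.length → ∀ s t, 0 ≤ s → s ≤ t → t ≤ T →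
      S s t v = ellTranspose (So s t) v)
    {s u t : ℝ} (hs : 0 ≤ s) (hsu : s ≤ u) (hut : u ≤ t) (ht : t ≤ T) :
    S s t I - ellTranspose (So s t) I = (S s u I - ellTranspose (So s u) I) +
      (S u t I - ellTranspose (So u t) I) := by
  have hleft := tmul_sub_tmul_left (b := S u t) fun v hv => hlt v hv s u hs hsu (hut.trans ht)
  have hright := tmul_sub_tmul_right (a := ellTranspose (So s u))
    fun v hv => hlt v hv u t (hs.trans hsu) hut ht
  rw [hS.level_zero u t (hs.trans hsu) hut ht] at hleft
  rw [ellTranspose_nil, hSo.level_zero s u hs hsu (hut.trans ht)] at hright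
  rw [hS.chen s u t hs hsu hut ht, hSo.chen s u t hs hsu hut ht, ellTranspose_tmul]
  linarith

theorem IsCanonicalLift.lyonsExtension_eq_ellTranspose (hY : IsCanonicalLift T X X2 Y2)
    (hX : IsRoughPath p T X X2) (hp : 1 ≤ p) (hp3 : p < 3)
    (hS : IsLyonsExtension p T (extPath X X2) Y2 S)
    (hSo : IsLyonsExtension p T (extPath X X2) (correctedLift (extPath X X2) Y2) So)
    (I : List (ExtIndex d)) (s t : ℝ) (hs : 0 ≤ s) (hst : s ≤ t) (ht : t ≤ T) :
    S s t I = ellTranspose (So s t) I := by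
  induction hn : I.length using Nat.strong_induction_on generalizing I s t with
  | _ n ih =>
    subst hn
    rcases I with _ | ⟨a, _ | ⟨b, _ | ⟨c, J⟩⟩⟩
    · rw [ellTranspose_nil, hS.level_zero s t hs hst ht, hSo.level_zero s t hs hst ht]
    · rw [ellTranspose_singleton, hS.level_one s t hs hst ht, hSo.level_one s t hs hst ht]
    · exact hY.lyonsExtension_pair hX hp hp3 hS hSo a b hs hst ht
    · obtain ⟨h, hh, hdiff⟩ :=
        hY.exists_control_sub_ellTranspose hX hp hp3 hS hSo (I := a :: b :: c :: J) (by simp)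
      refine sub_eq_zero.1 (hdiff.eq_zero hh (one_lt_one_div_add_smoothExponent hp hp3)
        (fun s u t hs hsu hut ht => ?_) hs hst ht)
      exact sub_ellTranspose_add_of_length_lt hS hSo
        (fun v hv s t hs hst ht => ih v.length hv v s t hs hst ht rfl) hs hsu hut ht

end Comparison

theorem mainTheorem3_general (d : ℕ) (p T : ℝ) (hp : 1 ≤ p) (hp3 : p < 3)
    (X : ℝ → Fin d → ℝ) (X2 : ℝ → ℝ → Matrix (Fin d) (Fin d) ℝ) (hX : IsRoughPath p T X X2) :
    (∃ Y2, IsCanonicalLift T X X2 Y2) ∧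
    ∀ Y2, IsCanonicalLift T X X2 Y2 →
      IsRoughPath p T (extPath X X2) Y2 ∧
      IsWeaklyGeometric p T (extPath X X2) (correctedLift (extPath X X2) Y2) ∧
      (∃ S, IsLyonsExtension p T (extPath X X2) Y2 S) ∧
      (∃ So, IsLyonsExtension p T (extPath X X2) (correctedLift (extPath X X2) Y2) So) ∧
      ∀ S So, IsLyonsExtension p T (extPath X X2) Y2 S →
        IsLyonsExtension p T (extPath X X2) (correctedLift (extPath X X2) Y2) So →
        ∀ t ∈ Set.Icc 0 T,
          TensorSeries.IsGroupLike (So 0 t) ∧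
          ∀ I : List (ExtIndex d),
            tensorPairing (basisTensor I) (S 0 t) = tensorPairing (ellCoeff I) (So 0 t) := by
  have hp0 : 0 < p := by linarith
  refine ⟨hX.exists_isCanonicalLift hp hp3, fun Y2 hY => ?_⟩
  have hYr : IsRoughPath p T (extPath X X2) Y2 := hY.isRoughPath hX hp hp3
  have hYc : IsRoughPath p T (extPath X X2) (correctedLift (extPath X X2) Y2) := hYr.corrected hp0
  refine ⟨hYr, hYr.isWeaklyGeometric_corrected hp0, hYr.exists_lyonsExtension hp0 hp3,
    hYc.exists_lyonsExtension hp0 hp3, fun S So hS hSo t ht => ⟨?_, fun I => ?_⟩⟩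
  · have hshuffle : IsShuffleCharacter (So 0 t) := hSo.isShuffleCharacter hp0 hp3
      (fun s t hs hst ht => hYr.correctedLift_add_swap hs hst ht) le_rfl ht.1 ht.2
    exact hshuffle.isGroupLike
  · rw [tensorPairing_basisTensor]
    exact hY.lyonsExtension_eq_ellTranspose hX hp hp3 hS hSo I 0 t le_rfl ht.1 ht.2

theorem mainTheorem3 (d : ℕ) (p T : ℝ) (hp2 : 2 < p) (hp3 : p < 3) (hT : 0 < T)
    (X : ℝ → Fin d → ℝ) (X2 : ℝ → ℝ → Matrix (Fin d) (Fin d) ℝ) (hX : IsRoughPath p T X X2) :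
    (∃ Y2, IsCanonicalLift T X X2 Y2) ∧
    ∀ Y2, IsCanonicalLift T X X2 Y2 →
      IsRoughPath p T (extPath X X2) Y2 ∧
      IsWeaklyGeometric p T (extPath X X2) (correctedLift (extPath X X2) Y2) ∧
      (∃ S, IsLyonsExtension p T (extPath X X2) Y2 S) ∧
      (∃ So, IsLyonsExtension p T (extPath X X2) (correctedLift (extPath X X2) Y2) So) ∧
      ∀ S So, IsLyonsExtension p T (extPath X X2) Y2 S →
        IsLyonsExtension p T (extPath X X2) (correctedLift (extPath X X2) Y2) So →
        ∀ t ∈ Set.Icc 0 T,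
          TensorSeries.IsGroupLike (So 0 t) ∧
          ∀ I : List (ExtIndex d),
            tensorPairing (basisTensor I) (S 0 t) = tensorPairing (ellCoeff I) (So 0 t) :=
  mainTheorem3_general d p T (by linarith) hp3 X X2 hX
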